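/- **Setting.** Let $(N^4,g)$ be a smooth spacetime of signature $(-,+,+,+)$, given on an open set $U\subset\mathbb R^4$ with coordinates $(t,x,y,z)$, time-oriented by $t$, whose slice $\mathcal S=\{t=0\}$ is spacelike. Assume it is axisymmetric without angular momentum: the rotations about the $z$-axis and the reflection $\varphi\mapsto-\varphi$ (that is, $y\mapsto -y$) preserve $U$ and are isometries. Let $u$ be the future unit normal of $\mathcal S$. For a closed surface $\Sigma\subset\mathcal S$ with induced metric $\sigma$ and outward unit normal $v$ in $\mathcal S$, put $\ell^\pm=u\pm v$ and $\Theta_\pm=\sigma^{ab}\langle\nabla_a\ell^\pm,\partial_b\rangle$. Let $H$ be its mean curvature vector; where $H$ is spacelike let $|H|=\sqrt{\langle H,H\rangle}$, $e_H=-H/|H|$, let $e_J$ be the future timelike unit normal orthogonal to $H$, and $\alpha_H=\langle\nabla e_H,e_J\rangle$. For an isometric immersion $i_0:\Sigma\to\mathbb R^{3,1}$ with mean curvature vector $H_0$ let $\alpha_{H_0}$ be the analogous form, $\tau=-\langle i_0,\partial_t\rangle$ its time function, $$\rho=\frac{\sqrt{|H_0|^2+\frac{(\Delta\tau)^2}{1+|\nabla\tau|^2}}-\sqrt{|H|^2+\frac{(\Delta\tau)^2}{1+|\nabla\tau|^2}}}{\sqrt{1+|\nabla\tau|^2}},\qquad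 j_a=\rho\nabla_a\tau-\nabla_a\sinh^{-1}\frac{\rho\,\Delta\tau}{|H_0||H|}-(\alpha_{H_0})_a+(\alpha_H)_a .$$ The optimal embedding equation is $\nabla_aj^a=0$; for a solution, $\mathrm{QLM}(\Sigma)=\frac1{8\pi}\int_\Sigma\rho$. **Theorem.** Let $(\Sigma_s)_{0\le s<s_0}$ be a family of smooth, immersed, axisymmetric spheres in $\mathcal S$ with constant expansion $\Theta_+=s$, converging smoothly as $s\to0^+$ to the marginally outer trapped surface $\Sigma_0$. Assume that either $\Theta_-<0$ on $\Sigma_0$ (so that $H$ becomes null), or $\mathcal S$ is time symmetric, i.e. its second fundamental form vanishes (so that $H\to0$). For every $0<s<s_0$ assume that $H$ is spacelike on $\Sigma_s$, and let $i_0^{(s)}:\Sigma_s\to\mathbb R^{3,1}$ be a smooth axisymmetric isometric immersion, of the form $(\theta,\varphi)\mapsto(\tau_s(\theta),R_s(\theta)\cos\varphi,R_s(\theta)\sin\varphi,Z_s(\theta))$, whose mean curvature vector $H_0$ is spacelike and whose time function $\tau_s$ solves the optimal embedding equation. Then, as $s\to0^+$, 1. $\tau_s$ tends to a constant: $\tau_s-\tau_s(\text{north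 pole})\to0$, $|\nabla\tau_s|^2\to0$ and $\Delta\tau_s\to0$, uniformly on $\Sigma_s$; 2. $j=0$ on $\Sigma_s$ for every $0<s<s_0$, and hence also in the limit; 3. $\mathrm{QLM}(\Sigma_s)-\frac1{8\pi}\int_{\Sigma_s}|H_0|\to0$. -/

import Mathlib

open Set Filter Topology MeasureTheory
open scoped ContDiff Matrix

namespace WangYau

noncomputable section

/-- Coordinate vectors of a parameter domain, of the space containing the unit sphere, and of a
spacetime with coordinates `(x⁰, x¹, x², x³) = (t, x, y, z)`. -/
abbrev R2 : Type := Fin 2 → ℝ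
abbrev R3 : Type := Fin 3 → ℝ
abbrev R4 : Type := Fin 4 → ℝ

/-- The coefficient matrix of a bilinear form on `R4`. -/
abbrev Form : Type := Matrix (Fin 4) (Fin 4) ℝ

/-! ### Lorentzian metrics in coordinates -/

/-- The Minkowski metric, of signature `(-,+,+,+)`. -/
def minkowski : Form := Matrix.diagonal ![-1, 1, 1, 1]

/-- The bilinear form with matrix `A`. -/
def ip (A : Form) (v w : R4) : ℝ := v ⬝ᵥ (A *ᵥ w)

/-- A symmetric form of signature `(-,+,+,+)`. -/
def IsLorentzian (A : Form) : Prop :=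
  ∃ B : Form, IsUnit B.det ∧ Bᵀ * A * B = minkowski

/-- `∂_α g_{μν}` at the point `p`. -/
def metricDeriv (g : R4 → Form) (p : R4) (α μ ν : Fin 4) : ℝ :=
  fderiv ℝ (fun q => g q μ ν) p (Pi.single α 1)

/-- The Christoffel symbol `Γ^μ_{αβ}` of `g` at `p`. -/
def christoffel (g : R4 → Form) (p : R4) (μ α β : Fin 4) : ℝ :=
  (1 / 2) * ∑ ν, (g p)⁻¹ μ ν *
    (metricDeriv g p α ν β + metricDeriv g p β ν α - metricDeriv g p ν α β)

/-- For a Lorentzian form whose restriction to `{w | w 0 = 0}` is positive definite: the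
future-pointing (`u⁰ > 0`) unit timelike vector orthogonal to that subspace,
`u^μ = - g^{μ0} / √(-g^{00})`. For the Minkowski metric it is `T₀ = ∂_t`. -/
def timeNormal (A : Form) : R4 := fun μ => -(A⁻¹ μ 0) / √(-(A⁻¹ 0 0))

/-- The second fundamental form `⟨∇_{∂_i} u, ∂_j⟩ = -⟨u, ∇_{∂_i} ∂_j⟩` of the hypersurface
`t = const` (used for spatial indices `i, j ≠ 0`). -/
def sliceSecondForm (g : R4 → Form) (p : R4) (i j : Fin 4) : ℝ :=
  -ip (g p) (timeNormal (g p)) (fun μ => christoffel g p μ i j)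

/-! ### Spacelike surfaces, given by a parametrization `X : R2 → R4` -/

/-- Partial derivative with respect to the parameter `y^a`. -/
def pd {E : Type*} [NormedAddCommGroup E] [NormedSpace ℝ E] (a : Fin 2) (f : R2 → E) (y : R2) : E :=
  fderiv ℝ f y (Pi.single a 1)

/-- The covariant derivative `∇_{∂_a X} W` of a vector field `W` along `X`. -/
def covD (g : R4 → Form) (X : R2 → R4) (a : Fin 2) (W : R2 → R4) (y : R2) : R4 :=
  fun μ => pd a W y μ + ∑ α, ∑ β, christoffel g (X y) μ α β * pd a X y α * W y β

/-- The induced metric `σ_{ab}`. -/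
def firstForm (g : R4 → Form) (X : R2 → R4) (y : R2) : Matrix (Fin 2) (Fin 2) ℝ :=
  Matrix.of fun a b => ip (g (X y)) (pd a X y) (pd b X y)

/-- The area density `√(det σ)`. -/
def areaDensity (g : R4 → Form) (X : R2 → R4) (y : R2) : ℝ := √((firstForm g X y).det)

/-- The component of `w` normal to the surface. -/
def normalPart (g : R4 → Form) (X : R2 → R4) (y : R2) (w : R4) : R4 :=
  w - ∑ a, ∑ b, ((firstForm g X y)⁻¹ a b * ip (g (X y)) w (pd b X y)) • pd a X y

/-- The mean curvature vector `H = σ^{ab} (∇_a ∂_b X)^⊥`. -/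
def meanCurv (g : R4 → Form) (X : R2 → R4) (y : R2) : R4 :=
  ∑ a, ∑ b, (firstForm g X y)⁻¹ a b • normalPart g X y (covD g X a (fun z => pd b X z) y)

/-- `⟨H, H⟩`. -/
def meanCurvSq (g : R4 → Form) (X : R2 → R4) (y : R2) : ℝ :=
  ip (g (X y)) (meanCurv g X y) (meanCurv g X y)

/-- `|H|`, for `H` spacelike. -/
def meanCurvNorm (g : R4 → Form) (X : R2 → R4) (y : R2) : ℝ := √(meanCurvSq g X y)

/-- The future-pointing unit normal `u` of the hypersurface `t = const`, along the surface. -/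
def sliceNormal (g : R4 → Form) (X : R2 → R4) (y : R2) : R4 := timeNormal (g (X y))

/-- A vector orthogonal to `u` and to the surface, on the side fixed by the orientation:
`⟨N, w⟩ = det (u, w, ∂₀X, ∂₁X)` for all `w`. -/
def outDirection (g : R4 → Form) (X : R2 → R4) (y : R2) : R4 :=
  (g (X y))⁻¹ *ᵥ fun μ =>
    (Matrix.of ![sliceNormal g X y, Pi.single μ 1, pd 0 X y, pd 1 X y] : Form).det

/-- The outward unit normal `v` of the surface in the hypersurface `t = const`. -/
def outNormal (g : R4 → Form) (X : R2 → R4) (y : R2) : R4 :=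
  (√(ip (g (X y)) (outDirection g X y) (outDirection g X y)))⁻¹ • outDirection g X y

/-- The null normals `ℓ⁺ = u + v` and `ℓ⁻ = u - v`. -/
def ellPlus (g : R4 → Form) (X : R2 → R4) (y : R2) : R4 := sliceNormal g X y + outNormal g X y
def ellMinus (g : R4 → Form) (X : R2 → R4) (y : R2) : R4 := sliceNormal g X y - outNormal g X y

/-- The expansion `σ^{ab} ⟨∇_a ℓ, ∂_b X⟩` of a normal field `ℓ`. -/
def expansion (g : R4 → Form) (X : R2 → R4) (l : R2 → R4) (y : R2) : ℝ :=
  ∑ a, ∑ b, (firstForm g X y)⁻¹ a b * ip (g (X y)) (covD g X a l y) (pd b X y)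

/-- The outward and inward null expansions. -/
def thetaPlus (g : R4 → Form) (X : R2 → R4) (y : R2) : ℝ := expansion g X (ellPlus g X) y
def thetaMinus (g : R4 → Form) (X : R2 → R4) (y : R2) : ℝ := expansion g X (ellMinus g X) y

/-- `e_H = -H / |H|`. -/
def eH (g : R4 → Form) (X : R2 → R4) (y : R2) : R4 :=
  -((meanCurvNorm g X y)⁻¹ • meanCurv g X y)

/-- The component of the future timelike vector `u` that is orthogonal to the surface and to `H`. -/
def conjDirection (g : R4 → Form) (X : R2 → R4) (y : R2) : R4 :=
  normalPart g X y (sliceNormal g X y) -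
    (ip (g (X y)) (sliceNormal g X y) (meanCurv g X y) / meanCurvSq g X y) • meanCurv g X y

/-- `e_J = J / |H|`: the future-pointing timelike unit normal orthogonal to `H`. -/
def eJ (g : R4 → Form) (X : R2 → R4) (y : R2) : R4 :=
  (√(-ip (g (X y)) (conjDirection g X y) (conjDirection g X y)))⁻¹ • conjDirection g X y

/-- The connection one-form `(α_H)_a = ⟨∇_a e_H, e_J⟩` in the mean curvature gauge. -/
def alphaH (g : R4 → Form) (X : R2 → R4) (a : Fin 2) (y : R2) : ℝ :=
  ip (g (X y)) (covD g X a (eH g X) y) (eJ g X y)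

/-- The divergence `∇_a f^a` of a one-form `f` on the surface. -/
def divergence (g : R4 → Form) (X : R2 → R4) (f : Fin 2 → R2 → ℝ) (y : R2) : ℝ :=
  (areaDensity g X y)⁻¹ *
    ∑ a, pd a (fun z => areaDensity g X z * ∑ b, (firstForm g X z)⁻¹ a b * f b z) y

/-- The Laplace-Beltrami operator `Δf` of the surface. -/
def laplacian (g : R4 → Form) (X : R2 → R4) (f : R2 → ℝ) (y : R2) : ℝ :=
  divergence g X (fun a z => pd a f z) y

/-- `|∇f|²`. -/
def gradSq (g : R4 → Form) (X : R2 → R4) (f : R2 → ℝ) (y : R2) : ℝ :=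
  ∑ a, ∑ b, (firstForm g X y)⁻¹ a b * pd a f y * pd b f y

/-! ### The Wang-Yau data of a surface `X` with reference embedding `X₀` into Minkowski space -/

/-- The flat metric as a metric field. -/
def flat : R4 → Form := fun _ => minkowski

/-- The time function `τ = -⟨X₀, T₀⟩` of the reference embedding. -/
def timeFn (X₀ : R2 → R4) (y : R2) : ℝ := X₀ y 0

/-- The mass density `ρ`. -/
def massDensity (g : R4 → Form) (X X₀ : R2 → R4) (y : R2) : ℝ :=
  (√(meanCurvSq flat X₀ y
        + laplacian g X (timeFn X₀) y ^ 2 / (1 + gradSq g X (timeFn X₀) y))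
    - √(meanCurvSq g X y
        + laplacian g X (timeFn X₀) y ^ 2 / (1 + gradSq g X (timeFn X₀) y)))
    / √(1 + gradSq g X (timeFn X₀) y)

/-- The one-form
`j_a = ρ ∇_a τ - ∇_a sinh⁻¹(ρ Δτ / (|H₀| |H|)) - (α_{H₀})_a + (α_H)_a`. -/
def flux (g : R4 → Form) (X X₀ : R2 → R4) (a : Fin 2) (y : R2) : ℝ :=
  massDensity g X X₀ y * pd a (timeFn X₀) y
    - pd a (fun z => Real.arsinh (massDensity g X X₀ z * laplacian g X (timeFn X₀) z /
        (meanCurvNorm flat X₀ z * meanCurvNorm g X z))) y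
    - alphaH flat X₀ a y + alphaH g X a y

/-! ### Spheres and axisymmetry -/

def unitSphere : Set R3 := {x | x 0 ^ 2 + x 1 ^ 2 + x 2 ^ 2 = 1}

/-- Polar coordinates `y = (θ, φ)` on the unit sphere. -/
def polar (y : R2) : R3 :=
  ![Real.sin (y 0) * Real.cos (y 1), Real.sin (y 0) * Real.sin (y 1), Real.cos (y 0)]

/-- The range `0 < θ < π` of the polar coordinates; it covers the sphere except the poles. -/
def polarDomain : Set R2 := {y | 0 < y 0 ∧ y 0 < Real.pi}

/-- A fundamental domain of the polar coordinates, for integration. -/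
def polarCell : Set R2 := {y | 0 < y 0 ∧ y 0 < Real.pi ∧ 0 < y 1 ∧ y 1 < 2 * Real.pi}

/-- The surface with parametrization `F : S² → R4`, in polar coordinates. -/
def patch (F : R3 → R4) : R2 → R4 := fun y => F (polar y)

/-- `(1/8π) ∫_Σ f dvol` for the closed surface `F : S² → R4`. -/
def surfaceMean (g : R4 → Form) (F : R3 → R4) (f : R2 → ℝ) : ℝ :=
  (1 / (8 * Real.pi)) * ∫ y in polarCell, f y * areaDensity g (patch F) y

/-- The Wang-Yau quasi-local mass `(1/8π) ∫_Σ ρ` determined by the reference embedding `G`, for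
`G` whose time function solves the optimal embedding equation. -/
def quasiLocalMass (g : R4 → Form) (F G : R3 → R4) : ℝ :=
  surfaceMean g F (massDensity g (patch F) (patch G))

/-- The mean curvature vector is spacelike at every point of the closed surface. The surface is
compact and `⟨H, H⟩` is continuous on it, so this is a positive lower bound off the poles. -/
def SpacelikeMeanCurvature (g : R4 → Form) (F : R3 → R4) : Prop :=
  ∃ c > 0, ∀ y ∈ polarDomain, c ≤ meanCurvSq g (patch F) y

/-- Rotation about the axis and reflection `φ ↦ -φ`, on the two kinds of coordinate space. -/
def rot3 (φ : ℝ) (x : R3) : R3 :=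
  ![Real.cos φ * x 0 - Real.sin φ * x 1, Real.sin φ * x 0 + Real.cos φ * x 1, x 2]
def refl3 (x : R3) : R3 := ![x 0, -x 1, x 2]
def rot4 (φ : ℝ) (p : R4) : R4 :=
  ![p 0, Real.cos φ * p 1 - Real.sin φ * p 2, Real.sin φ * p 1 + Real.cos φ * p 2, p 3]
def refl4 (p : R4) : R4 := ![p 0, p 1, -p 2, p 3]

/-- A parametrized sphere that is invariant under rotations and `φ ↦ -φ`, with an equivariant
parametrization; in polar coordinates,
`(θ, φ) ↦ (T(θ), R(θ) cos φ, R(θ) sin φ, Z(θ))`. -/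
def Axisymmetric (F : R3 → R4) : Prop :=
  ∀ x ∈ unitSphere, (∀ φ, F (rot3 φ x) = rot4 φ (F x)) ∧ F (refl3 x) = refl4 (F x)

/-- `v` is tangent to the unit sphere at `x`. -/
def IsTangent (x v : R3) : Prop := x ⬝ᵥ v = 0

/-- `F` restricts to an immersion of the unit sphere. -/
def IsImmersedSphere (F : R3 → R4) : Prop :=
  ∀ x ∈ unitSphere, ∀ v, IsTangent x v → fderiv ℝ F x v = 0 → v = 0

/-- `G` is an isometric embedding into Minkowski space of the surface `F`: both induce the same
metric on the sphere. -/
def IsIsometricReference (g : R4 → Form) (F G : R3 → R4) : Prop :=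
  ∀ x ∈ unitSphere, ∀ v w, IsTangent x v → IsTangent x w →
    ip minkowski (fderiv ℝ G x v) (fderiv ℝ G x w) = ip (g (F x)) (fderiv ℝ F x v) (fderiv ℝ F x w)

/-- A smooth spacetime on an open set `U`, time-oriented by `t`, whose slice `{t = 0}` is spacelike,
and which is axisymmetric without angular momentum: rotations about the axis and the reflection
`φ ↦ -φ` are isometries. -/
structure IsAxisymmetricSpacetime (U : Set R4) (g : R4 → Form) : Prop where
  isOpen : IsOpen U
  smooth : ∀ μ ν, ContDiffOn ℝ ∞ (fun p => g p μ ν) U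
  lorentzian : ∀ p ∈ U, IsLorentzian (g p)
  slice_spacelike : ∀ p ∈ U, p 0 = 0 → ∀ w : R4, w 0 = 0 → w ≠ 0 → 0 < ip (g p) w w
  rot_mem : ∀ φ, ∀ p ∈ U, rot4 φ p ∈ U
  rot_isometry : ∀ φ, ∀ p ∈ U, ∀ v w,
    ip (g (rot4 φ p)) (rot4 φ v) (rot4 φ w) = ip (g p) v w
  refl_mem : ∀ p ∈ U, refl4 p ∈ U
  refl_isometry : ∀ p ∈ U, ∀ v w, ip (g (refl4 p)) (refl4 v) (refl4 w) = ip (g p) v w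

/-- The slice `{t = 0}` is time symmetric: its second fundamental form vanishes. -/
def IsTimeSymmetric (U : Set R4) (g : R4 → Form) : Prop :=
  ∀ p ∈ U, p 0 = 0 → ∀ i j : Fin 4, i ≠ 0 → j ≠ 0 → sliceSecondForm g p i j = 0

/-- A family `Σ_s`, `0 ≤ s < s₀`, of axisymmetric closed surfaces in the slice `{t = 0}` with
constant expansion `Θ₊ = s`, converging smoothly as `s → 0⁺` to the marginally outer trapped
surface `Σ₀`. -/
structure IsConstantExpansionFamily (U : Set R4) (g : R4 → Form) (s₀ : ℝ) (F : ℝ → R3 → R4) :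
    Prop where
  smooth : ∀ s ∈ Ico 0 s₀, ContDiff ℝ ∞ (F s)
  immersed : ∀ s ∈ Ico 0 s₀, IsImmersedSphere (F s)
  mem : ∀ s ∈ Ico 0 s₀, ∀ x ∈ unitSphere, F s x ∈ U
  mem_slice : ∀ s ∈ Ico 0 s₀, ∀ x ∈ unitSphere, F s x 0 = 0
  axisymmetric : ∀ s ∈ Ico 0 s₀, Axisymmetric (F s)
  converges : ∀ n : ℕ, TendstoUniformlyOn (fun s x => iteratedFDeriv ℝ n (F s) x)
    (fun x => iteratedFDeriv ℝ n (F 0) x) (𝓝[>] 0) unitSphere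
  expansion_eq : ∀ s ∈ Ico 0 s₀, ∀ y ∈ polarDomain, thetaPlus g (patch (F s)) y = s

/-- The closed surface `F` has `Θ₋ < 0` at every point (by compactness, a negative upper bound off
the poles). -/
def InwardTrapped (g : R4 → Form) (F : R3 → R4) : Prop :=
  ∃ c > 0, ∀ y ∈ polarDomain, thetaMinus g (patch F) y ≤ -c

end

end WangYau

open WangYau

/-! Axisymmetry reduces everything to ordinary differential equations in the polar angle θ along
profile curves with speed l and orbit radius r. The reflection symmetry kills the φ-components of
both connection forms, so only the θ-component of j survives.

On Σ_s put m = −Θ₋. Then |H|² = s m, and α_H is the connection form α of the slice frame plus the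
differential of the boost angle slip = (log s − log m)/2. For the reference surface let S = τ'/l be
the tilt, W = √(1+S²), x = Δτ/W the expansion of the normalized normal part of ∂_t, k the expansion
of the unit normal orthogonal to ∂_t, and f the sine of the angle of the profile projected to ℝ³;
then |H₀|² = k² − x². The subtraction formula `arsinh_sub_arsinh` splits the arsinh term of j into
two boost angles. One of them cancels the boost in α_{H₀}, the curvature k cancels between ρτ' and
α_{H₀}, and `flux_eq` leaves j_θ = (τ'/W)(f/r − √(s m + x²)) + α − (y − slip)', where y =
arsinh(x/|H|).

Vanishing of j: the optimal embedding equation integrates to (r/l) j_θ = C. For fixed s the angle y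
− slip and the remaining terms stay bounded at the pole, whereas C ≠ 0 would make y − slip grow like
log θ. Hence C = 0 (`IsClosedPair.profileFlux_eq_zero`).

Bound of y, uniform in s: the quantity q = r S vanishes at both poles and satisfies q' = l r W |H|
sinh y, while j = 0 prescribes η' for η = y − slip. Positive mean curvature of the projection gives
a lower bound of f/r (`curvature_lower`). Where q > 0 also τ' > 0, so η' is bounded below. An
interval on which q > 0 contains, arbitrarily near its left end, points with q' > 0, that is y > 0;
from there y cannot fall far. The same argument run from the right end shows that y cannot be large.
This is `angle_bound`. It uses slip only through its oscillation about a constant.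

Consequences: x = |H| sinh y is O(√s). Integrating q' from the poles gives |q| = O(√s θ²) near a
pole, and division by r makes the tilt O(√s) (`abs_tilt_le_of_dilation`); this controls τ, ∇τ and
Δτ. The difference ρ − |H₀| is at most a small multiple of k plus a small constant. Although k has
no pointwise bound, r l k is positive and dominated by a derivative plus a constant, so its integral
is bounded (`integral_curvature_le`).

The two alternatives for the limit enter only in `exists_slip_bounds`, which asks that |H| → 0 and
that slip has bounded oscillation: either m lies between positive constants, or m = s. All geometric
constants are uniform because the profile curves converge with two derivatives; singular quotients
at the poles are handled by l'Hospital's rule for families (`exists_profileBounds`). -/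

namespace WangYau
noncomputable section

/-! ### Rotations about the axis and rotating fields -/

/-- The generator of the rotations about the axis. -/
def rotGen (v : R4) : R4 := ![0, -v 2, v 1, 0]

/-- The meridian `φ = 0` of the unit sphere. -/
def meridian (θ : ℝ) : R3 := ![Real.sin θ, 0, Real.cos θ]

/-- The profile curve of a parametrized sphere. -/
def curve (F : R3 → R4) (θ : ℝ) : R4 := F (meridian θ)

/-- The field along the polar coordinate domain obtained by rotating a field along the meridian. -/
def spin (w : ℝ → R4) (y : R2) : R4 := rot4 (y 1) (w (y 0))

lemma rot4_add (φ : ℝ) (v w : R4) : rot4 φ (v + w) = rot4 φ v + rot4 φ w := by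
  ext i; fin_cases i <;> simp [rot4] <;> ring

lemma rot4_smul (φ c : ℝ) (v : R4) : rot4 φ (c • v) = c • rot4 φ v := by
  ext i; fin_cases i <;> simp [rot4] <;> ring

lemma rot4_sub (φ : ℝ) (v w : R4) : rot4 φ (v - w) = rot4 φ v - rot4 φ w := by
  ext i; fin_cases i <;> simp [rot4] <;> ring

lemma refl4_add (v w : R4) : refl4 (v + w) = refl4 v + refl4 w := by
  ext i; fin_cases i <;> simp [refl4]; ring

lemma refl4_smul (c : ℝ) (v : R4) : refl4 (c • v) = c • refl4 v := by
  ext i; fin_cases i <;> simp [refl4]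

lemma rot4_neg_rot4 (φ : ℝ) (v : R4) : rot4 φ (rot4 (-φ) v) = v := by
  have h := Real.sin_sq_add_cos_sq φ
  ext i
  fin_cases i
  · simp [rot4]
  · simp [rot4]; linear_combination (v 1) * h
  · simp [rot4]; linear_combination (v 2) * h
  · simp [rot4]

lemma rot4_pi (v : R4) : rot4 Real.pi v = ![v 0, -v 1, -v 2, v 3] := by
  ext i; fin_cases i <;> simp [rot4]

/-- The rotation as a continuous linear map. -/
def rotL (φ : ℝ) : R4 →L[ℝ] R4 :=
  LinearMap.toContinuousLinearMap
    { toFun := rot4 φ, map_add' := rot4_add φ, map_smul' := fun c v => rot4_smul φ c v }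

/-- The reflection as a continuous linear map. -/
def reflL : R4 →L[ℝ] R4 :=
  LinearMap.toContinuousLinearMap
    { toFun := refl4, map_add' := refl4_add, map_smul' := fun c v => refl4_smul c v }

@[simp] lemma rotL_apply (φ : ℝ) (v : R4) : rotL φ v = rot4 φ v := rfl
@[simp] lemma reflL_apply (v : R4) : reflL v = refl4 v := rfl

lemma polar_eq (y : R2) : polar y = rot3 (y 1) (meridian (y 0)) := by
  ext i; fin_cases i <;> simp [polar, rot3, meridian] <;> ring

lemma meridian_mem (θ : ℝ) : meridian θ ∈ unitSphere := by
  simp [unitSphere, meridian]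

/-- Equivariance makes each sphere the rotated copy of its meridian curve, so geometric quantities
need only be computed at φ = 0. -/
lemma patch_eq_spin {F : R3 → R4} (hF : Axisymmetric F) : patch F = spin (curve F) := by
  ext1 y
  rw [patch, polar_eq, (hF _ (meridian_mem _)).1]; rfl

lemma contDiff_meridian : ContDiff ℝ ∞ meridian := by
  rw [contDiff_pi]
  intro i
  fin_cases i
  · exact Real.contDiff_sin
  · exact contDiff_const
  · exact Real.contDiff_cos

lemma contDiff_curve {F : R3 → R4} (hF : ContDiff ℝ ∞ F) : ContDiff ℝ ∞ (curve F) :=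
  hF.comp contDiff_meridian

/-- The reflection φ ↦ −φ fixes the meridian, so the y-coordinate equals its own negative there. -/
lemma curve_two {F : R3 → R4} (hF : Axisymmetric F) (θ : ℝ) : curve F θ 2 = 0 := by
  have h := (hF _ (meridian_mem θ)).2
  have h1 : refl3 (meridian θ) = meridian θ := by
    ext i; fin_cases i <;> simp [refl3, meridian]
  rw [h1] at h
  have := congrFun h 2
  simp [refl4] at this
  simp only [curve]; linarith

/-- Continuing the meridian past the pole is the same as rotating it by π; this parity determines
the behaviour of the curve at the poles. -/
lemma curve_neg {F : R3 → R4} (hF : Axisymmetric F) (θ : ℝ) :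
    curve F (-θ) = rot4 Real.pi (curve F θ) := by
  rw [curve, curve, ← (hF _ (meridian_mem θ)).1]
  congr 1
  ext i; fin_cases i <;> simp [rot3, meridian]

lemma curve_periodic {F : R3 → R4} (θ : ℝ) : curve F (2 * Real.pi - θ) = curve F (-θ) := by
  rw [curve, curve]
  congr 1
  ext i; fin_cases i <;> simp [meridian, Real.sin_two_pi_sub, Real.cos_two_pi_sub]

/-- The φ-derivative of a rotated vector is the rotated image under the generator, so both partial
derivatives of a rotating field are again rotating fields. -/
lemma hasFDerivAt_spin {w : ℝ → R4} {y : R2} {w' : R4} (hw : HasDerivAt w w' (y 0)) :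
    HasFDerivAt (spin w)
      ((ContinuousLinearMap.proj (R := ℝ) (φ := fun _ : Fin 2 => ℝ) 0).smulRight (rot4 (y 1) w') +
        (ContinuousLinearMap.proj (R := ℝ) (φ := fun _ : Fin 2 => ℝ) 1).smulRight
          (rot4 (y 1) (rotGen (w (y 0))))) y := by
  have h0 : HasFDerivAt (fun y : R2 => y 0)
      (ContinuousLinearMap.proj (R := ℝ) (φ := fun _ : Fin 2 => ℝ) 0) y := hasFDerivAt_apply 0 y
  have h1 : HasFDerivAt (fun y : R2 => y 1)
      (ContinuousLinearMap.proj (R := ℝ) (φ := fun _ : Fin 2 => ℝ) 1) y := hasFDerivAt_apply 1 y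
  have hc : ∀ i, HasFDerivAt (fun y : R2 => w (y 0) i)
      (w' i • ContinuousLinearMap.proj (R := ℝ) (φ := fun _ : Fin 2 => ℝ) 0) y := fun i => by
    have h2 : HasDerivAt (fun t => w t i) (w' i) (y 0) := hasDerivAt_pi.1 hw i
    exact h2.comp_hasFDerivAt y h0
  have hcos := h1.cos
  have hsin := h1.sin
  rw [hasFDerivAt_pi']
  intro i
  fin_cases i
  · refine (hc 0).congr_fderiv ?_
    ext v; simp [rot4, rotGen, mul_comm]
  · refine ((hcos.mul (hc 1)).sub (hsin.mul (hc 2))).congr_fderiv ?_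
    ext v; simp [rot4, rotGen]; ring
  · refine ((hsin.mul (hc 1)).add (hcos.mul (hc 2))).congr_fderiv ?_
    ext v; simp [rot4, rotGen]; ring
  · refine (hc 3).congr_fderiv ?_
    ext v; simp [rot4, rotGen, mul_comm]

lemma pd_zero_spin {w : ℝ → R4} {y : R2} (hw : DifferentiableAt ℝ w (y 0)) :
    pd 0 (spin w) y = rot4 (y 1) (deriv w (y 0)) := by
  rw [pd, (hasFDerivAt_spin hw.hasDerivAt).fderiv]; simp

lemma pd_one_spin {w : ℝ → R4} {y : R2} (hw : DifferentiableAt ℝ w (y 0)) :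
    pd 1 (spin w) y = rot4 (y 1) (rotGen (w (y 0))) := by
  rw [pd, (hasFDerivAt_spin hw.hasDerivAt).fderiv]; simp

lemma pd_of_zero {h : ℝ → ℝ} {y : R2} {h' : ℝ} (hh : HasDerivAt h h' (y 0)) :
    pd 0 (fun z => h (z 0)) y = h' ∧ pd 1 (fun z => h (z 0)) y = 0 := by
  have h0 : HasFDerivAt (fun y : R2 => y 0)
      (ContinuousLinearMap.proj (R := ℝ) (φ := fun _ : Fin 2 => ℝ) 0) y := hasFDerivAt_apply 0 y
  have := (hh.hasFDerivAt.comp y h0).fderiv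
  have e : (h ∘ fun y : R2 => y 0) = fun z => h (z 0) := rfl
  rw [e] at this
  constructor <;> rw [pd, this] <;> simp

lemma isOpen_polarDomain : IsOpen polarDomain :=
  (isOpen_lt continuous_const (continuous_apply 0)).inter
    (isOpen_lt (continuous_apply 0) continuous_const)

lemma pd_congr {E : Type*} [NormedAddCommGroup E] [NormedSpace ℝ E] {f h : R2 → E} {y : R2}
    {a : Fin 2} (H : f =ᶠ[𝓝 y] h) : pd a f y = pd a h y := by
  rw [pd, pd, H.fderiv_eq]

/-- A function of `θ` alone, near a point. -/
lemma pd_eq_of_polar {f : R2 → ℝ} {h : ℝ → ℝ} {h' : ℝ} {y : R2} (hy : y ∈ polarDomain)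
    (H : ∀ z ∈ polarDomain, f z = h (z 0)) (hh : HasDerivAt h h' (y 0)) :
    pd 0 f y = h' ∧ pd 1 f y = 0 := by
  have : f =ᶠ[𝓝 y] fun z => h (z 0) := by
    filter_upwards [isOpen_polarDomain.mem_nhds hy] with z hz using H z hz
  rw [pd_congr this, pd_congr this]
  exact pd_of_zero hh

end
end WangYau

namespace WangYau
noncomputable section

/-! ### Bilinear algebra -/

lemma ip_eq_sum (A : Form) (v w : R4) : ip A v w = ∑ i, ∑ j, v i * (A i j * w j) := by
  simp [ip, dotProduct, Matrix.mulVec, Finset.mul_sum]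

lemma ip_add_left (A : Form) (v w z : R4) : ip A (v + w) z = ip A v z + ip A w z := by
  simp [ip, add_dotProduct]
lemma ip_add_right (A : Form) (v w z : R4) : ip A z (v + w) = ip A z v + ip A z w := by
  simp [ip, Matrix.mulVec_add, dotProduct_add]
lemma ip_sub_left (A : Form) (v w z : R4) : ip A (v - w) z = ip A v z - ip A w z := by
  simp [ip, sub_dotProduct]
lemma ip_sub_right (A : Form) (v w z : R4) : ip A z (v - w) = ip A z v - ip A z w := by
  simp [ip, Matrix.mulVec_sub, dotProduct_sub]
lemma ip_smul_left (A : Form) (c : ℝ) (v z : R4) : ip A (c • v) z = c * ip A v z := by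
  simp [ip]
lemma ip_smul_right (A : Form) (c : ℝ) (v z : R4) : ip A z (c • v) = c * ip A z v := by
  simp [ip, Matrix.mulVec_smul]
lemma ip_neg_right (A : Form) (v z : R4) : ip A z (-v) = -ip A z v := by
  simp [ip, Matrix.mulVec_neg]
lemma ip_zero_left (A : Form) (z : R4) : ip A 0 z = 0 := by
  simp [ip]

lemma ip_comm {A : Form} (hA : Aᵀ = A) (v w : R4) : ip A v w = ip A w v := by
  rw [ip, ip, Matrix.dotProduct_mulVec, ← Matrix.mulVec_transpose, hA, dotProduct_comm]

/-- Symmetry is not assumed separately: the congruence with the symmetric Minkowski matrix is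
transposed and the invertible `B` cancelled. -/
lemma IsLorentzian.symm {A : Form} (h : IsLorentzian A) : Aᵀ = A := by
  obtain ⟨B, hB, e⟩ := h
  have h1 : Bᵀ * Aᵀ * B = Bᵀ * A * B := by
    have := congrArg Matrix.transpose e
    rw [e]
    simpa [Matrix.transpose_mul, Matrix.mul_assoc, minkowski] using this
  have hBt : IsUnit Bᵀ.det := by rwa [Matrix.det_transpose]
  have h2 := congrArg (fun M => (Bᵀ)⁻¹ * M * B⁻¹) h1
  simpa [Matrix.mul_assoc, Matrix.mul_nonsing_inv _ hB, Matrix.nonsing_inv_mul_cancel_left _ _ hBt]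
    using h2

lemma det_minkowski : minkowski.det = -1 := by
  simp [minkowski, Fin.prod_univ_four]

lemma IsLorentzian.det_ne_zero {A : Form} (h : IsLorentzian A) : A.det ≠ 0 := by
  obtain ⟨B, hB, e⟩ := h
  intro h0
  have := congrArg Matrix.det e
  rw [Matrix.det_mul, Matrix.det_mul, h0, det_minkowski] at this
  simp at this

lemma IsLorentzian.isUnit_det {A : Form} (h : IsLorentzian A) : IsUnit A.det :=
  isUnit_iff_ne_zero.2 h.det_ne_zero

/-- Pairing with a raised covector. -/
lemma ip_inv_mulVec {A : Form} (hs : Aᵀ = A) (hu : IsUnit A.det) (d w : R4) :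
    ip A (A⁻¹ *ᵥ d) w = d ⬝ᵥ w := by
  rw [ip_comm hs, ip, Matrix.mulVec_mulVec, Matrix.mul_nonsing_inv _ hu, Matrix.one_mulVec,
    dotProduct_comm]

lemma eq_of_ip_eq {A : Form} (hu : IsUnit A.det) {v w : R4} (hs : Aᵀ = A)
    (h : ∀ z, ip A v z = ip A w z) : v = w := by
  have h1 : A *ᵥ v = A *ᵥ w := by
    ext i
    have := h (Pi.single i 1)
    rw [ip_comm hs, ip_comm hs w] at this
    simpa [ip] using this
  have := congrArg (fun z => A⁻¹ *ᵥ z) h1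
  simpa [Matrix.mulVec_mulVec, Matrix.nonsing_inv_mul _ hu] using this

/-- A vector orthogonal to an orthogonal basis vanishes. -/
lemma eq_zero_of_ip_frame {A : Form} (hu : IsUnit A.det) (e : Fin 4 → R4) (d : Fin 4 → ℝ)
    (hd : ∀ i, d i ≠ 0) (he : ∀ i j, ip A (e i) (e j) = if i = j then d i else 0)
    {z : R4} (hz : ∀ i, ip A (e i) z = 0) : z = 0 := by
  -- The Gram matrix of the frame is diagonal with nonzero entries; its determinant shows that the
  -- frame is a basis.
  have hM : (Matrix.of e : Form) * A * (Matrix.of e : Form)ᵀ = Matrix.diagonal d := by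
    ext i j
    rw [Matrix.diagonal_apply, ← he i j, ip, Matrix.mul_assoc]
    simp [Matrix.mul_apply, dotProduct, Matrix.mulVec, Matrix.transpose_apply]
  have hdet := congrArg Matrix.det hM
  rw [Matrix.det_mul, Matrix.det_mul, Matrix.det_transpose, Matrix.det_diagonal] at hdet
  have hne : (Matrix.of e : Form).det ≠ 0 := by
    intro h0
    rw [h0] at hdet
    simp only [zero_mul] at hdet
    exact Finset.prod_ne_zero_iff.2 (fun i _ => hd i) hdet.symm
  have h1 : ((Matrix.of e : Form) * A) *ᵥ z = 0 := by
    ext i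
    rw [← Matrix.mulVec_mulVec]
    exact hz i
  have hdet2 : ((Matrix.of e : Form) * A).det ≠ 0 := by
    rw [Matrix.det_mul]; exact mul_ne_zero hne hu.ne_zero
  exact Matrix.eq_zero_of_mulVec_eq_zero hdet2 h1

/-! ### The derivative of a metric and the Christoffel symbols as multilinear forms -/

/-- `(D_a g)(b, c)`. -/
def dg (g : R4 → Form) (p a b c : R4) : ℝ :=
  ∑ i, ∑ j, b i * (fderiv ℝ (fun q => g q i j) p a * c j)

/-- The vector `Γ(a, b)`. -/
def chr (g : R4 → Form) (p a b : R4) : R4 :=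
  fun μ => ∑ α, ∑ β, christoffel g p μ α β * a α * b β

lemma covD_eq (g : R4 → Form) (X : R2 → R4) (a : Fin 2) (W : R2 → R4) (y : R2) :
    covD g X a W y = pd a W y + chr g (X y) (pd a X y) (W y) := rfl

lemma chr_add_right (g : R4 → Form) (p a b c : R4) :
    chr g p a (b + c) = chr g p a b + chr g p a c := by
  ext μ; simp [chr, mul_add, Finset.sum_add_distrib]

lemma chr_smul_right (g : R4 → Form) (p a b : R4) (t : ℝ) :
    chr g p a (t • b) = t • chr g p a b := by
  ext μ; simp [chr, Finset.mul_sum, mul_left_comm]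

lemma chr_smul_left (g : R4 → Form) (p a b : R4) (t : ℝ) :
    chr g p (t • a) b = t • chr g p a b := by
  ext μ; simp only [chr, Finset.mul_sum, Pi.smul_apply, smul_eq_mul]
  refine Finset.sum_congr rfl fun _ _ => Finset.sum_congr rfl fun _ _ => by ring

lemma fderiv_entry_eq_sum (g : R4 → Form) (p a : R4) (i j : Fin 4) :
    fderiv ℝ (fun q => g q i j) p a = ∑ α, a α * metricDeriv g p α i j := by
  have := LinearMap.pi_apply_eq_sum_univ (fderiv ℝ (fun q => g q i j) p).toLinearMap a
  simp only [ContinuousLinearMap.coe_coe, smul_eq_mul] at this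
  rw [this]
  refine Finset.sum_congr rfl fun α _ => ?_
  rw [metricDeriv]
  congr 2
  ext k
  simp [Pi.single_apply, eq_comm]

lemma dg_eq_sum (g : R4 → Form) (p a b c : R4) :
    dg g p a b c = ∑ α, ∑ i, ∑ j, a α * b i * c j * metricDeriv g p α i j := by
  simp only [dg, fderiv_entry_eq_sum, Finset.sum_mul, Finset.mul_sum]
  have : ∀ i, ∑ j, ∑ α, b i * (a α * metricDeriv g p α i j * c j)
      = ∑ α, ∑ j, a α * b i * c j * metricDeriv g p α i j := fun i => by
    rw [Finset.sum_comm]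
    refine Finset.sum_congr rfl fun _ _ => Finset.sum_congr rfl fun _ _ => by ring
  simp only [this]
  exact Finset.sum_comm

/-- The Koszul formula, extended trilinearly from coordinate fields; the inverse metric inside the
Christoffel symbol cancels against the pairing. -/
lemma ip_chr {g : R4 → Form} {p : R4} (hs : (g p)ᵀ = g p) (hu : IsUnit (g p).det) (a b c : R4) :
    ip (g p) (chr g p a b) c = (1 / 2) * (dg g p a c b + dg g p b c a - dg g p c a b) := by
  set S : R4 := fun ν => ∑ α, ∑ β, (1 / 2) * a α * b β *
    (metricDeriv g p α ν β + metricDeriv g p β ν α - metricDeriv g p ν α β) with hS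
  have h1 : chr g p a b = (g p)⁻¹ *ᵥ S := by
    ext μ
    simp only [chr, christoffel, Matrix.mulVec, dotProduct, hS, Finset.mul_sum, Finset.sum_mul]
    calc _ = ∑ α, ∑ ν, ∑ β, (g p)⁻¹ μ ν * (1 / 2 * a α * b β *
              (metricDeriv g p α ν β + metricDeriv g p β ν α - metricDeriv g p ν α β)) := by
          refine Finset.sum_congr rfl fun _ _ => ?_
          rw [Finset.sum_comm]
          refine Finset.sum_congr rfl fun _ _ => Finset.sum_congr rfl fun _ _ => by ring
      _ = _ := Finset.sum_comm
  rw [h1, ip_inv_mulVec hs hu]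
  simp only [dotProduct, hS, dg_eq_sum, Fin.sum_univ_four]
  ring

lemma dg_symm {g : R4 → Form} {U : Set R4} (hU : IsOpen U) (hs : ∀ q ∈ U, (g q)ᵀ = g q) {p : R4}
    (hp : p ∈ U) (a b c : R4) : dg g p a b c = dg g p a c b := by
  have h : ∀ i j, fderiv ℝ (fun q => g q i j) p = fderiv ℝ (fun q => g q j i) p := by
    intro i j
    refine Filter.EventuallyEq.fderiv_eq ?_
    filter_upwards [hU.mem_nhds hp] with q hq
    exact (congrFun (congrFun (hs q hq) j) i)
  rw [dg, dg, Finset.sum_comm]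
  refine Finset.sum_congr rfl fun i _ => Finset.sum_congr rfl fun j _ => ?_
  rw [h j i]; ring

/-! ### Metric compatibility and invariance under the isometries. -/

namespace IsAxisymmetricSpacetime

variable {U : Set R4} {g : R4 → Form}

lemma symm (h : IsAxisymmetricSpacetime U g) {p : R4} (hp : p ∈ U) : (g p)ᵀ = g p :=
  (h.lorentzian p hp).symm

lemma isUnit_det (h : IsAxisymmetricSpacetime U g) {p : R4} (hp : p ∈ U) : IsUnit (g p).det :=
  (h.lorentzian p hp).isUnit_det

lemma contDiffAt_entry (h : IsAxisymmetricSpacetime U g) {p : R4} (hp : p ∈ U) (i j : Fin 4) :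
    ContDiffAt ℝ ∞ (fun q => g q i j) p :=
  (h.smooth i j).contDiffAt (h.isOpen.mem_nhds hp)

lemma differentiableAt_entry (h : IsAxisymmetricSpacetime U g) {p : R4} (hp : p ∈ U)
    (i j : Fin 4) : DifferentiableAt ℝ (fun q => g q i j) p :=
  (h.contDiffAt_entry hp i j).differentiableAt (by simp)

/-- Adding the two Koszul expressions cancels all but the derivative of the metric along `a`. -/
lemma compat (h : IsAxisymmetricSpacetime U g) {p : R4} (hp : p ∈ U) (a b c : R4) :
    ip (g p) (chr g p a b) c + ip (g p) b (chr g p a c) = dg g p a b c := by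
  rw [ip_comm (h.symm hp) b, ip_chr (h.symm hp) (h.isUnit_det hp),
    ip_chr (h.symm hp) (h.isUnit_det hp)]
  have hs := fun a b c => dg_symm h.isOpen (fun q hq => h.symm hq) hp a b c
  rw [hs b c a, hs c b a, hs a c b, hs b a c]
  ring

/-- The covariant derivative is compatible with the metric. -/
lemma pd_ip (h : IsAxisymmetricSpacetime U g) {X V W : R2 → R4} {y : R2} (hp : X y ∈ U)
    (hX : DifferentiableAt ℝ X y) (hV : DifferentiableAt ℝ V y) (hW : DifferentiableAt ℝ W y)
    (a : Fin 2) : pd a (fun z => ip (g (X z)) (V z) (W z)) y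
      = ip (g (X y)) (covD g X a V y) (W y) + ip (g (X y)) (V y) (covD g X a W y) := by
  have e : (fun z => ip (g (X z)) (V z) (W z))
      = fun z => ∑ i, ∑ j, V z i * (g (X z) i j * W z j) := by
    ext z; exact ip_eq_sum _ _ _
  have hg : ∀ i j, HasFDerivAt (fun z => g (X z) i j)
      ((fderiv ℝ (fun q => g q i j) (X y)).comp (fderiv ℝ X y)) y := fun i j =>
    (h.differentiableAt_entry hp i j).hasFDerivAt.comp y hX.hasFDerivAt
  have hVi : ∀ i, HasFDerivAt (fun z => V z i)
      ((ContinuousLinearMap.proj i).comp (fderiv ℝ V y)) y := fun i =>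
    (hasFDerivAt_pi'.1 hV.hasFDerivAt i)
  have hWi : ∀ i, HasFDerivAt (fun z => W z i)
      ((ContinuousLinearMap.proj i).comp (fderiv ℝ W y)) y := fun i =>
    (hasFDerivAt_pi'.1 hW.hasFDerivAt i)
  have key : pd a (fun z => ip (g (X z)) (V z) (W z)) y =
      ip (g (X y)) (pd a V y) (W y) + ip (g (X y)) (V y) (pd a W y)
        + dg g (X y) (pd a X y) (V y) (W y) := by
    rw [e, pd]
    have H := (HasFDerivAt.fun_sum (u := Finset.univ) fun i _ =>
      HasFDerivAt.fun_sum (u := Finset.univ) fun j _ =>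
        (hVi i).fun_mul ((hg i j).fun_mul (hWi j)))
    rw [H.fderiv]
    simp only [ip_eq_sum, dg, ← Finset.sum_add_distrib]
    simp only [sum_apply]
    refine Finset.sum_congr rfl fun i _ => Finset.sum_congr rfl fun j _ => ?_
    simp [pd]; ring
  rw [key, covD_eq, covD_eq, ip_add_left, ip_add_right, ← h.compat hp]
  ring

/-- The isometry identity is differentiated; since `L` is linear it is its own derivative and
contributes no further term. -/
lemma dg_of_isometry (h : IsAxisymmetricSpacetime U g) {L : R4 →L[ℝ] R4}
    (hL : ∀ q ∈ U, L q ∈ U) (hiso : ∀ q ∈ U, ∀ v w, ip (g (L q)) (L v) (L w) = ip (g q) v w)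
    {p : R4} (hp : p ∈ U) (a b c : R4) :
    dg g (L p) (L a) (L b) (L c) = dg g p a b c := by
  have key : ∀ q ∈ U, ∀ a b c : R4,
      HasFDerivAt (fun q => ip (g q) b c) (fderiv ℝ (fun q => ip (g q) b c) q) q ∧
      fderiv ℝ (fun q => ip (g q) b c) q a = dg g q a b c := by
    intro q hq a b c
    have e : (fun q => ip (g q) b c) = fun q => ∑ i, ∑ j, b i * (g q i j * c j) := by
      ext q; exact ip_eq_sum _ _ _
    have H := (HasFDerivAt.fun_sum (u := Finset.univ) fun i _ =>
      HasFDerivAt.fun_sum (u := Finset.univ) fun j _ =>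
        (((h.differentiableAt_entry hq i j).hasFDerivAt.mul_const (c j)).const_mul (b i)))
    rw [← e] at H
    refine ⟨H.differentiableAt.hasFDerivAt, ?_⟩
    rw [H.fderiv]
    simp only [dg, sum_apply]
    refine Finset.sum_congr rfl fun i _ => Finset.sum_congr rfl fun j _ => ?_
    simp [mul_comm]
  rw [← (key (L p) (hL p hp) _ _ _).2, ← (key p hp _ _ _).2]
  have h1 := ((key (L p) (hL p hp) (L a) (L b) (L c)).1.comp p L.hasFDerivAt).fderiv
  have h2 : ((fun q => ip (g q) (L b) (L c)) ∘ L) =ᶠ[𝓝 p] fun q => ip (g q) b c := by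
    filter_upwards [h.isOpen.mem_nhds hp] with q hq
    exact hiso q hq b c
  rw [h2.fderiv_eq] at h1
  rw [h1]; rfl

/-- Invariance of the Christoffel symbols holds in this tensorial form because the isometries used
are linear in the coordinates, so no inhomogeneous second-derivative term appears. -/
lemma ip_chr_of_isometry (h : IsAxisymmetricSpacetime U g) {L : R4 →L[ℝ] R4}
    (hL : ∀ q ∈ U, L q ∈ U) (hiso : ∀ q ∈ U, ∀ v w, ip (g (L q)) (L v) (L w) = ip (g q) v w)
    {p : R4} (hp : p ∈ U) (a b c : R4) :
    ip (g (L p)) (chr g (L p) (L a) (L b)) (L c) = ip (g p) (chr g p a b) c := by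
  rw [ip_chr (h.symm hp) (h.isUnit_det hp), ip_chr (h.symm (hL p hp)) (h.isUnit_det (hL p hp))]
  simp only [h.dg_of_isometry hL hiso hp]

lemma ip_chr_rot (h : IsAxisymmetricSpacetime U g) (φ : ℝ) {p : R4} (hp : p ∈ U) (a b c : R4) :
    ip (g (rot4 φ p)) (chr g (rot4 φ p) (rot4 φ a) (rot4 φ b)) (rot4 φ c)
      = ip (g p) (chr g p a b) c :=
  h.ip_chr_of_isometry (L := rotL φ) (h.rot_mem φ) (h.rot_isometry φ) hp a b c

lemma refl4_of_two {v : R4} (hv : v 2 = 0) : refl4 v = v := by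
  ext i; fin_cases i <;> simp [refl4, hv]

lemma refl4_rotGen {v : R4} (hv : v 2 = 0) : refl4 (rotGen v) = -rotGen v := by
  ext i; fin_cases i <;> simp [refl4, rotGen, hv]

lemma ip_refl (h : IsAxisymmetricSpacetime U g) {p : R4} (hp : p ∈ U) (hp2 : p 2 = 0) (v w : R4) :
    ip (g p) (refl4 v) (refl4 w) = ip (g p) v w := by
  have := h.refl_isometry p hp v w
  rwa [refl4_of_two hp2] at this

lemma ip_chr_refl (h : IsAxisymmetricSpacetime U g) {p : R4} (hp : p ∈ U) (hp2 : p 2 = 0)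
    (a b c : R4) :
    ip (g p) (chr g p (refl4 a) (refl4 b)) (refl4 c) = ip (g p) (chr g p a b) c := by
  have := h.ip_chr_of_isometry (L := reflL) h.refl_mem h.refl_isometry hp a b c
  simpa [refl4_of_two hp2] using this

/-- The plane of symmetry is orthogonal to the rotation field. -/
lemma ip_rotGen (h : IsAxisymmetricSpacetime U g) {p : R4} (hp : p ∈ U) (hp2 : p 2 = 0) {v w : R4}
    (hv : v 2 = 0) (hw : w 2 = 0) : ip (g p) v (rotGen w) = 0 := by
  have := h.ip_refl hp hp2 v (rotGen w)
  rw [refl4_of_two hv, refl4_rotGen hw, ip_neg_right] at this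
  linarith

/-- Parity: the reflection fixes the symmetry plane and reverses the rotation field, so an
expression with exactly one rotation field equals its negative. This is how vanishing angular
momentum enters. -/
lemma ip_chr_rotGen_left (h : IsAxisymmetricSpacetime U g) {p : R4} (hp : p ∈ U) (hp2 : p 2 = 0)
    {a b c : R4} (ha : a 2 = 0) (hb : b 2 = 0) (hc : c 2 = 0) :
    ip (g p) (chr g p (rotGen a) b) c = 0 := by
  have := h.ip_chr_refl hp hp2 (rotGen a) b c
  rw [refl4_of_two hb, refl4_of_two hc, refl4_rotGen ha, ← neg_one_smul ℝ (rotGen a),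
    chr_smul_left, ip_smul_left] at this
  linarith

end IsAxisymmetricSpacetime

end
end WangYau

namespace WangYau
noncomputable section

/-! ### Smooth dependence -/

section Smooth

variable {E : Type*} [NormedAddCommGroup E] [NormedSpace ℝ E] {e : E}

lemma contDiffAt_det {n : ℕ} {M : E → Matrix (Fin n) (Fin n) ℝ}
    (h : ∀ i j, ContDiffAt ℝ ∞ (fun z => M z i j) e) : ContDiffAt ℝ ∞ (fun z => (M z).det) e := by
  simp only [Matrix.det_apply]
  refine ContDiffAt.sum fun σ _ => ?_
  exact (contDiffAt_prod fun i _ => h _ _).const_smul _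

lemma contDiffAt_inv_entry {n : ℕ} {M : E → Matrix (Fin n) (Fin n) ℝ}
    (h : ∀ i j, ContDiffAt ℝ ∞ (fun z => M z i j) e) (hdet : (M e).det ≠ 0) (i j : Fin n) :
    ContDiffAt ℝ ∞ (fun z => (M z)⁻¹ i j) e := by
  have e1 : (fun z => (M z)⁻¹ i j) = fun z => ((M z).det)⁻¹ * (M z).adjugate i j := by
    ext z; simp [Matrix.inv_def]
  rw [e1]
  refine ((contDiffAt_det h).inv hdet).mul ?_
  simp only [Matrix.adjugate_apply]
  refine contDiffAt_det fun k l => ?_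
  simp only [Matrix.updateRow_apply]
  split_ifs
  · exact contDiffAt_const
  · exact h _ _

lemma contDiffAt_apply {V : E → R4} (hV : ContDiffAt ℝ ∞ V e) (i : Fin 4) :
    ContDiffAt ℝ ∞ (fun z => V z i) e := contDiffAt_pi.1 hV i

lemma contDiffAt_fderiv_apply {F : Type*} [NormedAddCommGroup F] [NormedSpace ℝ F] {f : E → F}
    (hf : ContDiffAt ℝ ∞ f e) (v : E) : ContDiffAt ℝ ∞ (fun z => fderiv ℝ f z v) e :=
  (hf.fderiv_right (m := ∞) (by simp)).clm_apply contDiffAt_const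

variable {U : Set R4} {g : R4 → Form}

lemma IsAxisymmetricSpacetime.contDiffAt_comp (h : IsAxisymmetricSpacetime U g) {X : E → R4}
    (hX : ContDiffAt ℝ ∞ X e) (he : X e ∈ U) (i j : Fin 4) :
    ContDiffAt ℝ ∞ (fun z => g (X z) i j) e :=
  (h.contDiffAt_entry he i j).comp e hX

lemma IsAxisymmetricSpacetime.contDiffAt_ip (h : IsAxisymmetricSpacetime U g) {X V W : E → R4}
    (hX : ContDiffAt ℝ ∞ X e) (he : X e ∈ U) (hV : ContDiffAt ℝ ∞ V e) (hW : ContDiffAt ℝ ∞ W e) :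
    ContDiffAt ℝ ∞ (fun z => ip (g (X z)) (V z) (W z)) e := by
  simp only [ip_eq_sum]
  refine ContDiffAt.sum fun i _ => ContDiffAt.sum fun j _ => ?_
  exact (contDiffAt_apply hV i).mul ((h.contDiffAt_comp hX he i j).mul (contDiffAt_apply hW j))

lemma IsAxisymmetricSpacetime.contDiffAt_christoffel (h : IsAxisymmetricSpacetime U g) {p : R4}
    (hp : p ∈ U) (μ α β : Fin 4) : ContDiffAt ℝ ∞ (fun q => christoffel g q μ α β) p := by
  have hd : ∀ α i j, ContDiffAt ℝ ∞ (fun q => metricDeriv g q α i j) p := fun α i j =>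
    contDiffAt_fderiv_apply (h.contDiffAt_entry hp i j) _
  have hi : ∀ i j, ContDiffAt ℝ ∞ (fun q => (g q)⁻¹ i j) p := fun i j =>
    contDiffAt_inv_entry (h.contDiffAt_entry hp) (h.isUnit_det hp).ne_zero i j
  simp only [christoffel]
  refine contDiffAt_const.mul (ContDiffAt.sum fun ν _ => (hi _ _).mul ?_)
  exact ((hd _ _ _).add (hd _ _ _)).sub (hd _ _ _)

lemma IsAxisymmetricSpacetime.contDiffAt_chr (h : IsAxisymmetricSpacetime U g) {X V W : E → R4}
    (hX : ContDiffAt ℝ ∞ X e) (he : X e ∈ U) (hV : ContDiffAt ℝ ∞ V e) (hW : ContDiffAt ℝ ∞ W e) :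
    ContDiffAt ℝ ∞ (fun z => chr g (X z) (V z) (W z)) e := by
  rw [contDiffAt_pi]
  intro μ
  simp only [chr]
  refine ContDiffAt.sum fun i _ => ContDiffAt.sum fun j _ => ?_
  exact (((h.contDiffAt_christoffel he μ i j).comp e hX).mul (contDiffAt_apply hV i)).mul
    (contDiffAt_apply hW j)

lemma IsAxisymmetricSpacetime.contDiffAt_inv (h : IsAxisymmetricSpacetime U g) {X : E → R4}
    (hX : ContDiffAt ℝ ∞ X e) (he : X e ∈ U) (i j : Fin 4) :
    ContDiffAt ℝ ∞ (fun z => (g (X z))⁻¹ i j) e :=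
  contDiffAt_inv_entry (h.contDiffAt_comp hX he) (h.isUnit_det he).ne_zero i j

lemma contDiffAt_pd {F : Type*} [NormedAddCommGroup F] [NormedSpace ℝ F] {f : R2 → F} {y : R2}
    (hf : ContDiffAt ℝ ∞ f y) (a : Fin 2) : ContDiffAt ℝ ∞ (pd a f) y :=
  contDiffAt_fderiv_apply hf _

lemma IsAxisymmetricSpacetime.contDiffAt_covD (h : IsAxisymmetricSpacetime U g) {X W : R2 → R4}
    {y : R2} (hX : ContDiffAt ℝ ∞ X y) (hy : X y ∈ U) (hW : ContDiffAt ℝ ∞ W y) (a : Fin 2) :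
    ContDiffAt ℝ ∞ (covD g X a W) y :=
  (contDiffAt_pd hW a).add (h.contDiffAt_chr hX hy (contDiffAt_pd hX a) hW)

lemma IsAxisymmetricSpacetime.contDiffAt_firstForm (h : IsAxisymmetricSpacetime U g)
    {X : R2 → R4} {y : R2} (hX : ContDiffAt ℝ ∞ X y) (hy : X y ∈ U) (i j : Fin 2) :
    ContDiffAt ℝ ∞ (fun z => firstForm g X z i j) y :=
  h.contDiffAt_ip hX hy (contDiffAt_pd hX _) (contDiffAt_pd hX _)

lemma IsAxisymmetricSpacetime.contDiffAt_expansion (h : IsAxisymmetricSpacetime U g)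
    {X W : R2 → R4} {y : R2} (hX : ContDiffAt ℝ ∞ X y) (hy : X y ∈ U)
    (hσ : (firstForm g X y).det ≠ 0) (hW : ContDiffAt ℝ ∞ W y) :
    ContDiffAt ℝ ∞ (expansion g X W) y := by
  refine ContDiffAt.sum fun i _ => ContDiffAt.sum fun j _ => ?_
  exact (contDiffAt_inv_entry (h.contDiffAt_firstForm hX hy) hσ i j).mul
    (h.contDiffAt_ip hX hy (h.contDiffAt_covD hX hy hW i) (contDiffAt_pd hX j))

end Smooth

/-! ### Orthonormal normal frames of a surface -/

/-- `(T, N)` is an orthonormal frame of the normal bundle, with `T` timelike and `N` spacelike, of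
the surface `X`, whose coordinates are orthogonal. -/
structure IsNormalFrame (g : R4 → Form) (X T N : R2 → R4) (y : R2) : Prop where
  pos_zero : 0 < ip (g (X y)) (pd 0 X y) (pd 0 X y)
  pos_one : 0 < ip (g (X y)) (pd 1 X y) (pd 1 X y)
  tangent : ip (g (X y)) (pd 0 X y) (pd 1 X y) = 0
  T_tangent : ∀ a, ip (g (X y)) (pd a X y) (T y) = 0
  N_tangent : ∀ a, ip (g (X y)) (pd a X y) (N y) = 0
  T_T : ip (g (X y)) (T y) (T y) = -1
  N_N : ip (g (X y)) (N y) (N y) = 1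
  T_N : ip (g (X y)) (T y) (N y) = 0

section Frame

variable {U : Set R4} {g : R4 → Form} {X T N : R2 → R4} {y : R2}

lemma firstForm_eq_diagonal (hs : (g (X y))ᵀ = g (X y))
    (h01 : ip (g (X y)) (pd 0 X y) (pd 1 X y) = 0) :
    firstForm g X y = Matrix.diagonal
      ![ip (g (X y)) (pd 0 X y) (pd 0 X y), ip (g (X y)) (pd 1 X y) (pd 1 X y)] := by
  ext i j
  fin_cases i <;> fin_cases j <;> simp [firstForm, h01]
  rw [ip_comm hs, h01]

lemma inv_firstForm (hs : (g (X y))ᵀ = g (X y))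
    (h01 : ip (g (X y)) (pd 0 X y) (pd 1 X y) = 0)
    (h0 : 0 < ip (g (X y)) (pd 0 X y) (pd 0 X y)) (h1 : 0 < ip (g (X y)) (pd 1 X y) (pd 1 X y)) :
    (firstForm g X y)⁻¹ = Matrix.diagonal
      ![(ip (g (X y)) (pd 0 X y) (pd 0 X y))⁻¹, (ip (g (X y)) (pd 1 X y) (pd 1 X y))⁻¹] := by
  rw [firstForm_eq_diagonal hs h01]
  refine Matrix.inv_eq_right_inv ?_
  rw [Matrix.diagonal_mul_diagonal, ← Matrix.diagonal_one]
  congr 1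
  ext i
  fin_cases i
  · simp [h0.ne']
  · simp [h1.ne']

lemma expansion_eq_of_orthogonal (hs : (g (X y))ᵀ = g (X y))
    (h01 : ip (g (X y)) (pd 0 X y) (pd 1 X y) = 0)
    (h0 : 0 < ip (g (X y)) (pd 0 X y) (pd 0 X y)) (h1 : 0 < ip (g (X y)) (pd 1 X y) (pd 1 X y))
    (l : R2 → R4) :
    expansion g X l y =
      (ip (g (X y)) (pd 0 X y) (pd 0 X y))⁻¹ * ip (g (X y)) (covD g X 0 l y) (pd 0 X y) +
      (ip (g (X y)) (pd 1 X y) (pd 1 X y))⁻¹ * ip (g (X y)) (covD g X 1 l y) (pd 1 X y) := by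
  simp [expansion, inv_firstForm hs h01 h0 h1, Fin.sum_univ_two]

namespace IsNormalFrame

/-- Both sides pair equally with the orthogonal frame ∂₀X, ∂₁X, T, N, and the form is nondegenerate.
The sign on `T` reflects that it is timelike. -/
lemma normalPart_eq (hs : (g (X y))ᵀ = g (X y)) (hu : IsUnit (g (X y)).det)
    (h : IsNormalFrame g X T N y) (w : R4) :
    normalPart g X y w = -(ip (g (X y)) w (T y)) • T y + ip (g (X y)) w (N y) • N y := by
  have e : normalPart g X y w = w
      - ((ip (g (X y)) (pd 0 X y) (pd 0 X y))⁻¹ * ip (g (X y)) w (pd 0 X y)) • pd 0 X y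
      - ((ip (g (X y)) (pd 1 X y) (pd 1 X y))⁻¹ * ip (g (X y)) w (pd 1 X y)) • pd 1 X y := by
    simp [normalPart, inv_firstForm hs h.tangent h.pos_zero h.pos_one, Fin.sum_univ_two, sub_sub]
  rw [← sub_eq_zero]
  have h0 := h.pos_zero.ne'
  have h1 := h.pos_one.ne'
  have c10 : ip (g (X y)) (pd 1 X y) (pd 0 X y) = 0 := by rw [ip_comm hs, h.tangent]
  have cT : ∀ a, ip (g (X y)) (T y) (pd a X y) = 0 := fun a => by
    rw [ip_comm hs, h.T_tangent]
  have cN : ∀ a, ip (g (X y)) (N y) (pd a X y) = 0 := fun a => by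
    rw [ip_comm hs, h.N_tangent]
  have cNT : ip (g (X y)) (N y) (T y) = 0 := by rw [ip_comm hs, h.T_N]
  refine eq_zero_of_ip_frame hu ![pd 0 X y, pd 1 X y, T y, N y]
    ![ip (g (X y)) (pd 0 X y) (pd 0 X y), ip (g (X y)) (pd 1 X y) (pd 1 X y), -1, 1] ?_ ?_ ?_
  · intro i; fin_cases i <;> simp [h0, h1]
  · intro i j
    fin_cases i <;> fin_cases j <;>
      simp [h.tangent, c10, cT, cN, cNT, h.T_tangent, h.N_tangent, h.T_T, h.N_N, h.T_N]
  · intro i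
    rw [e]
    fin_cases i <;>
      simp only [Fin.zero_eta, Fin.mk_one, Fin.reduceFinMk, Matrix.cons_val, Matrix.cons_val_zero,
        Matrix.cons_val_one, ip_sub_right, ip_add_right, ip_smul_right, ip_neg_right, neg_smul,
        h.tangent, c10, cT, cN, cNT, h.T_tangent, h.N_tangent, h.T_T, h.N_N, h.T_N]
    · rw [ip_comm hs w]; field_simp; ring
    · rw [ip_comm hs w (pd 1 X y)]; field_simp; ring
    · rw [ip_comm hs w (T y)]; ring
    · rw [ip_comm hs w (N y)]; ring

end IsNormalFrame

variable {D : Set R2}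

/-- A smooth surface in a spacetime, over an open parameter domain, with an orthonormal normal
frame. -/
structure IsFramedSurface (U : Set R4) (g : R4 → Form) (D : Set R2) (X T N : R2 → R4) :
    Prop where
  spacetime : IsAxisymmetricSpacetime U g
  isOpen : IsOpen D
  mem : ∀ y ∈ D, X y ∈ U
  smooth : ∀ y ∈ D, ContDiffAt ℝ ∞ X y
  smooth_T : ∀ y ∈ D, ContDiffAt ℝ ∞ T y
  smooth_N : ∀ y ∈ D, ContDiffAt ℝ ∞ N y
  frame : ∀ y ∈ D, IsNormalFrame g X T N y

namespace IsFramedSurface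

lemma symm (h : IsFramedSurface U g D X T N) (hy : y ∈ D) : (g (X y))ᵀ = g (X y) :=
  h.spacetime.symm (h.mem y hy)

lemma isUnit_det (h : IsFramedSurface U g D X T N) (hy : y ∈ D) : IsUnit (g (X y)).det :=
  h.spacetime.isUnit_det (h.mem y hy)

lemma det_firstForm (h : IsFramedSurface U g D X T N) (hy : y ∈ D) :
    (firstForm g X y).det =
      ip (g (X y)) (pd 0 X y) (pd 0 X y) * ip (g (X y)) (pd 1 X y) (pd 1 X y) := by
  rw [firstForm_eq_diagonal (h.symm hy) (h.frame y hy).tangent]; simp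

lemma det_firstForm_ne_zero (h : IsFramedSurface U g D X T N) (hy : y ∈ D) :
    (firstForm g X y).det ≠ 0 := by
  rw [h.det_firstForm hy]
  exact mul_ne_zero (h.frame y hy).pos_zero.ne' (h.frame y hy).pos_one.ne'

lemma pd_const_eq_zero {f : R2 → ℝ} {c : ℝ} (hD : IsOpen D) (hf : ∀ z ∈ D, f z = c) (hy : y ∈ D)
    (a : Fin 2) : pd a f y = 0 := by
  have : f =ᶠ[𝓝 y] fun _ => c := by
    filter_upwards [hD.mem_nhds hy] with z hz using hf z hz
  rw [pd_congr this]; simp [pd]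

/-- Leibniz rule for a constant pairing. It moves derivatives between the members of an orthonormal
frame and from normal fields to tangent fields. -/
lemma ip_covD_of_const (h : IsFramedSurface U g D X T N) {V W : R2 → R4} {c : ℝ} (hy : y ∈ D)
    (hV : ContDiffAt ℝ ∞ V y) (hW : ContDiffAt ℝ ∞ W y)
    (hc : ∀ z ∈ D, ip (g (X z)) (V z) (W z) = c) (a : Fin 2) :
    ip (g (X y)) (covD g X a V y) (W y) = -ip (g (X y)) (V y) (covD g X a W y) := by
  have h1 := h.spacetime.pd_ip (h.mem y hy) ((h.smooth y hy).differentiableAt (by simp))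
    (hV.differentiableAt (by simp)) (hW.differentiableAt (by simp)) a
  rw [pd_const_eq_zero h.isOpen hc hy] at h1
  linarith

lemma expansion_eq (h : IsFramedSurface U g D X T N) (hy : y ∈ D) (l : R2 → R4) :
    expansion g X l y =
      (ip (g (X y)) (pd 0 X y) (pd 0 X y))⁻¹ * ip (g (X y)) (covD g X 0 l y) (pd 0 X y) +
      (ip (g (X y)) (pd 1 X y) (pd 1 X y))⁻¹ * ip (g (X y)) (covD g X 1 l y) (pd 1 X y) :=
  expansion_eq_of_orthogonal (h.symm hy) (h.frame y hy).tangent (h.frame y hy).pos_zero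
    (h.frame y hy).pos_one l

/-- The mean curvature vector in terms of the expansions of the frame. -/
lemma meanCurv_eq (h : IsFramedSurface U g D X T N) (hy : y ∈ D) :
    meanCurv g X y = expansion g X T y • T y - expansion g X N y • N y := by
  have F := h.frame y hy
  have e : meanCurv g X y
      = (ip (g (X y)) (pd 0 X y) (pd 0 X y))⁻¹ •
          normalPart g X y (covD g X 0 (fun z => pd 0 X z) y)
        + (ip (g (X y)) (pd 1 X y) (pd 1 X y))⁻¹ •
          normalPart g X y (covD g X 1 (fun z => pd 1 X z) y) := by
    simp [meanCurv, inv_firstForm (h.symm hy) F.tangent F.pos_zero F.pos_one, Fin.sum_univ_two]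
  have hT : ∀ a, ip (g (X y)) (covD g X a (fun z => pd a X z) y) (T y)
      = -ip (g (X y)) (covD g X a T y) (pd a X y) := fun a => by
    rw [ip_comm (h.symm hy) _ (pd a X y)]
    exact h.ip_covD_of_const hy (contDiffAt_pd (h.smooth y hy) a) (h.smooth_T y hy)
      (fun z hz => (h.frame z hz).T_tangent a) a
  have hN : ∀ a, ip (g (X y)) (covD g X a (fun z => pd a X z) y) (N y)
      = -ip (g (X y)) (covD g X a N y) (pd a X y) := fun a => by
    rw [ip_comm (h.symm hy) _ (pd a X y)]
    exact h.ip_covD_of_const hy (contDiffAt_pd (h.smooth y hy) a) (h.smooth_N y hy)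
      (fun z hz => (h.frame z hz).N_tangent a) a
  rw [e, F.normalPart_eq (h.symm hy) (h.isUnit_det hy), F.normalPart_eq (h.symm hy)
    (h.isUnit_det hy), h.expansion_eq hy, h.expansion_eq hy, hT, hT, hN, hN]
  module

lemma meanCurvSq_eq (h : IsFramedSurface U g D X T N) (hy : y ∈ D) :
    meanCurvSq g X y = expansion g X N y ^ 2 - expansion g X T y ^ 2 := by
  have F := h.frame y hy
  have hNT : ip (g (X y)) (N y) (T y) = 0 := by rw [ip_comm (h.symm hy), F.T_N]
  rw [meanCurvSq, h.meanCurv_eq hy]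
  simp only [ip_sub_left, ip_sub_right, ip_smul_left, ip_smul_right, F.T_T, F.N_N, F.T_N, hNT]
  ring

lemma contDiffAt_expansion (h : IsFramedSurface U g D X T N) (hy : y ∈ D) {W : R2 → R4}
    (hW : ContDiffAt ℝ ∞ W y) : ContDiffAt ℝ ∞ (expansion g X W) y :=
  h.spacetime.contDiffAt_expansion (h.smooth y hy) (h.mem y hy) (h.det_firstForm_ne_zero hy) hW

lemma contDiffAt_meanCurvSq (h : IsFramedSurface U g D X T N) (hy : y ∈ D) :
    ContDiffAt ℝ ∞ (meanCurvSq g X) y := by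
  have : meanCurvSq g X =ᶠ[𝓝 y]
      fun z => expansion g X N z ^ 2 - expansion g X T z ^ 2 := by
    filter_upwards [h.isOpen.mem_nhds hy] with z hz using h.meanCurvSq_eq hz
  exact (((h.contDiffAt_expansion hy (h.smooth_N y hy)).pow 2).sub
    ((h.contDiffAt_expansion hy (h.smooth_T y hy)).pow 2)).congr_of_eventuallyEq this

lemma contDiffAt_meanCurvNorm (h : IsFramedSurface U g D X T N) (hy : y ∈ D)
    (hH : 0 < meanCurvSq g X y) : ContDiffAt ℝ ∞ (meanCurvNorm g X) y :=
  (h.contDiffAt_meanCurvSq hy).sqrt hH.ne'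

lemma eH_eq (h : IsFramedSurface U g D X T N) (hy : y ∈ D) :
    eH g X y = (expansion g X N y / meanCurvNorm g X y) • N y
      - (expansion g X T y / meanCurvNorm g X y) • T y := by
  rw [eH, h.meanCurv_eq hy, smul_sub, smul_smul, smul_smul, neg_sub, inv_mul_eq_div, inv_mul_eq_div]

lemma meanCurvNorm_sq (h : IsFramedSurface U g D X T N) (hy : y ∈ D)
    (hH : 0 < meanCurvSq g X y) :
    meanCurvNorm g X y ^ 2 = expansion g X N y ^ 2 - expansion g X T y ^ 2 := by
  rw [meanCurvNorm, Real.sq_sqrt hH.le, h.meanCurvSq_eq hy]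

/-- The pair (e_H, e_J) is the boost of (N, T) with hyperbolic cosine k_N/|H| and hyperbolic sine
−k_T/|H|, where k_N, k_T are the expansions. Positivity of k_N together with ⟨u, T⟩ < 0 selects the
future-pointing branch. -/
lemma eJ_eq (h : IsFramedSurface U g D X T N) (hy : y ∈ D) (hH : 0 < meanCurvSq g X y)
    (hN : 0 < expansion g X N y) (huT : ip (g (X y)) (sliceNormal g X y) (T y) < 0)
    (huN : ip (g (X y)) (sliceNormal g X y) (N y) = 0) :
    eJ g X y = (expansion g X N y / meanCurvNorm g X y) • T y
      - (expansion g X T y / meanCurvNorm g X y) • N y := by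
  have F := h.frame y hy
  have hNT : ip (g (X y)) (N y) (T y) = 0 := by rw [ip_comm (h.symm hy), F.T_N]
  set m := -ip (g (X y)) (sliceNormal g X y) (T y) with hm
  set kT := expansion g X T y with hkT
  set kN := expansion g X N y with hkN
  have hsq := h.meanCurvNorm_sq hy hH
  set n := meanCurvNorm g X y with hn
  have hn0 : 0 < n := Real.sqrt_pos.2 hH
  have hS : meanCurvSq g X y = n ^ 2 := by rw [hsq, h.meanCurvSq_eq hy]
  have hm0 : 0 < m := by linarith
  have hc : conjDirection g X y = (m * kN / n ^ 2) • (kN • T y - kT • N y) := by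
    rw [conjDirection, F.normalPart_eq (h.symm hy) (h.isUnit_det hy), h.meanCurv_eq hy, huN, hS]
    simp only [ip_sub_right, ip_smul_right, huN, mul_zero, sub_zero, zero_smul, add_zero]
    rw [← hkT, ← hkN, show ip (g (X y)) (sliceNormal g X y) (T y) = -m by rw [hm]; ring]
    have h1 : kN * kN = n ^ 2 + kT * kT := by linarith [hsq]
    have h2 : m * kN / n ^ 2 * kN = m + m * kT / n ^ 2 * kT := by
      field_simp; linear_combination h1
    have h3 : (m * kN / n ^ 2) • (kN • T y - kT • N y)
        = (m * kN / n ^ 2 * kN) • T y - (m * kN / n ^ 2 * kT) • N y := by module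
    rw [h3, h2]
    simp only [mul_neg, neg_div, neg_smul, neg_neg]
    module
  have hq : -ip (g (X y)) (conjDirection g X y) (conjDirection g X y) = (m * kN / n) ^ 2 := by
    rw [hc]
    simp only [ip_sub_left, ip_sub_right, ip_smul_left, ip_smul_right, F.T_T, F.N_N, F.T_N, hNT]
    have h1 : kN * kN - kT * kT = n ^ 2 := by linarith [hsq]
    field_simp
    linear_combination h1
  have hpos : 0 < m * kN / n := by positivity
  rw [eJ, hq, Real.sqrt_sq hpos.le, hc, smul_sub, smul_sub, smul_smul, smul_smul, smul_smul,
    smul_smul]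
  congr 2
  · field_simp
  · field_simp

lemma covD_linear (X : R2 → R4) (a : Fin 2) {c s : R2 → ℝ} {V W : R2 → R4}
    (hc : DifferentiableAt ℝ c y) (hs : DifferentiableAt ℝ s y) (hV : DifferentiableAt ℝ V y)
    (hW : DifferentiableAt ℝ W y) :
    covD g X a (fun z => c z • V z - s z • W z) y
      = pd a c y • V y - pd a s y • W y + c y • covD g X a V y - s y • covD g X a W y := by
  rw [covD_eq, covD_eq, covD_eq]
  have e : pd a (fun z => c z • V z - s z • W z) y
      = pd a c y • V y + c y • pd a V y - (pd a s y • W y + s y • pd a W y) := by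
    simp only [pd]
    rw [fderiv_fun_sub (hc.fun_smul hV) (hs.fun_smul hW), fderiv_fun_smul hc hV, fderiv_fun_smul hs hW]
    simp [add_comm]
  rw [e, sub_eq_add_neg (c y • V y), ← neg_smul, chr_add_right, chr_smul_right, chr_smul_right]
  module

/-- The connection form in the mean curvature gauge, in terms of an orthonormal frame. -/
lemma alphaH_eq (h : IsFramedSurface U g D X T N) (hy : y ∈ D)
    (hH : ∀ z ∈ D, 0 < meanCurvSq g X z)
    (hN : 0 < expansion g X N y) (huT : ip (g (X y)) (sliceNormal g X y) (T y) < 0)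
    (huN : ip (g (X y)) (sliceNormal g X y) (N y) = 0) (a : Fin 2) :
    alphaH g X a y = ip (g (X y)) (covD g X a N y) (T y)
      + pd a (fun z => Real.arsinh (expansion g X T z / meanCurvNorm g X z)) y := by
  have F := h.frame y hy
  have hNT : ip (g (X y)) (N y) (T y) = 0 := by rw [ip_comm (h.symm hy), F.T_N]
  have hn0 : ∀ z ∈ D, 0 < meanCurvNorm g X z := fun z hz => Real.sqrt_pos.2 (hH z hz)
  have ds : ∀ V, ContDiffAt ℝ ∞ V y →
      DifferentiableAt ℝ (fun z => expansion g X V z / meanCurvNorm g X z) y := fun V hV =>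
    (((h.contDiffAt_expansion hy hV).div (h.contDiffAt_meanCurvNorm hy (hH y hy))
      (hn0 y hy).ne').differentiableAt (by simp))
  have dc := ds N (h.smooth_N y hy)
  have dt := ds T (h.smooth_T y hy)
  set c : R2 → ℝ := fun z => expansion g X N z / meanCurvNorm g X z with hcdef
  set s : R2 → ℝ := fun z => expansion g X T z / meanCurvNorm g X z with hsdef
  have heH : eH g X =ᶠ[𝓝 y] fun z => c z • N z - s z • T z := by
    filter_upwards [h.isOpen.mem_nhds hy] with z hz using h.eH_eq hz
  -- `c` and `s` are the hyperbolic cosine and, up to sign, the hyperbolic sine of the boost angle.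
  -- Boosting a normal frame changes its connection form by the differential of the angle, which is
  -- `s'/c` by the next two steps.
  have hcs : ∀ z ∈ D, c z ^ 2 - s z ^ 2 = 1 := by
    intro z hz
    have := h.meanCurvNorm_sq hz (hH z hz)
    have := hn0 z hz
    simp only [hcdef, hsdef]
    field_simp
    linarith
  have hcpos : 0 < c y := div_pos hN (hn0 y hy)
  have hder : c y * pd a c y = s y * pd a s y := by
    have h1 := pd_const_eq_zero h.isOpen hcs hy a
    have h2 := (((dc.hasFDerivAt.pow 2).sub (dt.hasFDerivAt.pow 2))).fderiv
    rw [pd, show (fun z => c z ^ 2 - s z ^ 2) = (fun x => c x ^ 2) - fun x => s x ^ 2 from rfl,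
      h2] at h1
    simp at h1
    simp only [pd]; linarith
  have hars : pd a (fun z => Real.arsinh (s z)) y = pd a s y / c y := by
    have h1 := (dt.hasFDerivAt.arsinh).fderiv
    have h2 : √(1 + s y ^ 2) = c y := by
      rw [show 1 + s y ^ 2 = c y ^ 2 by linarith [hcs y hy], Real.sqrt_sq hcpos.le]
    rw [pd, h1, h2]
    simp [pd]; field_simp
  have hcov : covD g X a (eH g X) y
      = pd a c y • N y - pd a s y • T y + c y • covD g X a N y - s y • covD g X a T y := by
    rw [← covD_linear X a dc dt ((h.smooth_N y hy).differentiableAt (by simp))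
      ((h.smooth_T y hy).differentiableAt (by simp)), covD_eq, covD_eq, pd_congr heH,
      heH.self_of_nhds]
  have oN := h.ip_covD_of_const hy (h.smooth_N y hy) (h.smooth_N y hy)
    (fun z hz => (h.frame z hz).N_N) a
  have oT := h.ip_covD_of_const hy (h.smooth_T y hy) (h.smooth_T y hy)
    (fun z hz => (h.frame z hz).T_T) a
  have oTN := h.ip_covD_of_const hy (h.smooth_T y hy) (h.smooth_N y hy)
    (fun z hz => (h.frame z hz).T_N) a
  rw [ip_comm (h.symm hy) (N y)] at oN
  rw [ip_comm (h.symm hy) (T y)] at oT oTN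
  have e : eJ g X y = c y • T y - s y • N y := h.eJ_eq hy (hH y hy) hN huT huN
  rw [alphaH, hcov, e, hars]
  simp only [ip_sub_left, ip_add_left, ip_sub_right, ip_smul_left, ip_smul_right, F.T_T, F.N_N,
    F.T_N, hNT, oTN]
  have oN' : ip (g (X y)) (covD g X a N y) (N y) = 0 := by linarith
  have oT' : ip (g (X y)) (covD g X a T y) (T y) = 0 := by linarith
  rw [oN', oT']
  have hcs' := hcs y hy
  have : pd a c y = s y * pd a s y / c y := by rw [← hder]; field_simp
  rw [this]
  field_simp
  linear_combination (pd a s y + c y * ip (g (X y)) (covD g X a N y) (T y)) * hcs'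

end IsFramedSurface

end Frame

end
end WangYau

namespace WangYau
noncomputable section

/-! ### Surfaces of revolution and rotating fields -/

/-- The squared speed of a profile curve. -/
def speedSq (g : R4 → Form) (γ : ℝ → R4) (θ : ℝ) : ℝ := ip (g (γ θ)) (deriv γ θ) (deriv γ θ)

/-- The squared length of the rotation field along a profile curve. -/
def orbitSq (g : R4 → Form) (γ : ℝ → R4) (θ : ℝ) : ℝ :=
  ip (g (γ θ)) (rotGen (γ θ)) (rotGen (γ θ))

/-- The speed of a profile curve. -/
def speed (g : R4 → Form) (γ : ℝ → R4) (θ : ℝ) : ℝ := √(speedSq g γ θ)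

/-- The radius of the circle traced by a point of a profile curve. -/
def radius (g : R4 → Form) (γ : ℝ → R4) (θ : ℝ) : ℝ := √(orbitSq g γ θ)

/-- The covariant derivative of `n` along the profile curve. -/
def covProfile (g : R4 → Form) (γ n : ℝ → R4) (θ : ℝ) : R4 :=
  deriv n θ + chr g (γ θ) (deriv γ θ) (n θ)

/-- The covariant derivative of the rotating field `n` along the orbits. -/
def covOrbit (g : R4 → Form) (γ n : ℝ → R4) (θ : ℝ) : R4 :=
  rotGen (n θ) + chr g (γ θ) (rotGen (γ θ)) (n θ)

/-- The expansion of a rotating field. -/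
def profileExpansion (g : R4 → Form) (γ n : ℝ → R4) (θ : ℝ) : ℝ :=
  (speedSq g γ θ)⁻¹ * ip (g (γ θ)) (covProfile g γ n θ) (deriv γ θ)
    + (orbitSq g γ θ)⁻¹ * ip (g (γ θ)) (covOrbit g γ n θ) (rotGen (γ θ))

/-- The profile curve of a smooth spacelike surface of revolution in an axisymmetric spacetime. -/
structure IsProfile (U : Set R4) (g : R4 → Form) (γ : ℝ → R4) : Prop where
  spacetime : IsAxisymmetricSpacetime U g
  smooth : ContDiff ℝ ∞ γ
  mem : ∀ θ, γ θ ∈ U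
  two : ∀ θ, γ θ 2 = 0
  speedSq_pos : ∀ θ, 0 < speedSq g γ θ
  orbitSq_pos : ∀ θ ∈ Ioo 0 Real.pi, 0 < orbitSq g γ θ

lemma mem_Ioo_of_polar {y : R2} (hy : y ∈ polarDomain) : y 0 ∈ Ioo 0 Real.pi := hy

lemma rotGen_smul (c : ℝ) (v : R4) : rotGen (c • v) = c • rotGen v := by
  ext i; fin_cases i <;> simp [rotGen]

lemma contDiffAt_spin {w : ℝ → R4} {y : R2} (hw : ContDiffAt ℝ ∞ w (y 0)) :
    ContDiffAt ℝ ∞ (spin w) y := by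
  have h0 : ContDiffAt ℝ ∞ (fun z : R2 => z 0) y := contDiffAt_pi.1 contDiffAt_id 0
  have h1 : ContDiffAt ℝ ∞ (fun z : R2 => z 1) y := contDiffAt_pi.1 contDiffAt_id 1
  have hc : ∀ i, ContDiffAt ℝ ∞ (fun z : R2 => w (z 0) i) y := fun i =>
    contDiffAt_apply (V := fun z : R2 => w (z 0)) (hw.comp y h0) i
  rw [contDiffAt_pi]
  intro i
  fin_cases i
  · exact hc 0
  · exact (h1.cos.mul (hc 1)).sub (h1.sin.mul (hc 2))
  · exact (h1.sin.mul (hc 1)).add (h1.cos.mul (hc 2))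
  · exact hc 3

lemma contDiff_deriv {γ : ℝ → R4} (h : ContDiff ℝ ∞ γ) : ContDiff ℝ ∞ (deriv γ) :=
  (contDiff_infty_iff_deriv.1 h).2

lemma contDiffAt_deriv {E : Type*} [NormedAddCommGroup E] [NormedSpace ℝ E] {f : ℝ → E} {x : ℝ}
    (h : ContDiffAt ℝ ∞ f x) : ContDiffAt ℝ ∞ (deriv f) x := by
  have := contDiffAt_fderiv_apply h (1 : ℝ)
  simpa using this

namespace IsProfile

variable {U : Set R4} {g : R4 → Form} {γ : ℝ → R4} {y : R2}

lemma differentiable (h : IsProfile U g γ) : Differentiable ℝ γ := h.smooth.differentiable (by simp)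

lemma deriv_two (h : IsProfile U g γ) (θ : ℝ) : deriv γ θ 2 = 0 := by
  have h1 : HasDerivAt (fun t => γ t 2) (deriv γ θ 2) θ :=
    hasDerivAt_pi.1 (h.differentiable θ).hasDerivAt 2
  have h2 : (fun t => γ t 2) = fun _ => 0 := by ext t; exact h.two t
  rw [h2] at h1
  exact h1.unique (hasDerivAt_const θ 0)

lemma symm (h : IsProfile U g γ) (θ : ℝ) : (g (γ θ))ᵀ = g (γ θ) := h.spacetime.symm (h.mem θ)

lemma contDiff_ip (h : IsProfile U g γ) {v w : ℝ → R4} {θ : ℝ} (hv : ContDiffAt ℝ ∞ v θ)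
    (hw : ContDiffAt ℝ ∞ w θ) : ContDiffAt ℝ ∞ (fun t => ip (g (γ t)) (v t) (w t)) θ :=
  h.spacetime.contDiffAt_ip h.smooth.contDiffAt (h.mem θ) hv hw

lemma contDiff_speedSq (h : IsProfile U g γ) : ContDiff ℝ ∞ (speedSq g γ) :=
  contDiff_iff_contDiffAt.2 fun _ =>
    h.contDiff_ip (contDiff_deriv h.smooth).contDiffAt (contDiff_deriv h.smooth).contDiffAt

lemma contDiffAt_rotGen {n : ℝ → R4} {θ : ℝ} (hn : ContDiffAt ℝ ∞ n θ) :
    ContDiffAt ℝ ∞ (fun t => rotGen (n t)) θ := by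
  rw [contDiffAt_pi]
  intro i
  fin_cases i
  · exact contDiffAt_const
  · exact (contDiffAt_apply hn 2).neg
  · exact contDiffAt_apply hn 1
  · exact contDiffAt_const

lemma contDiff_orbitSq (h : IsProfile U g γ) : ContDiff ℝ ∞ (orbitSq g γ) :=
  contDiff_iff_contDiffAt.2 fun _ =>
    h.contDiff_ip (contDiffAt_rotGen h.smooth.contDiffAt) (contDiffAt_rotGen h.smooth.contDiffAt)

lemma speed_pos (h : IsProfile U g γ) (θ : ℝ) : 0 < speed g γ θ := Real.sqrt_pos.2 (h.speedSq_pos θ)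

lemma speed_sq (h : IsProfile U g γ) (θ : ℝ) : speed g γ θ ^ 2 = speedSq g γ θ :=
  Real.sq_sqrt (h.speedSq_pos θ).le

lemma contDiff_speed (h : IsProfile U g γ) : ContDiff ℝ ∞ (speed g γ) :=
  contDiff_iff_contDiffAt.2 fun θ => h.contDiff_speedSq.contDiffAt.sqrt (h.speedSq_pos θ).ne'

lemma radius_pos (h : IsProfile U g γ) {θ : ℝ} (hθ : θ ∈ Ioo 0 Real.pi) : 0 < radius g γ θ :=
  Real.sqrt_pos.2 (h.orbitSq_pos θ hθ)

lemma contDiffAt_radius (h : IsProfile U g γ) {θ : ℝ} (hθ : θ ∈ Ioo 0 Real.pi) :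
    ContDiffAt ℝ ∞ (radius g γ) θ := h.contDiff_orbitSq.contDiffAt.sqrt (h.orbitSq_pos θ hθ).ne'

lemma pd_zero (h : IsProfile U g γ) (y : R2) : pd 0 (spin γ) y = rot4 (y 1) (deriv γ (y 0)) :=
  pd_zero_spin (h.differentiable _)

lemma pd_one (h : IsProfile U g γ) (y : R2) : pd 1 (spin γ) y = rot4 (y 1) (rotGen (γ (y 0))) :=
  pd_one_spin (h.differentiable _)

lemma ip_spin (h : IsProfile U g γ) (y : R2) (v w : R4) :
    ip (g (spin γ y)) (rot4 (y 1) v) (rot4 (y 1) w) = ip (g (γ (y 0))) v w :=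
  h.spacetime.rot_isometry _ _ (h.mem _) _ _

lemma ip_zero_zero (h : IsProfile U g γ) (y : R2) :
    ip (g (spin γ y)) (pd 0 (spin γ) y) (pd 0 (spin γ) y) = speedSq g γ (y 0) := by
  rw [h.pd_zero, h.ip_spin]; rfl

lemma ip_one_one (h : IsProfile U g γ) (y : R2) :
    ip (g (spin γ y)) (pd 1 (spin γ) y) (pd 1 (spin γ) y) = orbitSq g γ (y 0) := by
  rw [h.pd_one, h.ip_spin]; rfl

lemma ip_zero_one (h : IsProfile U g γ) (y : R2) :
    ip (g (spin γ y)) (pd 0 (spin γ) y) (pd 1 (spin γ) y) = 0 := by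
  rw [h.pd_zero, h.pd_one, h.ip_spin]
  exact h.spacetime.ip_rotGen (h.mem _) (h.two _) (h.deriv_two _) (h.two _)

lemma spin_mem (h : IsProfile U g γ) (y : R2) : spin γ y ∈ U := h.spacetime.rot_mem _ _ (h.mem _)

lemma ip_covD_zero (h : IsProfile U g γ) {n : ℝ → R4} (hn : DifferentiableAt ℝ n (y 0)) (c : R4) :
    ip (g (spin γ y)) (covD g (spin γ) 0 (spin n) y) (rot4 (y 1) c)
      = ip (g (γ (y 0))) (covProfile g γ n (y 0)) c := by
  rw [covD_eq, ip_add_left, h.pd_zero, pd_zero_spin hn, h.ip_spin, covProfile, ip_add_left,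
    ← h.spacetime.ip_chr_rot (y 1) (h.mem _)]
  rfl

lemma ip_covD_one (h : IsProfile U g γ) {n : ℝ → R4} (hn : DifferentiableAt ℝ n (y 0)) (c : R4) :
    ip (g (spin γ y)) (covD g (spin γ) 1 (spin n) y) (rot4 (y 1) c)
      = ip (g (γ (y 0))) (covOrbit g γ n (y 0)) c := by
  rw [covD_eq, ip_add_left, h.pd_one, pd_one_spin hn, h.ip_spin, covOrbit, ip_add_left,
    ← h.spacetime.ip_chr_rot (y 1) (h.mem _)]
  rfl

lemma expansion_spin (h : IsProfile U g γ) (hy : y ∈ polarDomain) {n : ℝ → R4}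
    (hn : DifferentiableAt ℝ n (y 0)) :
    expansion g (spin γ) (spin n) y = profileExpansion g γ n (y 0) := by
  rw [expansion_eq_of_orthogonal (h.spacetime.symm (h.spin_mem y)) (h.ip_zero_one y), h.ip_zero_zero,
    h.ip_one_one, h.pd_zero, h.pd_one, h.ip_covD_zero hn, h.ip_covD_one hn]
  · rfl
  · rw [h.ip_zero_zero]; exact h.speedSq_pos _
  · rw [h.ip_one_one]; exact h.orbitSq_pos _ hy

lemma areaDensity_spin (h : IsProfile U g γ) (y : R2) :
    areaDensity g (spin γ) y = speed g γ (y 0) * radius g γ (y 0) := by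
  rw [areaDensity, firstForm_eq_diagonal (h.spacetime.symm (h.spin_mem y)) (h.ip_zero_one y),
    h.ip_zero_zero, h.ip_one_one, Matrix.det_diagonal, speed, radius,
    ← Real.sqrt_mul (h.speedSq_pos _).le]
  simp

lemma inv_firstForm_spin (h : IsProfile U g γ) (hy : y ∈ polarDomain) :
    (firstForm g (spin γ) y)⁻¹
      = Matrix.diagonal ![(speedSq g γ (y 0))⁻¹, (orbitSq g γ (y 0))⁻¹] := by
  have h0 := h.speedSq_pos (y 0)
  have h1 := h.orbitSq_pos _ hy
  rw [← h.ip_zero_zero] at h0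
  rw [← h.ip_one_one] at h1
  rw [inv_firstForm (h.spacetime.symm (h.spin_mem y)) (h.ip_zero_one y) h0 h1, h.ip_zero_zero,
    h.ip_one_one]

/-- The divergence of a rotation invariant one-form without angular component. -/
lemma divergence_spin (h : IsProfile U g γ) (hy : y ∈ polarDomain) {f : Fin 2 → R2 → ℝ}
    {f₀ : ℝ → ℝ} (h0 : ∀ z ∈ polarDomain, f 0 z = f₀ (z 0)) (h1 : ∀ z ∈ polarDomain, f 1 z = 0)
    (hd : DifferentiableAt ℝ f₀ (y 0)) :
    divergence g (spin γ) f y = (speed g γ (y 0) * radius g γ (y 0))⁻¹ *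
      deriv (fun θ => radius g γ θ / speed g γ θ * f₀ θ) (y 0) := by
  -- The area density l r times the inverse metric coefficient l⁻² is r/l.
  have e0 : ∀ z ∈ polarDomain, areaDensity g (spin γ) z * ∑ b, (firstForm g (spin γ) z)⁻¹ 0 b * f b z
      = radius g γ (z 0) / speed g γ (z 0) * f₀ (z 0) := by
    intro z hz
    have := h.speed_pos (z 0)
    rw [h.inv_firstForm_spin hz, h.areaDensity_spin, Fin.sum_univ_two, h0 z hz]
    simp [← h.speed_sq]
    field_simp
  have e1 : ∀ z ∈ polarDomain,
      areaDensity g (spin γ) z * ∑ b, (firstForm g (spin γ) z)⁻¹ 1 b * f b z = 0 := by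
    intro z hz
    rw [h.inv_firstForm_spin hz, Fin.sum_univ_two, h1 z hz]
    simp
  have hd' : DifferentiableAt ℝ (fun θ => radius g γ θ / speed g γ θ * f₀ θ) (y 0) :=
    (((h.contDiffAt_radius hy).div h.contDiff_speed.contDiffAt
      (h.speed_pos _).ne').differentiableAt (by simp)).mul hd
  rw [divergence, Fin.sum_univ_two, (pd_eq_of_polar hy e0 hd'.hasDerivAt).1,
    (pd_eq_of_polar (h := fun _ => 0) hy e1 (hasDerivAt_const _ _)).2, h.areaDensity_spin, add_zero]

lemma laplacian_spin (h : IsProfile U g γ) (hy : y ∈ polarDomain) {f : R2 → ℝ} {τ : ℝ → ℝ}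
    (hf : ∀ z ∈ polarDomain, f z = τ (z 0)) (hτ : ContDiff ℝ ∞ τ) :
    laplacian g (spin γ) f y = (speed g γ (y 0) * radius g γ (y 0))⁻¹ *
      deriv (fun θ => radius g γ θ / speed g γ θ * deriv τ θ) (y 0) := by
  have hd : Differentiable ℝ τ := hτ.differentiable (by simp)
  refine h.divergence_spin hy ?_ ?_ ?_
  · exact fun z hz => (pd_eq_of_polar hz hf (hd _).hasDerivAt).1
  · exact fun z hz => (pd_eq_of_polar hz hf (hd _).hasDerivAt).2
  · exact ((contDiff_infty_iff_deriv.1 hτ).2.differentiable (by simp)) _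

lemma gradSq_spin (h : IsProfile U g γ) (hy : y ∈ polarDomain) {f : R2 → ℝ} {τ : ℝ → ℝ}
    (hf : ∀ z ∈ polarDomain, f z = τ (z 0)) (hτ : Differentiable ℝ τ) :
    gradSq g (spin γ) f y = (deriv τ (y 0) / speed g γ (y 0)) ^ 2 := by
  have e := pd_eq_of_polar hy hf (hτ _).hasDerivAt
  rw [gradSq, h.inv_firstForm_spin hy]
  simp [Fin.sum_univ_two, e.1, e.2, ← h.speed_sq]
  field_simp

/-- The radius of an axisymmetric surface in terms of the distance to the axis. -/
lemma orbitSq_eq (h : IsProfile U g γ) (θ : ℝ) :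
    orbitSq g γ θ = (γ θ 1) ^ 2 * g (γ θ) 2 2 := by
  simp [orbitSq, ip_eq_sum, rotGen, Fin.sum_univ_four, h.two θ]; ring

end IsProfile

/-- A frame of fields along the profile curve, in the plane of symmetry and orthogonal to the
curve. -/
structure IsProfileFrame (g : R4 → Form) (γ t n : ℝ → R4) (θ : ℝ) : Prop where
  t_smooth : ContDiffAt ℝ ∞ t θ
  n_smooth : ContDiffAt ℝ ∞ n θ
  t_two : t θ 2 = 0
  n_two : n θ 2 = 0
  t_tangent : ip (g (γ θ)) (deriv γ θ) (t θ) = 0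
  n_tangent : ip (g (γ θ)) (deriv γ θ) (n θ) = 0
  t_t : ip (g (γ θ)) (t θ) (t θ) = -1
  n_n : ip (g (γ θ)) (n θ) (n θ) = 1
  t_n : ip (g (γ θ)) (t θ) (n θ) = 0

namespace IsProfile

variable {U : Set R4} {g : R4 → Form} {γ t n : ℝ → R4} {y : R2}

lemma isFramedSurface (h : IsProfile U g γ)
    (hf : ∀ θ ∈ Ioo 0 Real.pi, IsProfileFrame g γ t n θ) :
    IsFramedSurface U g polarDomain (spin γ) (spin t) (spin n) where
  spacetime := h.spacetime
  isOpen := isOpen_polarDomain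
  mem := fun y _ => h.spin_mem y
  smooth := fun y _ => contDiffAt_spin h.smooth.contDiffAt
  smooth_T := fun y hy => contDiffAt_spin (hf _ hy).t_smooth
  smooth_N := fun y hy => contDiffAt_spin (hf _ hy).n_smooth
  frame := fun y hy => by
    have F := hf _ hy
    have hS := h.spacetime
    refine ⟨?_, ?_, h.ip_zero_one y, ?_, ?_, ?_, ?_, ?_⟩
    · rw [h.ip_zero_zero]; exact h.speedSq_pos _
    · rw [h.ip_one_one]; exact h.orbitSq_pos _ hy
    · intro a
      fin_cases a
      · simp only [Fin.zero_eta]; rw [h.pd_zero, spin.eq_1 t, h.ip_spin, F.t_tangent]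
      · simp only [Fin.mk_one]; rw [h.pd_one, spin.eq_1 t, h.ip_spin, ip_comm (h.symm _)]
        exact hS.ip_rotGen (h.mem _) (h.two _) F.t_two (h.two _)
    · intro a
      fin_cases a
      · simp only [Fin.zero_eta]; rw [h.pd_zero, spin.eq_1 n, h.ip_spin, F.n_tangent]
      · simp only [Fin.mk_one]; rw [h.pd_one, spin.eq_1 n, h.ip_spin, ip_comm (h.symm _)]
        exact hS.ip_rotGen (h.mem _) (h.two _) F.n_two (h.two _)
    · rw [spin.eq_1 t, h.ip_spin, F.t_t]
    · rw [spin.eq_1 n, h.ip_spin, F.n_n]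
    · rw [spin.eq_1 t, spin.eq_1 n, h.ip_spin, F.t_n]

/-- The angular component of the connection form vanishes. -/
lemma ip_covD_one_eq_zero (h : IsProfile U g γ) (hf : IsProfileFrame g γ t n (y 0)) :
    ip (g (spin γ y)) (covD g (spin γ) 1 (spin n) y) (spin t y) = 0 := by
  -- Both terms of the derivative along an orbit are odd under the reflection: one pairs the
  -- rotation field with the symmetry plane, the other has a single rotation field in the
  -- Christoffel term.
  rw [spin.eq_1 t, h.ip_covD_one (hf.n_smooth.differentiableAt (by simp)), covOrbit, ip_add_left,
    ip_comm (h.symm _), h.spacetime.ip_rotGen (h.mem _) (h.two _) hf.t_two hf.n_two,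
    h.spacetime.ip_chr_rotGen_left (h.mem _) (h.two _) (h.two _) hf.n_two hf.t_two, add_zero]

end IsProfile

end
end WangYau

namespace WangYau
noncomputable section

/-! ### Mean curvature and connection form of a framed surface of revolution -/

namespace IsProfile

variable {U : Set R4} {g : R4 → Form} {γ t n : ℝ → R4} {y : R2}

lemma meanCurvSq_spin (h : IsProfile U g γ) (hf : ∀ θ ∈ Ioo 0 Real.pi, IsProfileFrame g γ t n θ)
    (hy : y ∈ polarDomain) :
    meanCurvSq g (spin γ) y
      = profileExpansion g γ n (y 0) ^ 2 - profileExpansion g γ t (y 0) ^ 2 := by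
  rw [(h.isFramedSurface hf).meanCurvSq_eq hy,
    h.expansion_spin hy ((hf _ hy).n_smooth.differentiableAt (by simp)),
    h.expansion_spin hy ((hf _ hy).t_smooth.differentiableAt (by simp))]

lemma contDiffAt_profileExpansion (h : IsProfile U g γ) {θ : ℝ} (hθ : θ ∈ Ioo 0 Real.pi)
    {w : ℝ → R4} (hw : ContDiffAt ℝ ∞ w θ) : ContDiffAt ℝ ∞ (profileExpansion g γ w) θ := by
  have hγ := h.smooth.contDiffAt (x := θ)
  have hγ' := (contDiff_deriv h.smooth).contDiffAt (x := θ)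
  have hr := contDiffAt_rotGen hγ
  refine ContDiffAt.add (ContDiffAt.mul ?_ ?_) (ContDiffAt.mul ?_ ?_)
  · exact h.contDiff_speedSq.contDiffAt.inv (h.speedSq_pos θ).ne'
  · exact h.contDiff_ip ((contDiffAt_deriv hw).add (h.spacetime.contDiffAt_chr hγ (h.mem θ) hγ' hw))
      hγ'
  · exact h.contDiff_orbitSq.contDiffAt.inv (h.orbitSq_pos θ hθ).ne'
  · exact h.contDiff_ip ((contDiffAt_rotGen hw).add (h.spacetime.contDiffAt_chr hγ (h.mem θ) hr hw)) hr

/-- The connection form of a framed surface of revolution. -/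
lemma alphaH_spin (h : IsProfile U g γ) (hf : ∀ θ ∈ Ioo 0 Real.pi, IsProfileFrame g γ t n θ)
    {u : ℝ → R4} (hu : ∀ y, sliceNormal g (spin γ) y = spin u y)
    (hut : ∀ θ ∈ Ioo 0 Real.pi, ip (g (γ θ)) (u θ) (t θ) < 0)
    (hun : ∀ θ ∈ Ioo 0 Real.pi, ip (g (γ θ)) (u θ) (n θ) = 0)
    (hn : ∀ θ ∈ Ioo 0 Real.pi, 0 < profileExpansion g γ n θ)
    (hH : ∀ θ ∈ Ioo 0 Real.pi,
      0 < profileExpansion g γ n θ ^ 2 - profileExpansion g γ t θ ^ 2)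
    (hy : y ∈ polarDomain) :
    alphaH g (spin γ) 0 y = ip (g (γ (y 0))) (covProfile g γ n (y 0)) (t (y 0))
      + deriv (fun θ => Real.arsinh (profileExpansion g γ t θ /
          √(profileExpansion g γ n θ ^ 2 - profileExpansion g γ t θ ^ 2))) (y 0) ∧
    alphaH g (spin γ) 1 y = 0 := by
  have S := h.isFramedSurface hf
  have hH' : ∀ z ∈ polarDomain, 0 < meanCurvSq g (spin γ) z := fun z hz => by
    rw [h.meanCurvSq_spin hf hz]; exact hH _ hz
  have hn' : 0 < expansion g (spin γ) (spin n) y := by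
    rw [h.expansion_spin hy ((hf _ hy).n_smooth.differentiableAt (by simp))]; exact hn _ hy
  have hut' : ip (g (spin γ y)) (sliceNormal g (spin γ) y) (spin t y) < 0 := by
    rw [hu, spin.eq_1 u, spin.eq_1 t, h.ip_spin]; exact hut _ hy
  have hun' : ip (g (spin γ y)) (sliceNormal g (spin γ) y) (spin n y) = 0 := by
    rw [hu, spin.eq_1 u, spin.eq_1 n, h.ip_spin]; exact hun _ hy
  have e : ∀ z ∈ polarDomain,
      Real.arsinh (expansion g (spin γ) (spin t) z / meanCurvNorm g (spin γ) z) =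
      (fun θ => Real.arsinh (profileExpansion g γ t θ /
          √(profileExpansion g γ n θ ^ 2 - profileExpansion g γ t θ ^ 2))) (z 0) := by
    intro z hz
    simp only
    rw [meanCurvNorm, h.meanCurvSq_spin hf hz,
      h.expansion_spin hz ((hf _ hz).t_smooth.differentiableAt (by simp))]
  have hd : DifferentiableAt ℝ (fun θ => Real.arsinh (profileExpansion g γ t θ /
          √(profileExpansion g γ n θ ^ 2 - profileExpansion g γ t θ ^ 2))) (y 0) := by
    have c1 := h.contDiffAt_profileExpansion hy (hf _ hy).t_smooth
    have c2 := h.contDiffAt_profileExpansion hy (hf _ hy).n_smooth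
    have := (c1.div (((c2.pow 2).sub (c1.pow 2)).sqrt (hH _ hy).ne')
      (Real.sqrt_pos.2 (hH _ hy)).ne').arsinh
    exact this.differentiableAt (by simp)
  have e' := pd_eq_of_polar hy e hd.hasDerivAt
  constructor
  · rw [S.alphaH_eq hy hH' hn' hut' hun', e'.1, spin.eq_1 t,
      h.ip_covD_zero ((hf _ hy).n_smooth.differentiableAt (by simp))]
  · rw [S.alphaH_eq hy hH' hn' hut' hun', e'.2, h.ip_covD_one_eq_zero (hf _ hy), add_zero]

end IsProfile

/-! ### The normal of the slice -/

lemma timeNormal_eq (A : Form) :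
    timeNormal A = (-(√(-(A⁻¹ 0 0)))⁻¹) • (A⁻¹ *ᵥ Pi.single 0 1) := by
  ext μ
  simp [timeNormal]; ring

section TimeNormal

variable {A : Form}

/-- The restriction of `A` to the spatial directions is positive definite. -/
def SpatiallyPositive (A : Form) : Prop := ∀ w : R4, w 0 = 0 → w ≠ 0 → 0 < ip A w w

lemma ip_raise_zero (hA : IsLorentzian A) (w : R4) :
    ip A (A⁻¹ *ᵥ Pi.single 0 1) w = w 0 := by
  rw [ip_inv_mulVec hA.symm hA.isUnit_det]; simp

/-- A⁻¹₀₀ is the squared length of the raised covector dt, which is orthogonal to the spatial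
directions. If it were zero, that vector would be spatial, nonzero and null; if positive, `A` would
be nonnegative on all vectors, against the timelike vector supplied by the signature. -/
lemma inv_zero_zero_neg (hA : IsLorentzian A) (hp : SpatiallyPositive A) : A⁻¹ 0 0 < 0 := by
  set n : R4 := A⁻¹ *ᵥ Pi.single 0 1 with hn
  have hn0 : n 0 = A⁻¹ 0 0 := by simp [hn]
  have hne : n ≠ 0 := by
    intro h0
    have := ip_raise_zero hA (Pi.single 0 1)
    rw [← hn, h0, ip_zero_left] at this
    simp at this
  by_contra hneg
  push Not at hneg
  rcases hneg.eq_or_lt with h0 | hpos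
  · have h1 := hp n (by rw [hn0, ← h0]) hne
    rw [hn, ip_raise_zero hA, ← hn, hn0, ← h0] at h1
    exact lt_irrefl _ h1
  · obtain ⟨B, hB, e⟩ := hA
    have hA : IsLorentzian A := ⟨B, hB, e⟩
    set w : R4 := B *ᵥ Pi.single 0 1 with hw
    have hww : ip A w w = -1 := by
      have e1 : ip A w w = (Pi.single 0 1 : R4) ⬝ᵥ ((Bᵀ * A * B) *ᵥ Pi.single 0 1) := by
        rw [Matrix.mul_assoc, ← Matrix.mulVec_mulVec, Matrix.dotProduct_mulVec,
          Matrix.vecMul_transpose, ← Matrix.mulVec_mulVec]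
        rfl
      rw [e1, e]
      simp [minkowski]
    set a := w 0 / A⁻¹ 0 0 with ha
    set v : R4 := w - a • n with hv
    have hv0 : v 0 = 0 := by
      simp [hv, hn0, ha]; field_simp; ring
    have e1 : w = a • n + v := by rw [hv]; abel
    have e2 : ip A w w = a ^ 2 * A⁻¹ 0 0 + ip A v v := by
      rw [e1]
      simp only [ip_add_left, ip_add_right, ip_smul_left, ip_smul_right]
      rw [ip_comm hA.symm v n, hn, ip_raise_zero hA, ip_raise_zero hA, ← hn, hn0, hv0]
      ring
    have e3 : 0 ≤ ip A v v := by
      by_cases hv' : v = 0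
      · rw [hv', ip_zero_left]
      · exact (hp v hv0 hv').le
    have : 0 ≤ a ^ 2 * A⁻¹ 0 0 := by positivity
    linarith

lemma ip_timeNormal (hA : IsLorentzian A) (w : R4) :
    ip A (timeNormal A) w = -(w 0) / √(-(A⁻¹ 0 0)) := by
  rw [timeNormal_eq, ip_smul_left, ip_raise_zero hA]; ring

lemma timeNormal_zero (hA : IsLorentzian A) (hp : SpatiallyPositive A) :
    timeNormal A 0 = √(-(A⁻¹ 0 0)) := by
  have h := inv_zero_zero_neg hA hp
  rw [timeNormal, Real.div_sqrt]

lemma timeNormal_zero_pos (hA : IsLorentzian A) (hp : SpatiallyPositive A) :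
    0 < timeNormal A 0 := by
  rw [timeNormal_zero hA hp]
  exact Real.sqrt_pos.2 (by linarith [inv_zero_zero_neg hA hp])

lemma ip_timeNormal_self (hA : IsLorentzian A) (hp : SpatiallyPositive A) :
    ip A (timeNormal A) (timeNormal A) = -1 := by
  have := Real.sqrt_pos.2 (show 0 < -(A⁻¹ 0 0) by linarith [inv_zero_zero_neg hA hp])
  rw [ip_timeNormal hA, timeNormal_zero hA hp]
  field_simp

/-- The normal is determined by the form and the covector dt alone, so a map that preserves both
carries normal to normal. Surjectivity is supplied by the right inverse `M`. -/
lemma timeNormal_map {A' : Form} (hA : IsLorentzian A) (hA' : IsLorentzian A') {L M : R4 → R4}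
    (hLM : ∀ z, L (M z) = z) (h0 : ∀ z, L z 0 = z 0) (hsmul : ∀ (c : ℝ) z, L (c • z) = c • L z)
    (hL : ∀ v w, ip A' (L v) (L w) = ip A v w) :
    timeNormal A' = L (timeNormal A) := by
  have h1 : A'⁻¹ *ᵥ Pi.single 0 1 = L (A⁻¹ *ᵥ Pi.single 0 1) := by
    refine eq_of_ip_eq hA'.isUnit_det hA'.symm fun z => ?_
    rw [ip_raise_zero hA', ← hLM z, hL, ip_raise_zero hA, h0]
  have h2 : A'⁻¹ 0 0 = A⁻¹ 0 0 := by
    have := congrFun h1 0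
    rw [h0] at this
    simpa using this
  rw [timeNormal_eq, timeNormal_eq, h1, h2, hsmul]

end TimeNormal

/-- The determinant of four vectors. -/
def det4 (a b c d : R4) : ℝ := (Matrix.of ![a, b, c, d] : Form).det

lemma det4_expand (a b c d : R4) : det4 a b c d =
    a 0 * (b 1 * (c 2 * d 3 - c 3 * d 2) - b 2 * (c 1 * d 3 - c 3 * d 1)
      + b 3 * (c 1 * d 2 - c 2 * d 1))
    - a 1 * (b 0 * (c 2 * d 3 - c 3 * d 2) - b 2 * (c 0 * d 3 - c 3 * d 0)
      + b 3 * (c 0 * d 2 - c 2 * d 0))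
    + a 2 * (b 0 * (c 1 * d 3 - c 3 * d 1) - b 1 * (c 0 * d 3 - c 3 * d 0)
      + b 3 * (c 0 * d 1 - c 1 * d 0))
    - a 3 * (b 0 * (c 1 * d 2 - c 2 * d 1) - b 1 * (c 0 * d 2 - c 2 * d 0)
      + b 2 * (c 0 * d 1 - c 1 * d 0)) := by
  simp [det4, Matrix.det_succ_row_zero, Fin.sum_univ_succ, Fin.succAbove]
  ring

lemma det4_rot (φ : ℝ) (a b c d : R4) :
    det4 (rot4 φ a) (rot4 φ b) (rot4 φ c) (rot4 φ d) = det4 a b c d := by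
  have e : (Matrix.of ![rot4 φ a, rot4 φ b, rot4 φ c, rot4 φ d] : Form) =
      Matrix.of ![a, b, c, d] * !![1, 0, 0, 0; 0, Real.cos φ, Real.sin φ, 0;
        0, -Real.sin φ, Real.cos φ, 0; 0, 0, 0, 1] := by
    ext i j
    fin_cases i <;> fin_cases j <;>
      simp [Matrix.mul_apply, Fin.sum_univ_four, rot4] <;> ring
  have hd : (!![1, 0, 0, 0; 0, Real.cos φ, Real.sin φ, 0;
        0, -Real.sin φ, Real.cos φ, 0; 0, 0, 0, 1] : Form).det = 1 := by
    simp [Matrix.det_succ_row_zero, Fin.sum_univ_succ, Fin.succAbove]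
    nlinarith [Real.sin_sq_add_cos_sq φ]
  rw [det4, e, Matrix.det_mul, hd, mul_one]; rfl

/-! ### The normal of a surface of revolution in the slice -/

/-- The determinant of the metric on the half plane of the profile curves. -/
def planeDet (g : R4 → Form) (p : R4) : ℝ := g p 1 1 * g p 3 3 - g p 1 3 ^ 2

/-- The unit vector in the half plane `φ = 0` of the slice that is orthogonal to `q`. -/
def planeNormal (g : R4 → Form) (p q : R4) : R4 :=
  (√(ip (g p) q q) * √(planeDet g p))⁻¹ •
    ![0, -ip (g p) q (Pi.single 3 1), 0, ip (g p) q (Pi.single 1 1)]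

namespace IsAxisymmetricSpacetime

variable {U : Set R4} {g : R4 → Form} {p q : R4}

lemma spatiallyPositive (h : IsAxisymmetricSpacetime U g) (hp : p ∈ U) (h0 : p 0 = 0) :
    SpatiallyPositive (g p) := h.slice_spacelike p hp h0

lemma timeNormal_rot (h : IsAxisymmetricSpacetime U g) (hp : p ∈ U) (φ : ℝ) :
    timeNormal (g (rot4 φ p)) = rot4 φ (timeNormal (g p)) :=
  timeNormal_map (h.lorentzian p hp) (h.lorentzian _ (h.rot_mem φ p hp)) (rot4_neg_rot4 φ)
    (fun _ => rfl) (fun c z => rot4_smul φ c z) (h.rot_isometry φ p hp)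

lemma timeNormal_two (h : IsAxisymmetricSpacetime U g) (hp : p ∈ U) (h2 : p 2 = 0) :
    timeNormal (g p) 2 = 0 := by
  have h1 : timeNormal (g p) = refl4 (timeNormal (g p)) :=
    timeNormal_map (M := refl4) (h.lorentzian p hp) (h.lorentzian p hp)
      (fun z => by ext i; fin_cases i <;> simp [refl4]) (fun _ => rfl)
      (fun c z => refl4_smul c z) (h.ip_refl hp h2)
  have := congrFun h1 2
  simp [refl4] at this
  linarith

lemma ip_single (A : Form) (i j : Fin 4) : ip A (Pi.single i 1) (Pi.single j 1) = A i j := by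
  simp [ip]

/-- On the plane y = 0 the vector ∂_y is the image of ∂_x under the rotation generator, hence
orthogonal to the plane. -/
lemma entry_two (h : IsAxisymmetricSpacetime U g) (hp : p ∈ U) (h2 : p 2 = 0) {i : Fin 4}
    (hi : i ≠ 2) : g p i 2 = 0 ∧ g p 2 i = 0 := by
  have hs := h.symm hp
  have e : rotGen (Pi.single 1 1) = Pi.single 2 1 := by
    ext i; fin_cases i <;> simp [rotGen]
  have h1 := h.ip_rotGen hp h2 (v := Pi.single i 1) (w := Pi.single 1 1)
    (by simp [hi.symm]) (by simp)
  rw [e, ip_single] at h1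
  exact ⟨h1, by rw [← h1]; exact congrFun (congrFun hs i) 2⟩

lemma entry_comm (h : IsAxisymmetricSpacetime U g) (hp : p ∈ U) (i j : Fin 4) :
    g p i j = g p j i := congrFun (congrFun (h.symm hp) j) i

lemma entry_pos (h : IsAxisymmetricSpacetime U g) (hp : p ∈ U) (h0 : p 0 = 0) {i : Fin 4}
    (hi : i ≠ 0) : 0 < g p i i := by
  have := h.slice_spacelike p hp h0 (Pi.single i 1) (by simp [hi.symm]) (by simp)
  rwa [ip_single] at this

lemma planeDet_pos (h : IsAxisymmetricSpacetime U g) (hp : p ∈ U) (h0 : p 0 = 0) :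
    0 < planeDet g p := by
  have h11 := h.entry_pos hp h0 (i := 1) (by simp)
  -- The squared length of this test vector is g₁₁ times the determinant of the plane block.
  have := h.slice_spacelike p hp h0 ![0, -g p 1 3, 0, g p 1 1] (by simp) (by
    intro e
    have := congrFun e 3
    simp at this
    exact h11.ne' this)
  simp [ip_eq_sum, Fin.sum_univ_four, h.entry_comm hp 3 1] at this
  have e : 0 < g p 1 1 * planeDet g p := by rw [planeDet]; linarith
  exact pos_of_mul_pos_right e h11.le

/-- The components are the pairings of `q` with ∂_x and ∂_z, exchanged with a sign, so the two
contributions cancel once the form is symmetric; the second alternative stands in for that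
hypothesis. -/
lemma planeNormal_orthogonal (q : R4) : ip (g p) (planeNormal g p q) q = 0 ∨ (g p)ᵀ ≠ g p := by
  by_cases hs : (g p)ᵀ = g p
  · left
    have h13 : g p 3 1 = g p 1 3 := congrFun (congrFun hs 1) 3
    have e : (![0, -ip (g p) q (Pi.single 3 1), 0, ip (g p) q (Pi.single 1 1)] : R4)
        = (-ip (g p) q (Pi.single 3 1)) • Pi.single 1 1
          + (ip (g p) q (Pi.single 1 1)) • Pi.single 3 1 := by
      ext i; fin_cases i <;> simp
    rw [planeNormal, ip_smul_left, e, ip_add_left, ip_smul_left, ip_smul_left,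
      ip_comm hs (Pi.single 1 1), ip_comm hs (Pi.single 3 1)]
    ring
  · exact Or.inr hs

lemma ip_planeNormal (h : IsAxisymmetricSpacetime U g) (hp : p ∈ U) (q : R4) :
    ip (g p) q (planeNormal g p q) = 0 := by
  rw [ip_comm (h.symm hp)]
  exact (planeNormal_orthogonal q).resolve_right (by simpa using h.symm hp)

lemma planeNormal_zero (q : R4) : planeNormal g p q 0 = 0 := by simp [planeNormal]
lemma planeNormal_two (q : R4) : planeNormal g p q 2 = 0 := by simp [planeNormal]

lemma ip_planeNormal_self (h : IsAxisymmetricSpacetime U g) (hp : p ∈ U) (h0 : p 0 = 0)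
    (hq0 : q 0 = 0) (hq2 : q 2 = 0) (hq : 0 < ip (g p) q q) :
    ip (g p) (planeNormal g p q) (planeNormal g p q) = 1 := by
  have hD := h.planeDet_pos hp h0
  have e : ip (g p) ![0, -ip (g p) q (Pi.single 3 1), 0, ip (g p) q (Pi.single 1 1)]
      ![0, -ip (g p) q (Pi.single 3 1), 0, ip (g p) q (Pi.single 1 1)]
      = ip (g p) q q * planeDet g p := by
    simp [ip_eq_sum, Fin.sum_univ_four, hq0, hq2, h.entry_comm hp 3 1, planeDet]
    ring
  rw [planeNormal, ip_smul_left, ip_smul_right, e]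
  have h1 := Real.sq_sqrt hq.le
  have h2 := Real.sq_sqrt hD.le
  have h3 := Real.sqrt_pos.2 hq
  have h4 := Real.sqrt_pos.2 hD
  field_simp
  rw [h1, h2]

end IsAxisymmetricSpacetime

/-- The profile curve of a surface of revolution in the slice `t = 0`. -/
structure IsSliceProfile (U : Set R4) (g : R4 → Form) (γ : ℝ → R4) : Prop
    extends IsProfile U g γ where
  zero : ∀ θ, γ θ 0 = 0

/-- The normal of the slice along a profile curve. -/
def timeField (g : R4 → Form) (γ : ℝ → R4) (θ : ℝ) : R4 := timeNormal (g (γ θ))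

/-- The unit normal in the slice along a profile curve, on the side fixed by the orientation of
the half plane. -/
def normalField (g : R4 → Form) (γ : ℝ → R4) (θ : ℝ) : R4 := planeNormal g (γ θ) (deriv γ θ)

namespace IsAxisymmetricSpacetime

variable {E : Type*} [NormedAddCommGroup E] [NormedSpace ℝ E] {e : E}
  {U : Set R4} {g : R4 → Form}

lemma contDiffAt_timeNormal (h : IsAxisymmetricSpacetime U g) {X : E → R4}
    (hX : ContDiffAt ℝ ∞ X e) (he : X e ∈ U) (h0 : X e 0 = 0) :
    ContDiffAt ℝ ∞ (fun z => timeNormal (g (X z))) e := by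
  have hneg := inv_zero_zero_neg (h.lorentzian _ he) (h.spatiallyPositive he h0)
  have hpos : 0 < -((g (X e))⁻¹ 0 0) := by linarith
  rw [contDiffAt_pi]
  intro μ
  refine ((h.contDiffAt_inv hX he μ 0).neg).div
    (((h.contDiffAt_inv hX he 0 0).neg).sqrt hpos.ne') (Real.sqrt_pos.2 hpos).ne'

lemma contDiffAt_planeNormal (h : IsAxisymmetricSpacetime U g) {X Q : E → R4}
    (hX : ContDiffAt ℝ ∞ X e) (he : X e ∈ U) (h0 : X e 0 = 0) (hQ : ContDiffAt ℝ ∞ Q e)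
    (hq : 0 < ip (g (X e)) (Q e) (Q e)) :
    ContDiffAt ℝ ∞ (fun z => planeNormal g (X z) (Q z)) e := by
  have hD := h.planeDet_pos he h0
  have hDs : ContDiffAt ℝ ∞ (fun z => planeDet g (X z)) e :=
    ((h.contDiffAt_comp hX he 1 1).mul (h.contDiffAt_comp hX he 3 3)).sub
      ((h.contDiffAt_comp hX he 1 3).pow 2)
  have h1 : ContDiffAt ℝ ∞ (fun z => (√(ip (g (X z)) (Q z) (Q z)) * √(planeDet g (X z)))⁻¹) e :=
    (((h.contDiffAt_ip hX he hQ hQ).sqrt hq.ne').mul (hDs.sqrt hD.ne')).inv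
      (mul_ne_zero (Real.sqrt_pos.2 hq).ne' (Real.sqrt_pos.2 hD).ne')
  have h2 : ContDiffAt ℝ ∞ (fun z => (![0, -ip (g (X z)) (Q z) (Pi.single 3 1), 0,
      ip (g (X z)) (Q z) (Pi.single 1 1)] : R4)) e := by
    rw [contDiffAt_pi]
    intro i
    fin_cases i
    · exact contDiffAt_const
    · exact (h.contDiffAt_ip hX he hQ contDiffAt_const).neg
    · exact contDiffAt_const
    · exact h.contDiffAt_ip hX he hQ contDiffAt_const
  exact h1.smul h2

end IsAxisymmetricSpacetime

lemma profileExpansion_smul {g : R4 → Form} {γ n : ℝ → R4} {θ : ℝ} (hn : DifferentiableAt ℝ n θ) (c : ℝ) :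
    profileExpansion g γ (fun t => c • n t) θ = c * profileExpansion g γ n θ := by
  have h1 : deriv (fun t => c • n t) θ = c • deriv n θ := deriv_fun_const_smul c hn
  simp only [profileExpansion, covProfile, covOrbit, h1, chr_smul_right, rotGen_smul,
    ip_add_left, ip_smul_left]
  ring

lemma profileExpansion_add {g : R4 → Form} {γ n m : ℝ → R4} {θ : ℝ}
    (hn : DifferentiableAt ℝ n θ) (hm : DifferentiableAt ℝ m θ) :
    profileExpansion g γ (fun t => n t + m t) θ
      = profileExpansion g γ n θ + profileExpansion g γ m θ := by
  have h1 : deriv (fun t => n t + m t) θ = deriv n θ + deriv m θ := deriv_fun_add hn hm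
  have h2 : rotGen (n θ + m θ) = rotGen (n θ) + rotGen (m θ) := by
    ext i; fin_cases i <;> simp [rotGen]; ring
  simp only [profileExpansion, covProfile, covOrbit, h1, h2, chr_add_right, ip_add_left]
  ring

namespace IsSliceProfile

variable {U : Set R4} {g : R4 → Form} {γ : ℝ → R4} {y : R2}

lemma deriv_zero (h : IsSliceProfile U g γ) (θ : ℝ) : deriv γ θ 0 = 0 := by
  have h1 : HasDerivAt (fun t => γ t 0) (deriv γ θ 0) θ :=
    hasDerivAt_pi.1 (h.differentiable θ).hasDerivAt 0
  have h2 : (fun t => γ t 0) = fun _ => 0 := by ext t; exact h.zero t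
  rw [h2] at h1
  exact h1.unique (hasDerivAt_const θ 0)

lemma lorentzian (h : IsSliceProfile U g γ) (θ : ℝ) : IsLorentzian (g (γ θ)) :=
  h.spacetime.lorentzian _ (h.mem θ)

lemma spatiallyPositive (h : IsSliceProfile U g γ) (θ : ℝ) : SpatiallyPositive (g (γ θ)) :=
  h.spacetime.spatiallyPositive (h.mem θ) (h.zero θ)

lemma contDiff_timeField (h : IsSliceProfile U g γ) : ContDiff ℝ ∞ (timeField g γ) :=
  contDiff_iff_contDiffAt.2 fun θ =>
    h.spacetime.contDiffAt_timeNormal h.smooth.contDiffAt (h.mem θ) (h.zero θ)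

lemma contDiff_normalField (h : IsSliceProfile U g γ) : ContDiff ℝ ∞ (normalField g γ) :=
  contDiff_iff_contDiffAt.2 fun θ =>
    h.spacetime.contDiffAt_planeNormal h.smooth.contDiffAt (h.mem θ) (h.zero θ)
      (contDiff_deriv h.smooth).contDiffAt (h.speedSq_pos θ)

lemma isProfileFrame (h : IsSliceProfile U g γ) {σ : ℝ} (hσ : σ ^ 2 = 1) (θ : ℝ) :
    IsProfileFrame g γ (timeField g γ) (fun t => σ • normalField g γ t) θ where
  t_smooth := h.contDiff_timeField.contDiffAt
  n_smooth := h.contDiff_normalField.contDiffAt.const_smul σ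
  t_two := h.spacetime.timeNormal_two (h.mem θ) (h.two θ)
  n_two := by simp [normalField, IsAxisymmetricSpacetime.planeNormal_two]
  t_tangent := by
    rw [ip_comm (h.symm θ), timeField, ip_timeNormal (h.lorentzian θ), h.deriv_zero]; simp
  n_tangent := by
    rw [ip_smul_right, normalField, h.spacetime.ip_planeNormal (h.mem θ), mul_zero]
  t_t := ip_timeNormal_self (h.lorentzian θ) (h.spatiallyPositive θ)
  n_n := by
    rw [ip_smul_left, ip_smul_right, normalField, h.spacetime.ip_planeNormal_self (h.mem θ)
      (h.zero θ) (h.deriv_zero θ) (h.deriv_two θ) (h.speedSq_pos θ)]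
    linarith
  t_n := by
    rw [timeField, ip_timeNormal (h.lorentzian θ)]
    simp [normalField, IsAxisymmetricSpacetime.planeNormal_zero]

lemma sliceNormal_spin (h : IsSliceProfile U g γ) (y : R2) :
    sliceNormal g (spin γ) y = spin (timeField g γ) y := by
  rw [sliceNormal, spin, h.spacetime.timeNormal_rot (h.mem _)]; rfl

/-- Both vectors are compared through their pairings with arbitrary `z`; the determinant is rotation
invariant and so can be expanded on the meridian, where the metric splits off ∂_y. The scalar
carries the sign of the coordinate γ¹. -/
lemma outDirection_spin (h : IsSliceProfile U g γ) (y : R2) :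
    outDirection g (spin γ) y =
      (timeField g γ (y 0) 0 * γ (y 0) 1 * √(speedSq g γ (y 0)) / √(planeDet g (γ (y 0)))) •
        rot4 (y 1) (normalField g γ (y 0)) := by
  have hX := h.spin_mem y
  refine eq_of_ip_eq (h.spacetime.isUnit_det hX) (h.spacetime.symm hX) fun z => ?_
  rw [outDirection, ip_inv_mulVec (h.spacetime.symm hX) (h.spacetime.isUnit_det hX)]
  have e1 : (fun μ => (Matrix.of ![sliceNormal g (spin γ) y, Pi.single μ 1, pd 0 (spin γ) y,
      pd 1 (spin γ) y] : Form).det) ⬝ᵥ z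
      = det4 (sliceNormal g (spin γ) y) z (pd 0 (spin γ) y) (pd 1 (spin γ) y) := by
    change (fun μ => det4 (sliceNormal g (spin γ) y) (Pi.single μ 1) (pd 0 (spin γ) y)
      (pd 1 (spin γ) y)) ⬝ᵥ z = _
    simp only [dotProduct, Fin.sum_univ_four, det4_expand]
    simp
    ring
  rw [e1, ← rot4_neg_rot4 (y 1) z, h.sliceNormal_spin, h.pd_zero, h.pd_one, spin, det4_rot,
    ip_smul_left, h.ip_spin]
  set w := rot4 (-(y 1)) z
  set θ := y 0
  have hD := h.spacetime.planeDet_pos (h.mem θ) (h.zero θ)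
  have hE := h.speedSq_pos θ
  have hD' := Real.sqrt_pos.2 hD
  have hE' := Real.sqrt_pos.2 hE
  have hDD := Real.sq_sqrt hD.le
  have u1 := ip_timeNormal (h.lorentzian θ) (Pi.single 1 1)
  have u3 := ip_timeNormal (h.lorentzian θ) (Pi.single 3 1)
  have u2 := h.spacetime.timeNormal_two (h.mem θ) (h.two θ)
  have q0 := h.deriv_zero θ
  have q2 := h.deriv_two θ
  have g02 := h.spacetime.entry_two (h.mem θ) (h.two θ) (i := 0) (by simp)
  have g12 := h.spacetime.entry_two (h.mem θ) (h.two θ) (i := 1) (by simp)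
  have g32 := h.spacetime.entry_two (h.mem θ) (h.two θ) (i := 3) (by simp)
  have g31 := h.spacetime.entry_comm (h.mem θ) 3 1
  have g30 := h.spacetime.entry_comm (h.mem θ) 3 0
  have g10 := h.spacetime.entry_comm (h.mem θ) 1 0
  simp [ip_eq_sum, Fin.sum_univ_four, u2, g12, g32, g31] at u1 u3
  rw [normalField, planeNormal, ip_smul_left]
  change _ = _ * ((√(speedSq g γ θ) * √(planeDet g (γ θ)))⁻¹ * _)
  rw [show ∀ x a b c : ℝ, 0 < b → 0 < c → a * b / c * ((b * c)⁻¹ * x) = a * x / c ^ 2 from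
    fun x a b c hb hc => by field_simp, hDD, eq_div_iff hD.ne']
  · rw [det4_expand]
    simp only [timeField, rotGen, ip_eq_sum, Fin.sum_univ_four, q0, q2, u2, g02, g12, g32, g31, g30,
      g10, planeDet, h.two θ, Matrix.cons_val_zero, Matrix.cons_val_one,
      Matrix.cons_val]
    simp
    -- Only the terms containing `w 0` involve u¹ and u³; the orthogonality of u to ∂_x and ∂_z
    -- eliminates them.
    linear_combination (γ θ 1 * w 0) *
      ((deriv γ θ 1 * g (γ θ) 1 3 + deriv γ θ 3 * g (γ θ) 3 3) * u1
        - (deriv γ θ 1 * g (γ θ) 1 1 + deriv γ θ 3 * g (γ θ) 1 3) * u3)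
  · exact hE'
  · exact hD'

/-- Normalizing leaves only the sign of the scalar in `outDirection_spin`. The profile may lie on
either side of the axis, hence the sign σ. -/
lemma outNormal_spin (h : IsSliceProfile U g γ) {σ : ℝ} (hσ : σ ^ 2 = 1)
    (hR : 0 < σ * γ (y 0) 1) :
    outNormal g (spin γ) y = spin (fun θ => σ • normalField g γ θ) y := by
  have hD := Real.sqrt_pos.2 (h.spacetime.planeDet_pos (h.mem (y 0)) (h.zero (y 0)))
  have hE := Real.sqrt_pos.2 (h.speedSq_pos (y 0))
  have hu : 0 < timeField g γ (y 0) 0 :=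
    timeNormal_zero_pos (h.lorentzian (y 0)) (h.spatiallyPositive (y 0))
  set k := timeField g γ (y 0) 0 * γ (y 0) 1 * √(speedSq g γ (y 0)) / √(planeDet g (γ (y 0)))
    with hk
  have hσk : 0 < σ * k := by
    rw [hk, show ∀ a b c d : ℝ, σ * (a * b * c / d) = a * (σ * b) * c / d from
      fun a b c d => by ring]
    positivity
  have hn : ip (g (spin γ y)) (rot4 (y 1) (normalField g γ (y 0)))
      (rot4 (y 1) (normalField g γ (y 0))) = 1 := by
    rw [h.ip_spin, normalField, h.spacetime.ip_planeNormal_self (h.mem _)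
      (h.zero _) (h.deriv_zero _) (h.deriv_two _) (h.speedSq_pos _)]
  rw [outNormal, h.outDirection_spin, ip_smul_left, ip_smul_right, hn, mul_one, ← hk,
    show k * k = (σ * k) ^ 2 by rw [mul_pow, hσ]; ring, Real.sqrt_sq hσk.le, spin, rot4_smul,
    smul_smul]
  congr 1
  have hk0 : k ≠ 0 := by rintro h0; simp [h0] at hσk
  have hσ0 : σ ≠ 0 := by rintro h0; simp [h0] at hσ
  field_simp
  exact hσ.symm

end IsSliceProfile

end
end WangYau

namespace WangYau
noncomputable section

/-! ### Surfaces of revolution in Minkowski space -/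

lemma ip_minkowski (v w : R4) :
    ip minkowski v w = -(v 0 * w 0) + v 1 * w 1 + v 2 * w 2 + v 3 * w 3 := by
  simp [ip, minkowski, Matrix.mulVec_diagonal, dotProduct, Fin.sum_univ_four]

lemma ip_flat (p v w : R4) :
    ip (flat p) v w = -(v 0 * w 0) + v 1 * w 1 + v 2 * w 2 + v 3 * w 3 := ip_minkowski v w

/-- Minkowski space is itself a spacetime of this kind, so the same frame calculus serves the
surface and its reference. -/
lemma isAxisymmetricSpacetime_flat : IsAxisymmetricSpacetime univ flat where
  isOpen := isOpen_univ
  smooth := fun μ ν => contDiffOn_const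
  lorentzian := fun p _ => ⟨1, by simp, by simp [flat]⟩
  slice_spacelike := fun p _ _ w h0 hw => by
    rw [ip_flat, h0]
    by_contra hneg
    have h1 : w 1 = 0 := by nlinarith [sq_nonneg (w 1), sq_nonneg (w 2), sq_nonneg (w 3)]
    have h2 : w 2 = 0 := by nlinarith [sq_nonneg (w 1), sq_nonneg (w 2), sq_nonneg (w 3)]
    have h3 : w 3 = 0 := by nlinarith [sq_nonneg (w 1), sq_nonneg (w 2), sq_nonneg (w 3)]
    exact hw (by ext i; fin_cases i <;> simp [h0, h1, h2, h3])
  rot_mem := fun _ _ _ => mem_univ _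
  rot_isometry := fun φ p _ v w => by
    rw [ip_flat, ip_flat]
    simp [rot4]
    linear_combination (v 1 * w 1 + v 2 * w 2) * Real.sin_sq_add_cos_sq φ
  refl_mem := fun _ _ => mem_univ _
  refl_isometry := fun p _ v w => by
    rw [ip_flat, ip_flat]; simp [refl4]

lemma chr_flat (p a b : R4) : chr flat p a b = 0 := by
  ext μ
  simp [chr, christoffel, metricDeriv, flat]

lemma sliceNormal_flat (γ : ℝ → R4) (y : R2) :
    sliceNormal flat (spin γ) y = spin (fun _ => Pi.single 0 1) y := by
  have hinv : minkowski⁻¹ = minkowski := by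
    refine Matrix.inv_eq_right_inv ?_
    rw [minkowski, Matrix.diagonal_mul_diagonal, ← Matrix.diagonal_one]
    congr 1; ext i; fin_cases i <;> simp
  ext i
  simp only [sliceNormal, flat, timeNormal, hinv, spin]
  fin_cases i <;> simp [minkowski, rot4]

/-- Data of a surface of revolution in Minkowski space: `lorentzFactor` is `√(1 + |∇τ|²)`. -/
def lorentzFactor (γ : ℝ → R4) (θ : ℝ) : ℝ :=
  √(1 + (deriv γ θ 0 / speed flat γ θ) ^ 2)

/-- The unit normal orthogonal to `∂_t`, up to sign. -/
def refNormal (γ : ℝ → R4) (θ : ℝ) : R4 :=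
  (speed flat γ θ * lorentzFactor γ θ)⁻¹ • ![0, deriv γ θ 3, 0, -deriv γ θ 1]

/-- The normalized component of `∂_t` orthogonal to the surface. -/
def refTime (γ : ℝ → R4) (θ : ℝ) : R4 :=
  (lorentzFactor γ θ)⁻¹ •
    ((Pi.single 0 1 : R4) + (deriv γ θ 0 / speed flat γ θ ^ 2) • deriv γ θ)

namespace IsProfile

variable {γ : ℝ → R4} {θ : ℝ} {y : R2}

lemma lorentzFactor_pos (γ : ℝ → R4) (θ : ℝ) : 0 < lorentzFactor γ θ :=
  Real.sqrt_pos.2 (by positivity)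

lemma one_le_lorentzFactor (γ : ℝ → R4) (θ : ℝ) : 1 ≤ lorentzFactor γ θ :=
  Real.one_le_sqrt.2 (by nlinarith [sq_nonneg (deriv γ θ 0 / speed flat γ θ)])

lemma lorentzFactor_sq (γ : ℝ → R4) (θ : ℝ) :
    lorentzFactor γ θ ^ 2 = 1 + (deriv γ θ 0 / speed flat γ θ) ^ 2 :=
  Real.sq_sqrt (by positivity)

lemma contDiff_deriv_apply (h : IsProfile univ flat γ) (i : Fin 4) :
    ContDiff ℝ ∞ (fun t => deriv γ t i) :=
  contDiff_pi.1 (contDiff_deriv h.smooth) i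

lemma contDiff_lorentzFactor (h : IsProfile univ flat γ) : ContDiff ℝ ∞ (lorentzFactor γ) :=
  contDiff_iff_contDiffAt.2 fun θ =>
    (contDiffAt_const.add (((h.contDiff_deriv_apply 0).contDiffAt.div h.contDiff_speed.contDiffAt
      (h.speed_pos θ).ne').pow 2)).sqrt (by positivity)

lemma speed_flat_sq (h : IsProfile univ flat γ) (θ : ℝ) :
    speed flat γ θ ^ 2 = -(deriv γ θ 0) ^ 2 + deriv γ θ 1 ^ 2 + deriv γ θ 3 ^ 2 := by
  rw [h.speed_sq, speedSq, ip_flat, h.deriv_two]; ring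

/-- l W is the Euclidean speed of the profile curve projected along ∂_t, because l²W² = l² + τ'². -/
lemma speed_mul_lorentzFactor_sq (h : IsProfile univ flat γ) (θ : ℝ) :
    (speed flat γ θ * lorentzFactor γ θ) ^ 2 = deriv γ θ 1 ^ 2 + deriv γ θ 3 ^ 2 := by
  have := h.speed_flat_sq θ
  have h0 := (h.speed_pos θ).ne'
  rw [mul_pow, lorentzFactor_sq]
  field_simp
  linarith

lemma contDiff_refNormal (h : IsProfile univ flat γ) : ContDiff ℝ ∞ (refNormal γ) := by
  have h1 : ContDiff ℝ ∞ (fun θ => (speed flat γ θ * lorentzFactor γ θ)⁻¹) :=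
    (h.contDiff_speed.mul h.contDiff_lorentzFactor).inv fun θ =>
      (mul_pos (h.speed_pos θ) (lorentzFactor_pos γ θ)).ne'
  have h2 : ContDiff ℝ ∞ (fun θ => (![0, deriv γ θ 3, 0, -deriv γ θ 1] : R4)) := by
    rw [contDiff_pi]
    intro i
    fin_cases i
    · exact contDiff_const
    · exact h.contDiff_deriv_apply 3
    · exact contDiff_const
    · exact (h.contDiff_deriv_apply 1).neg
  exact h1.smul h2

lemma contDiff_refTime (h : IsProfile univ flat γ) : ContDiff ℝ ∞ (refTime γ) := by
  have h1 : ContDiff ℝ ∞ (fun θ => (lorentzFactor γ θ)⁻¹) :=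
    h.contDiff_lorentzFactor.inv fun θ => (lorentzFactor_pos γ θ).ne'
  have h2 : ContDiff ℝ ∞ (fun θ => deriv γ θ 0 / speed flat γ θ ^ 2) :=
    (h.contDiff_deriv_apply 0).div (h.contDiff_speed.pow 2) fun θ =>
      (pow_pos (h.speed_pos θ) 2).ne'
  exact h1.smul (contDiff_const.add (h2.smul (contDiff_deriv h.smooth)))

/-- The frame consists of the Euclidean normal of the projection and the normalized normal part (∂_t
+ ∇τ)/W of ∂_t. The sign ε stays free until the curvature can be made positive. -/
lemma isProfileFrame_ref (h : IsProfile univ flat γ) {ε : ℝ} (hε : ε ^ 2 = 1) (θ : ℝ) :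
    IsProfileFrame flat γ (refTime γ) (fun t => ε • refNormal γ t) θ := by
  have h0 := (h.speed_pos θ).ne'
  have hW := (lorentzFactor_pos γ θ).ne'
  have hs := h.speed_flat_sq θ
  have hW2 := lorentzFactor_sq γ θ
  have hsW := h.speed_mul_lorentzFactor_sq θ
  have d2 := h.deriv_two θ
  refine ⟨h.contDiff_refTime.contDiffAt, h.contDiff_refNormal.contDiffAt.const_smul ε, ?_, ?_, ?_,
    ?_, ?_, ?_, ?_⟩
  · simp [refTime, d2]
  · simp [refNormal]
  · rw [refTime, ip_smul_right, ip_add_right, ip_smul_right]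
    have e : ip (flat (γ θ)) (deriv γ θ) (deriv γ θ) = speed flat γ θ ^ 2 := (h.speed_sq θ).symm
    rw [e, ip_flat]
    simp
    right
    field_simp; ring
  · rw [ip_smul_right, refNormal, ip_smul_right, ip_flat]
    simp [d2]
    right; right
    ring
  · rw [refTime, ip_smul_left, ip_smul_right, ip_add_left, ip_add_right, ip_add_right,
      ip_smul_left, ip_smul_right, ip_smul_left, ip_smul_right]
    have e : ip (flat (γ θ)) (deriv γ θ) (deriv γ θ) = speed flat γ θ ^ 2 := (h.speed_sq θ).symm
    rw [e, ip_flat, ip_flat, ip_flat]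
    simp
    field_simp
    rw [div_pow] at hW2
    field_simp at hW2
    linarith
  · rw [ip_smul_left, ip_smul_right, refNormal, ip_smul_left, ip_smul_right, ip_flat]
    simp
    have h3 := mul_ne_zero h0 hW
    rw [← mul_inv]
    set m := speed flat γ θ * lorentzFactor γ θ with hm
    field_simp
    rw [hε, one_mul]
    linarith
  · rw [refTime, refNormal, ip_smul_left, ip_smul_right, ip_smul_right, ip_add_left, ip_smul_left,
      ip_flat, ip_flat]
    simp [d2]
    right; right; right; right; ring

end IsProfile

/-- The cosine of the angle of the projected profile curve, with the radius as coordinate. -/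
def refCos (γ : ℝ → R4) (θ : ℝ) : ℝ :=
  deriv (radius flat γ) θ / (speed flat γ θ * lorentzFactor γ θ)

/-- The divergence of `∇τ`, divided by `√(1 + |∇τ|²)`. -/
def refDilation (γ : ℝ → R4) (θ : ℝ) : ℝ :=
  (speed flat γ θ * radius flat γ θ)⁻¹ *
    deriv (fun t => radius flat γ t / speed flat γ t * deriv γ t 0) θ / lorentzFactor γ θ

/-- The mean curvature of the projection, weighted by the metric of the surface itself. -/
def refCurvature (γ : ℝ → R4) (f : ℝ → ℝ) (θ : ℝ) : ℝ :=
  lorentzFactor γ θ / speed flat γ θ * (deriv f θ * refCos γ θ - deriv (refCos γ) θ * f θ)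
    + f θ / radius flat γ θ

/-- A continuous function without zeros on an interval has a sign. -/
lemma exists_sign_of_ne_zero {s : Set ℝ} (hs : IsPreconnected s) {f : ℝ → ℝ}
    (hf : ContinuousOn f s) (h0 : ∀ x ∈ s, f x ≠ 0) :
    ∃ δ : ℝ, δ ^ 2 = 1 ∧ ∀ x ∈ s, 0 < δ * f x := by
  by_cases h : ∃ a ∈ s, f a < 0
  · obtain ⟨a, ha, hfa⟩ := h
    refine ⟨-1, by norm_num, fun x hx => ?_⟩
    by_contra hneg
    have hx0 : 0 ≤ f x := by linarith
    obtain ⟨z, hz, hz0⟩ := hs.intermediate_value ha hx hf ⟨hfa.le, hx0⟩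
    exact h0 z hz hz0
  · push Not at h
    exact ⟨1, by norm_num, fun x hx => by
      rw [one_mul]; exact lt_of_le_of_ne (h x hx) (h0 x hx).symm⟩

namespace IsProfile

variable {γ : ℝ → R4} {θ : ℝ} {y : R2}

lemma hasDerivAt_ip_flat {v w : ℝ → R4} {v' w' : R4} (hv : HasDerivAt v v' θ)
    (hw : HasDerivAt w w' θ) :
    HasDerivAt (fun t => ip minkowski (v t) (w t))
      (ip minkowski v' (w θ) + ip minkowski (v θ) w') θ := by
  have hv' := fun i => hasDerivAt_pi.1 hv i
  have hw' := fun i => hasDerivAt_pi.1 hw i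
  have e : (fun t => ip minkowski (v t) (w t)) = fun t =>
      -(v t 0 * w t 0) + v t 1 * w t 1 + v t 2 * w t 2 + v t 3 * w t 3 := by
    ext t; exact ip_minkowski _ _
  rw [e]
  refine ((((((hv' 0).fun_mul (hw' 0)).fun_neg).fun_add ((hv' 1).fun_mul (hw' 1))).fun_add
    ((hv' 2).fun_mul (hw' 2))).fun_add ((hv' 3).fun_mul (hw' 3))).congr_deriv ?_
  rw [ip_minkowski, ip_minkowski]; ring

lemma radius_flat_sq (h : IsProfile univ flat γ) (θ : ℝ) : orbitSq flat γ θ = γ θ 1 ^ 2 := by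
  rw [h.orbitSq_eq]; simp [flat, minkowski]

/-- The distance to the axis has a sign along the profile curve. -/
lemma exists_sign {U : Set R4} {g : R4 → Form} (h : IsProfile U g γ) :
    ∃ δ : ℝ, δ ^ 2 = 1 ∧ ∀ θ ∈ Ioo 0 Real.pi, 0 < δ * γ θ 1 := by
  have hne : ∀ θ ∈ Ioo 0 Real.pi, γ θ 1 ≠ 0 := by
    intro θ hθ h0
    have := h.orbitSq_pos θ hθ
    rw [h.orbitSq_eq, h0] at this
    simp at this
  have hc : ContinuousOn (fun θ => γ θ 1) (Ioo 0 Real.pi) :=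
    ((continuous_apply 1).comp h.smooth.continuous).continuousOn
  exact exists_sign_of_ne_zero isPreconnected_Ioo hc hne

lemma covProfile_flat (γ n : ℝ → R4) (θ : ℝ) : covProfile flat γ n θ = deriv n θ := by
  rw [covProfile, chr_flat, add_zero]

lemma ip_covOrbit_flat (h : IsProfile univ flat γ) (n : ℝ → R4) :
    ip (flat (γ θ)) (covOrbit flat γ n θ) (rotGen (γ θ)) = n θ 1 * γ θ 1 := by
  rw [covOrbit, chr_flat, add_zero, ip_flat]
  simp [rotGen, h.two θ]

lemma profileExpansion_flat (h : IsProfile univ flat γ) (hθ : θ ∈ Ioo 0 Real.pi) (n : ℝ → R4) :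
    profileExpansion flat γ n θ =
      (speed flat γ θ ^ 2)⁻¹ * ip minkowski (deriv n θ) (deriv γ θ) + n θ 1 / γ θ 1 := by
  have hP : γ θ 1 ≠ 0 := by
    intro h0
    have := h.orbitSq_pos θ hθ
    rw [h.radius_flat_sq, h0] at this
    simp at this
  rw [profileExpansion, h.ip_covOrbit_flat, covProfile_flat, h.radius_flat_sq, h.speed_sq]
  congr 1
  field_simp

lemma hasDerivAt_deriv (h : IsProfile univ flat γ) (θ : ℝ) :
    HasDerivAt (deriv γ) (deriv (deriv γ) θ) θ :=
  ((contDiff_deriv h.smooth).differentiable (by simp) θ).hasDerivAt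

lemma ip_deriv_eq_neg (h : IsProfile univ flat γ) {n : ℝ → R4} (hn : DifferentiableAt ℝ n θ)
    (h0 : ∀ t, ip minkowski (deriv γ t) (n t) = 0) :
    ip minkowski (deriv n θ) (deriv γ θ) = -ip minkowski (n θ) (deriv (deriv γ) θ) := by
  have h1 := hasDerivAt_ip_flat (h.hasDerivAt_deriv θ) hn.hasDerivAt
  have h2 : (fun t => ip minkowski (deriv γ t) (n t)) = fun _ => 0 := funext h0
  rw [h2] at h1
  have := h1.unique (hasDerivAt_const θ 0)
  rw [ip_minkowski] at this ⊢
  rw [ip_minkowski] at this ⊢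
  linarith

/-- The radius is a signed multiple of the distance to the axis. -/
lemma radius_eventuallyEq (h : IsProfile univ flat γ) {δ : ℝ} (hδ : δ ^ 2 = 1)
    (hP : ∀ θ ∈ Ioo 0 Real.pi, 0 < δ * γ θ 1) (hθ : θ ∈ Ioo 0 Real.pi) :
    radius flat γ =ᶠ[𝓝 θ] fun t => δ * γ t 1 := by
  filter_upwards [isOpen_Ioo.mem_nhds hθ] with t ht
  rw [radius, h.radius_flat_sq, show γ t 1 ^ 2 = (δ * γ t 1) ^ 2 by rw [mul_pow, hδ, one_mul],
    Real.sqrt_sq (hP t ht).le]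

lemma deriv_radius (h : IsProfile univ flat γ) {δ : ℝ} (hδ : δ ^ 2 = 1)
    (hP : ∀ θ ∈ Ioo 0 Real.pi, 0 < δ * γ θ 1) (hθ : θ ∈ Ioo 0 Real.pi) :
    deriv (radius flat γ) θ = δ * deriv γ θ 1 := by
  rw [(h.radius_eventuallyEq hδ hP hθ).deriv_eq]
  exact ((hasDerivAt_pi.1 (h.differentiable θ).hasDerivAt 1).const_mul δ).deriv

/-- W times this field is ∂_t + ∇τ. Since ∂_t is parallel, its expansion is the divergence of ∇τ;
rescaling a normal field merely rescales its expansion. -/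
lemma profileExpansion_refTime (h : IsProfile univ flat γ) (hθ : θ ∈ Ioo 0 Real.pi) :
    profileExpansion flat γ (refTime γ) θ = refDilation γ θ := by
  obtain ⟨δ, hδ, hP⟩ := h.exists_sign
  have hδ0 : δ ≠ 0 := by rintro rfl; simp at hδ
  have hP0 : γ θ 1 ≠ 0 := by
    have := hP θ hθ
    rintro h0; simp [h0] at this
  have hs := (h.speed_pos θ).ne'
  have hW := (lorentzFactor_pos γ θ).ne'
  have hF := fun t => (h.isProfileFrame_ref (ε := 1) (by norm_num) t)
  rw [h.profileExpansion_flat hθ,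
    h.ip_deriv_eq_neg (h.contDiff_refTime.contDiffAt.differentiableAt (by simp))
      (fun t => (hF t).t_tangent)]
  have dγ := h.hasDerivAt_deriv θ
  have ds : HasDerivAt (speed flat γ) (deriv (speed flat γ) θ) θ :=
    (h.contDiff_speed.differentiable (by simp) θ).hasDerivAt
  have hss : speed flat γ θ * deriv (speed flat γ) θ
      = ip minkowski (deriv γ θ) (deriv (deriv γ) θ) := by
    have h1 := hasDerivAt_ip_flat dγ dγ
    have h2 : (fun t => ip minkowski (deriv γ t) (deriv γ t)) = fun t => speed flat γ t ^ 2 := by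
      ext t; exact (h.speed_sq t).symm
    rw [h2] at h1
    have h3 := h1.unique (ds.fun_pow 2)
    rw [ip_minkowski, ip_minkowski] at h3
    rw [ip_minkowski]
    simp at h3
    linarith
  have dr : HasDerivAt (radius flat γ) (δ * deriv γ θ 1) θ := by
    rw [← h.deriv_radius hδ hP hθ]
    exact ((h.contDiffAt_radius hθ).differentiableAt (by simp)).hasDerivAt
  have hr : radius flat γ θ = δ * γ θ 1 := (h.radius_eventuallyEq hδ hP hθ).self_of_nhds
  have hd := ((dr.fun_div ds hs).fun_mul (hasDerivAt_pi.1 dγ 0)).deriv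
  rw [refDilation, hd, refTime, ip_smul_left, ip_add_left, ip_smul_left, ← hss, hr]
  rw [ip_minkowski]
  simp
  field_simp
  ring

lemma refNormal_one (γ : ℝ → R4) (θ : ℝ) :
    refNormal γ θ 1 = deriv γ θ 3 / (speed flat γ θ * lorentzFactor γ θ) := by
  simp [refNormal]; field_simp

lemma refNormal_three (γ : ℝ → R4) (θ : ℝ) :
    refNormal γ θ 3 = -(deriv γ θ 1 / (speed flat γ θ * lorentzFactor γ θ)) := by
  simp [refNormal]; field_simp

lemma contDiffAt_refCos (h : IsProfile univ flat γ) (hθ : θ ∈ Ioo 0 Real.pi) :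
    ContDiffAt ℝ ∞ (refCos γ) θ :=
  (contDiffAt_deriv (h.contDiffAt_radius hθ)).div
    (h.contDiff_speed.mul h.contDiff_lorentzFactor).contDiffAt
    (mul_pos (h.speed_pos θ) (lorentzFactor_pos γ θ)).ne'

lemma refCos_sq (h : IsProfile univ flat γ) (hθ : θ ∈ Ioo 0 Real.pi) :
    refCos γ θ ^ 2 + refNormal γ θ 1 ^ 2 = 1 := by
  obtain ⟨δ, hδ, hP⟩ := h.exists_sign
  have h1 := h.speed_mul_lorentzFactor_sq θ
  have hs := (h.speed_pos θ).ne'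
  have hW := (lorentzFactor_pos γ θ).ne'
  rw [refCos, refNormal_one, h.deriv_radius hδ hP hθ, div_pow, div_pow, mul_pow δ, hδ]
  field_simp
  linarith

/-- Up to signs the components of the normal are the sine and cosine of the angle of the projected
curve, so its derivative along the curve is the turning rate, written as f' cos − cos' f. -/
lemma ip_deriv_refNormal (h : IsProfile univ flat γ) {δ : ℝ} (hδ : δ ^ 2 = 1)
    (hP : ∀ θ ∈ Ioo 0 Real.pi, 0 < δ * γ θ 1) (ε : ℝ) (hθ : θ ∈ Ioo 0 Real.pi) :
    ip minkowski (deriv (fun t => ε • refNormal γ t) θ) (deriv γ θ) =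
      speed flat γ θ * lorentzFactor γ θ *
      (deriv (fun t => δ * ε * refNormal γ t 1) θ * refCos γ θ
        - deriv (refCos γ) θ * (δ * ε * refNormal γ θ 1)) ∧
    deriv (fun t => ε • refNormal γ t) θ 0 = 0 := by
  have hs := (h.speed_pos θ).ne'
  have hW := (lorentzFactor_pos γ θ).ne'
  have dn : HasDerivAt (refNormal γ) (deriv (refNormal γ) θ) θ :=
    (h.contDiff_refNormal.contDiffAt.differentiableAt (by simp)).hasDerivAt
  have dni := fun i => hasDerivAt_pi.1 dn i
  have z0 : deriv (refNormal γ) θ 0 = 0 := by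
    have e : (fun t => refNormal γ t 0) = fun _ => 0 := by ext t; simp [refNormal]
    have := dni 0
    rw [e] at this
    exact this.unique (hasDerivAt_const θ 0)
  have d3 : deriv (refCos γ) θ = -δ * deriv (refNormal γ) θ 3 := by
    have e : refCos γ =ᶠ[𝓝 θ] fun t => -δ * refNormal γ t 3 := by
      filter_upwards [isOpen_Ioo.mem_nhds hθ] with t ht
      rw [refCos, refNormal_three, h.deriv_radius hδ hP ht]; ring
    rw [e.deriv_eq]
    exact ((dni 3).const_mul (-δ)).deriv
  have d1 : deriv (fun t => δ * ε * refNormal γ t 1) θ = δ * ε * deriv (refNormal γ) θ 1 :=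
    ((dni 1).const_mul _).deriv
  have d : deriv (fun t => ε • refNormal γ t) θ = ε • deriv (refNormal γ) θ :=
    (dn.fun_const_smul ε).deriv
  rw [d, d1, d3, ip_smul_left, ip_minkowski, z0, h.deriv_two]
  constructor
  · rw [refCos, refNormal_one, h.deriv_radius hδ hP hθ]
    field_simp
    linear_combination (-ε * (deriv (refNormal γ) θ 1 * deriv γ θ 1
      + deriv (refNormal γ) θ 3 * deriv γ θ 3)) * hδ
  · simp [z0]

lemma profileExpansion_refNormal (h : IsProfile univ flat γ) {δ : ℝ} (hδ : δ ^ 2 = 1)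
    (hP : ∀ θ ∈ Ioo 0 Real.pi, 0 < δ * γ θ 1) (ε : ℝ) (hθ : θ ∈ Ioo 0 Real.pi) :
    profileExpansion flat γ (fun t => ε • refNormal γ t) θ
      = refCurvature γ (fun t => δ * ε * refNormal γ t 1) θ := by
  have hP0 : γ θ 1 ≠ 0 := by
    have := hP θ hθ
    rintro h0; simp [h0] at this
  have hδ0 : δ ≠ 0 := by rintro rfl; simp at hδ
  have hs := (h.speed_pos θ).ne'
  rw [h.profileExpansion_flat hθ, (h.ip_deriv_refNormal hδ hP ε hθ).1,
    refCurvature, (h.radius_eventuallyEq hδ hP hθ).self_of_nhds]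
  simp only [Pi.smul_apply, smul_eq_mul]
  congr 1
  · field_simp
  · field_simp

/-- The connection form of the frame orthogonal to `∂_t`. -/
lemma ip_covProfile_ref (h : IsProfile univ flat γ) {δ : ℝ} (hδ : δ ^ 2 = 1)
    (hP : ∀ θ ∈ Ioo 0 Real.pi, 0 < δ * γ θ 1) (ε : ℝ) (hθ : θ ∈ Ioo 0 Real.pi) :
    ip (flat (γ θ)) (covProfile flat γ (fun t => ε • refNormal γ t) θ) (refTime γ θ)
      = deriv γ θ 0 / lorentzFactor γ θ * (refCurvature γ (fun t => δ * ε * refNormal γ t 1) θ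
          - δ * ε * refNormal γ θ 1 / radius flat γ θ) := by
  have h1 := h.ip_deriv_refNormal hδ hP ε hθ
  have hs := (h.speed_pos θ).ne'
  have hW := (lorentzFactor_pos γ θ).ne'
  -- The normal has no time component at any θ, so ∂_t drops out and only the tangential term of
  -- `refTime` contributes; what remains is a multiple of the meridional part of the curvature.
  rw [covProfile_flat, refTime, ip_smul_right, ip_add_right, ip_smul_right]
  change _ * (ip minkowski _ _ + _ * ip minkowski _ _) = _
  rw [h1.1, ip_minkowski _ (Pi.single 0 1), h1.2, refCurvature]
  simp
  field_simp

end IsProfile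

end
end WangYau

namespace WangYau
noncomputable section

/-! ### The current of a surface of revolution -/

/-- The polar coordinates of a point of the meridian. -/
def meridianPoint (θ : ℝ) : R2 := ![θ, 0]

lemma meridianPoint_mem {θ : ℝ} (hθ : θ ∈ Ioo 0 Real.pi) : meridianPoint θ ∈ polarDomain := hθ

/-- The subtraction formula for sinh. With x = Δτ/W, a = |H| and b = |H₀| the left side is the
arsinh term of the current, in which ρΔτ = x(√(b²+x²) − √(a²+x²)). -/
lemma arsinh_sub_arsinh {x a b : ℝ} (ha : 0 < a) (hb : 0 < b) :
    Real.arsinh (x * (√(b ^ 2 + x ^ 2) - √(a ^ 2 + x ^ 2)) / (b * a))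
      = Real.arsinh (x / a) - Real.arsinh (x / b) := by
  have key : ∀ c : ℝ, 0 < c → √(1 + (x / c) ^ 2) = √(c ^ 2 + x ^ 2) / c := by
    intro c hc
    rw [show 1 + (x / c) ^ 2 = (c ^ 2 + x ^ 2) / c ^ 2 by field_simp, Real.sqrt_div' _ (by positivity),
      Real.sqrt_sq hc.le]
  rw [← Real.sinh_inj, Real.sinh_arsinh, Real.sinh_sub, Real.sinh_arsinh, Real.sinh_arsinh,
    Real.cosh_arsinh, Real.cosh_arsinh, key a ha, key b hb]
  field_simp

/-- The hyperbolic angle between the frame of the slice and the mean curvature frame of a surface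
with expansions `s` and `-m`. -/
def slipAngle (s m : ℝ) : ℝ := Real.arsinh ((s - m) / 2 / √(s * m))

/-- The expansions of the slice frame are (s − m)/2 and (s + m)/2, so the exponential of the boost
angle is √(s/m). Consequently s only shifts the angle by a constant, and its oscillation is that of
(log m)/2. -/
lemma slipAngle_eq {s m : ℝ} (hs : 0 < s) (hm : 0 < m) :
    slipAngle s m = (Real.log s - Real.log m) / 2 := by
  have h1 : √(s * m) = √s * √m := Real.sqrt_mul hs.le m
  have hs' := Real.sqrt_pos.2 hs
  have hm' := Real.sqrt_pos.2 hm
  have e1 : Real.exp ((Real.log s - Real.log m) / 2) = √s / √m := by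
    rw [sub_div, Real.exp_sub, Real.exp_half, Real.exp_half, Real.exp_log hs, Real.exp_log hm]
  rw [slipAngle, ← Real.sinh_inj, Real.sinh_arsinh, Real.sinh_eq, Real.exp_neg, e1, h1]
  have h2 := Real.mul_self_sqrt hs.le
  have h3 := Real.mul_self_sqrt hm.le
  field_simp
  rw [Real.sq_sqrt hs.le, Real.sq_sqrt hm.le]

/-- A surface of revolution in the slice, with expansions `s` and `-m`, and its connection form `α`
in the frame of the slice. -/
structure IsSliceData (g : R4 → Form) (γ : ℝ → R4) (s : ℝ) (m α : ℝ → ℝ) : Prop where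
  m_pos : ∀ θ ∈ Ioo 0 Real.pi, 0 < m θ
  m_smooth : ∀ θ ∈ Ioo 0 Real.pi, ContDiffAt ℝ ∞ m θ
  meanCurvSq_eq : ∀ y ∈ polarDomain, meanCurvSq g (spin γ) y = s * m (y 0)
  alphaH_zero : ∀ y ∈ polarDomain,
    alphaH g (spin γ) 0 y = α (y 0) + deriv (fun t => slipAngle s (m t)) (y 0)
  alphaH_one : ∀ y ∈ polarDomain, alphaH g (spin γ) 1 y = 0

/-- The connection form of the slice frame along a profile curve. -/
def sliceConnection (g : R4 → Form) (γ : ℝ → R4) (θ : ℝ) : ℝ :=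
  ip (g (γ θ)) (covProfile g γ (normalField g γ) θ) (timeField g γ θ)

namespace IsSliceProfile

variable {U : Set R4} {g : R4 → Form} {γ : ℝ → R4} {σ s : ℝ}

lemma thetas_spin (h : IsSliceProfile U g γ) (hσ : σ ^ 2 = 1)
    (hR : ∀ θ ∈ Ioo 0 Real.pi, 0 < σ * γ θ 1) {y : R2} (hy : y ∈ polarDomain) :
    thetaPlus g (spin γ) y = profileExpansion g γ (timeField g γ) (y 0)
      + σ * profileExpansion g γ (normalField g γ) (y 0) ∧
    thetaMinus g (spin γ) y = profileExpansion g γ (timeField g γ) (y 0)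
      - σ * profileExpansion g γ (normalField g γ) (y 0) := by
  have key : ∀ c : ℝ, ∀ l : R2 → R4,
      (∀ z ∈ polarDomain, l z = spin (fun t => timeField g γ t + c • normalField g γ t) z) →
      expansion g (spin γ) l y = profileExpansion g γ (timeField g γ) (y 0)
        + c * profileExpansion g γ (normalField g γ) (y 0) := by
    intro c l hl
    have dt : DifferentiableAt ℝ (timeField g γ) (y 0) :=
      h.contDiff_timeField.differentiable (by simp) _
    have dn : DifferentiableAt ℝ (normalField g γ) (y 0) :=
      h.contDiff_normalField.differentiable (by simp) _
    have e : l =ᶠ[𝓝 y] spin (fun t => timeField g γ t + c • normalField g γ t) := by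
      filter_upwards [isOpen_polarDomain.mem_nhds hy] with z hz using hl z hz
    have e1 : expansion g (spin γ) l y
        = expansion g (spin γ) (spin (fun t => timeField g γ t + c • normalField g γ t)) y := by
      simp only [expansion, covD_eq, pd_congr e, e.self_of_nhds]
    rw [e1, h.expansion_spin hy (dt.fun_add (dn.fun_const_smul c)),
      profileExpansion_add dt (dn.fun_const_smul c), profileExpansion_smul dn]
  constructor
  · refine key σ _ fun z hz => ?_
    rw [ellPlus, h.sliceNormal_spin, h.outNormal_spin hσ (hR _ hz)]
    simp only [spin, rot4_add]
  · rw [sub_eq_add_neg, ← neg_mul]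
    refine key (-σ) _ fun z hz => ?_
    rw [ellMinus, h.sliceNormal_spin, h.outNormal_spin hσ (hR _ hz)]
    simp only [spin, neg_smul, rot4_sub, ← sub_eq_add_neg]

/-- The data of a surface of constant expansion. -/
lemma isSliceData (h : IsSliceProfile U g γ) (hσ : σ ^ 2 = 1)
    (hR : ∀ θ ∈ Ioo 0 Real.pi, 0 < σ * γ θ 1) (hs : 0 < s)
    (hΘ : ∀ y ∈ polarDomain, thetaPlus g (spin γ) y = s)
    (hH : ∀ y ∈ polarDomain, 0 < meanCurvSq g (spin γ) y) :
    IsSliceData g γ s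
      (fun θ => σ * profileExpansion g γ (normalField g γ) θ
        - profileExpansion g γ (timeField g γ) θ)
      (fun θ => σ * sliceConnection g γ θ) := by
  have hf := fun θ (_ : θ ∈ Ioo 0 Real.pi) => h.isProfileFrame hσ θ
  have dn : Differentiable ℝ (normalField g γ) := h.contDiff_normalField.differentiable (by simp)
  have hexp : ∀ θ, profileExpansion g γ (fun t => σ • normalField g γ t) θ
      = σ * profileExpansion g γ (normalField g γ) θ := fun θ => profileExpansion_smul (dn θ) σ
  have hsum : ∀ θ ∈ Ioo 0 Real.pi, profileExpansion g γ (timeField g γ) θ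
      + σ * profileExpansion g γ (normalField g γ) θ = s := fun θ hθ => by
    rw [← hΘ _ (meridianPoint_mem hθ), (h.thetas_spin hσ hR (meridianPoint_mem hθ)).1]; rfl
  -- The difference of squares k_N² − k_T² factors as Θ₊ · (−Θ₋).
  have hsq : ∀ y ∈ polarDomain, meanCurvSq g (spin γ) y = s *
      (σ * profileExpansion g γ (normalField g γ) (y 0)
        - profileExpansion g γ (timeField g γ) (y 0)) := fun y hy => by
    rw [h.meanCurvSq_spin hf hy, hexp, ← hsum _ hy]; ring
  have hm : ∀ θ ∈ Ioo 0 Real.pi, 0 < σ * profileExpansion g γ (normalField g γ) θ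
        - profileExpansion g γ (timeField g γ) θ := fun θ hθ => by
    have := hH _ (meridianPoint_mem hθ)
    rw [hsq _ (meridianPoint_mem hθ)] at this
    exact pos_of_mul_pos_right this hs.le
  have hα := fun {y} hy => h.alphaH_spin (y := y) hf h.sliceNormal_spin
    (fun θ hθ => by
      have := (hf θ hθ).t_t
      rw [this]; norm_num)
    (fun θ hθ => (hf θ hθ).t_n)
    (fun θ hθ => by
      rw [hexp]; linarith [hm θ hθ, hsum θ hθ])
    (fun θ hθ => by
      have := mul_pos hs (hm θ hθ)
      rw [hexp]
      rw [← hsum θ hθ] at this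
      linarith) hy
  refine ⟨hm, fun θ hθ => ?_, hsq, fun y hy => ?_, fun y hy => (hα hy).2⟩
  · exact (contDiffAt_const.mul (h.contDiffAt_profileExpansion hθ h.contDiff_normalField.contDiffAt)).sub
      (h.contDiffAt_profileExpansion hθ h.contDiff_timeField.contDiffAt)
  · rw [(hα hy).1]
    congr 1
    · have e : covProfile g γ (fun t => σ • normalField g γ t) (y 0)
          = σ • covProfile g γ (normalField g γ) (y 0) := by
        rw [covProfile, deriv_fun_const_smul σ (dn _), chr_smul_right, covProfile, smul_add]
      rw [e, ip_smul_left]; rfl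
    · refine Filter.EventuallyEq.deriv_eq ?_
      filter_upwards [isOpen_Ioo.mem_nhds (mem_Ioo_of_polar hy)] with t ht
      rw [slipAngle, hexp]
      have := hsum t ht
      congr 2
      · linarith
      · congr 1; rw [← this]; ring

end IsSliceProfile

/-- A surface of revolution in Minkowski space with spacelike mean curvature vector: `f` is the sine
of the angle of the projected profile curve. -/
structure IsReferenceData (γ : ℝ → R4) (f : ℝ → ℝ) : Prop where
  profile : IsProfile univ flat γ
  smooth : ContDiff ℝ ∞ f
  sq : ∀ θ ∈ Ioo 0 Real.pi, refCos γ θ ^ 2 + f θ ^ 2 = 1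
  curvature_pos : ∀ θ ∈ Ioo 0 Real.pi, 0 < refCurvature γ f θ
  spacelike : ∀ θ ∈ Ioo 0 Real.pi, 0 < refCurvature γ f θ ^ 2 - refDilation γ θ ^ 2
  meanCurvSq_eq : ∀ y ∈ polarDomain,
    meanCurvSq flat (spin γ) y = refCurvature γ f (y 0) ^ 2 - refDilation γ (y 0) ^ 2
  alphaH_zero : ∀ y ∈ polarDomain, alphaH flat (spin γ) 0 y =
    deriv γ (y 0) 0 / lorentzFactor γ (y 0) *
      (refCurvature γ f (y 0) - f (y 0) / radius flat γ (y 0))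
    + deriv (fun t => Real.arsinh
        (refDilation γ t / √(refCurvature γ f t ^ 2 - refDilation γ t ^ 2))) (y 0)
  alphaH_one : ∀ y ∈ polarDomain, alphaH flat (spin γ) 1 y = 0

namespace IsProfile

variable {γ : ℝ → R4}

lemma contDiffAt_refCurvature (h : IsProfile univ flat γ) {f : ℝ → ℝ} {θ : ℝ}
    (hθ : θ ∈ Ioo 0 Real.pi) (hf : ContDiffAt ℝ ∞ f θ) :
    ContDiffAt ℝ ∞ (refCurvature γ f) θ :=
  ((h.contDiff_lorentzFactor.contDiffAt.div h.contDiff_speed.contDiffAt (h.speed_pos θ).ne').mul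
    (((contDiffAt_deriv hf).mul (h.contDiffAt_refCos hθ)).sub
      ((contDiffAt_deriv (h.contDiffAt_refCos hθ)).mul hf))).add
    (hf.div (h.contDiffAt_radius hθ) (h.radius_pos hθ).ne')

lemma contDiffAt_refDilation (h : IsProfile univ flat γ) {θ : ℝ} (hθ : θ ∈ Ioo 0 Real.pi) :
    ContDiffAt ℝ ∞ (refDilation γ) θ := by
  have hs := h.contDiff_speed.contDiffAt (x := θ)
  have hr := h.contDiffAt_radius hθ
  have hs0 := (h.speed_pos θ).ne'
  exact (((hs.mul hr).inv (mul_ne_zero hs0 (h.radius_pos hθ).ne')).mul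
    (contDiffAt_deriv ((hr.div hs hs0).mul (h.contDiff_deriv_apply 0).contDiffAt))).div
    h.contDiff_lorentzFactor.contDiffAt (lorentzFactor_pos γ θ).ne'

/-- A spacelike H₀ means k² > x², so k never vanishes and has a constant sign on the interval; the
orientation ε of the normal is chosen to make it positive. -/
lemma exists_isReferenceData (h : IsProfile univ flat γ)
    (hH : ∀ y ∈ polarDomain, 0 < meanCurvSq flat (spin γ) y) :
    ∃ c : ℝ, IsReferenceData γ (fun t => c * refNormal γ t 1) := by
  obtain ⟨δ, hδ, hP⟩ := h.exists_sign
  have hsm : ∀ c : ℝ, ContDiff ℝ ∞ (fun t => c * refNormal γ t 1) := fun c =>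
    contDiff_const.mul (contDiff_pi.1 h.contDiff_refNormal 1)
  have hsq : ∀ ε : ℝ, ε ^ 2 = 1 → ∀ y ∈ polarDomain, meanCurvSq flat (spin γ) y
      = refCurvature γ (fun t => δ * ε * refNormal γ t 1) (y 0) ^ 2 - refDilation γ (y 0) ^ 2 :=
    fun ε hε y hy => by
      rw [h.meanCurvSq_spin (fun θ _ => h.isProfileFrame_ref hε θ) hy, h.profileExpansion_refTime hy,
        h.profileExpansion_refNormal hδ hP ε hy]
  have hne : ∀ θ ∈ Ioo 0 Real.pi, refCurvature γ (fun t => δ * 1 * refNormal γ t 1) θ ≠ 0 := by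
    intro θ hθ h0
    have := hH _ (meridianPoint_mem hθ)
    rw [hsq 1 (by norm_num) _ (meridianPoint_mem hθ)] at this
    have e : (meridianPoint θ) 0 = θ := rfl
    rw [e, h0] at this
    nlinarith [sq_nonneg (refDilation γ θ)]
  obtain ⟨ε, hε, hpos⟩ := exists_sign_of_ne_zero isPreconnected_Ioo
    (fun θ hθ => (h.contDiffAt_refCurvature hθ
      (hsm (δ * 1)).contDiffAt).continuousAt.continuousWithinAt) hne
  have hcurv : ∀ θ ∈ Ioo 0 Real.pi, 0 < refCurvature γ (fun t => δ * ε * refNormal γ t 1) θ := by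
    intro θ hθ
    refine (hpos θ hθ).trans_eq ?_
    rw [← h.profileExpansion_refNormal hδ hP _ hθ, ← h.profileExpansion_refNormal hδ hP _ hθ,
      profileExpansion_smul (h.contDiff_refNormal.differentiable (by simp) _),
      profileExpansion_smul (h.contDiff_refNormal.differentiable (by simp) _)]
    ring
  have hsp : ∀ θ ∈ Ioo 0 Real.pi, 0 < refCurvature γ (fun t => δ * ε * refNormal γ t 1) θ ^ 2
      - refDilation γ θ ^ 2 := fun θ hθ => by
    have := hH _ (meridianPoint_mem hθ)
    rw [hsq ε hε _ (meridianPoint_mem hθ)] at this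
    exact this
  have hα := fun {y} hy => h.alphaH_spin (y := y) (fun θ _ => h.isProfileFrame_ref hε θ)
    (sliceNormal_flat γ)
    (fun θ _ => by
      have hW := lorentzFactor_pos γ θ
      rw [ip_flat]
      simp [refTime]
      have : 0 < 1 + deriv γ θ 0 / speed flat γ θ ^ 2 * deriv γ θ 0 := by
        rw [div_mul_eq_mul_div, ← sq, ← div_pow]; positivity
      positivity)
    (fun θ _ => by rw [ip_flat]; simp [refNormal])
    (fun θ hθ => by rw [h.profileExpansion_refNormal hδ hP ε hθ]; exact hcurv θ hθ)
    (fun θ hθ => by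
      rw [h.profileExpansion_refNormal hδ hP ε hθ, h.profileExpansion_refTime hθ]
      exact hsp θ hθ) hy
  refine ⟨δ * ε, h, hsm _, fun θ hθ => ?_, hcurv, hsp, hsq ε hε, fun y hy => ?_,
    fun y hy => (hα hy).2⟩
  · rw [mul_pow, mul_pow, hδ, hε, one_mul, one_mul]; exact h.refCos_sq hθ
  · rw [(hα hy).1, h.ip_covProfile_ref hδ hP ε hy]
    congr 1
    refine Filter.EventuallyEq.deriv_eq ?_
    filter_upwards [isOpen_Ioo.mem_nhds (mem_Ioo_of_polar hy)] with t ht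
    rw [h.profileExpansion_refNormal hδ hP ε ht, h.profileExpansion_refTime ht]

end IsProfile

/-- A surface of constant expansion together with an isometric reference surface. -/
structure IsReferencePair (U : Set R4) (g : R4 → Form) (γ γ₀ : ℝ → R4) (s : ℝ) (m α f : ℝ → ℝ) :
    Prop where
  slice : IsSliceProfile U g γ
  s_pos : 0 < s
  data : IsSliceData g γ s m α
  ref : IsReferenceData γ₀ f
  speed_eq : speed flat γ₀ = speed g γ
  radius_eq : radius flat γ₀ = radius g γ

/-- The hyperbolic angle of the reference surface relative to the frame of the slice. -/
def refAngle (γ₀ : ℝ → R4) (s : ℝ) (m : ℝ → ℝ) (θ : ℝ) : ℝ :=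
  Real.arsinh (refDilation γ₀ θ / √(s * m θ))

/-- The angular component of the current. -/
def profileFlux (g : R4 → Form) (γ γ₀ : ℝ → R4) (s : ℝ) (m α f : ℝ → ℝ) (θ : ℝ) : ℝ :=
  deriv γ₀ θ 0 / lorentzFactor γ₀ θ * (f θ / radius g γ θ - √(s * m θ + refDilation γ₀ θ ^ 2))
    + α θ - deriv (fun t => refAngle γ₀ s m t - slipAngle s (m t)) θ

namespace IsReferencePair

variable {U : Set R4} {g : R4 → Form} {γ γ₀ : ℝ → R4} {s : ℝ} {m α f : ℝ → ℝ} {y : R2}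

lemma contDiff_time (h : IsReferencePair U g γ γ₀ s m α f) : ContDiff ℝ ∞ (fun t => γ₀ t 0) :=
  contDiff_pi.1 h.ref.profile.smooth 0

lemma deriv_time (h : IsReferencePair U g γ γ₀ s m α f) (θ : ℝ) :
    deriv (fun t => γ₀ t 0) θ = deriv γ₀ θ 0 :=
  (hasDerivAt_pi.1 (h.ref.profile.differentiable θ).hasDerivAt 0).deriv

lemma timeFn_spin (y : R2) : timeFn (spin γ₀) y = γ₀ (y 0) 0 := rfl

lemma gradSq_eq (h : IsReferencePair U g γ γ₀ s m α f) (hy : y ∈ polarDomain) :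
    gradSq g (spin γ) (timeFn (spin γ₀)) y = (deriv γ₀ (y 0) 0 / speed g γ (y 0)) ^ 2 := by
  rw [h.slice.gradSq_spin hy (τ := fun t => γ₀ t 0) (fun z _ => timeFn_spin z)
    (h.contDiff_time.differentiable (by simp)), h.deriv_time]

lemma one_add_gradSq (h : IsReferencePair U g γ γ₀ s m α f) (hy : y ∈ polarDomain) :
    1 + gradSq g (spin γ) (timeFn (spin γ₀)) y = lorentzFactor γ₀ (y 0) ^ 2 := by
  rw [h.gradSq_eq hy, IsProfile.lorentzFactor_sq, h.speed_eq]

lemma laplacian_eq (h : IsReferencePair U g γ γ₀ s m α f) (hy : y ∈ polarDomain) :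
    laplacian g (spin γ) (timeFn (spin γ₀)) y
      = refDilation γ₀ (y 0) * lorentzFactor γ₀ (y 0) := by
  rw [h.slice.laplacian_spin hy (τ := fun t => γ₀ t 0) (fun z _ => timeFn_spin z) h.contDiff_time,
    refDilation, h.speed_eq, h.radius_eq, div_mul_cancel₀ _ (IsProfile.lorentzFactor_pos _ _).ne']
  simp only [h.deriv_time]

lemma laplacian_sq_div (h : IsReferencePair U g γ γ₀ s m α f) (hy : y ∈ polarDomain) :
    laplacian g (spin γ) (timeFn (spin γ₀)) y ^ 2 / (1 + gradSq g (spin γ) (timeFn (spin γ₀)) y)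
      = refDilation γ₀ (y 0) ^ 2 := by
  have := (IsProfile.lorentzFactor_pos γ₀ (y 0)).ne'
  rw [h.one_add_gradSq hy, h.laplacian_eq hy]
  field_simp

lemma massDensity_eq (h : IsReferencePair U g γ γ₀ s m α f) (hy : y ∈ polarDomain) :
    massDensity g (spin γ) (spin γ₀) y =
      (refCurvature γ₀ f (y 0) - √(s * m (y 0) + refDilation γ₀ (y 0) ^ 2))
        / lorentzFactor γ₀ (y 0) := by
  rw [massDensity, h.laplacian_sq_div hy, h.one_add_gradSq hy, h.data.meanCurvSq_eq y hy,
    h.ref.meanCurvSq_eq y hy, sub_add_cancel, Real.sqrt_sq (h.ref.curvature_pos _ hy).le,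
    Real.sqrt_sq (IsProfile.lorentzFactor_pos _ _).le]

lemma norm_sq_pos (h : IsReferencePair U g γ γ₀ s m α f) {θ : ℝ} (hθ : θ ∈ Ioo 0 Real.pi) :
    0 < s * m θ := mul_pos h.s_pos (h.data.m_pos θ hθ)

/-- The second angle is exactly the boost occurring in α_{H₀}, and cancels there. -/
lemma arsinh_eq (h : IsReferencePair U g γ γ₀ s m α f) (hy : y ∈ polarDomain) :
    Real.arsinh (massDensity g (spin γ) (spin γ₀) y * laplacian g (spin γ) (timeFn (spin γ₀)) y /
        (meanCurvNorm flat (spin γ₀) y * meanCurvNorm g (spin γ) y))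
      = refAngle γ₀ s m (y 0) - Real.arsinh (refDilation γ₀ (y 0) /
          √(refCurvature γ₀ f (y 0) ^ 2 - refDilation γ₀ (y 0) ^ 2)) := by
  have hW := (IsProfile.lorentzFactor_pos γ₀ (y 0)).ne'
  have h1 := h.norm_sq_pos hy
  have h2 := h.ref.spacelike _ hy
  rw [refAngle, ← arsinh_sub_arsinh (Real.sqrt_pos.2 h1) (Real.sqrt_pos.2 h2), Real.sq_sqrt h1.le,
    Real.sq_sqrt h2.le, sub_add_cancel, Real.sqrt_sq (h.ref.curvature_pos _ hy).le,
    h.massDensity_eq hy, h.laplacian_eq hy, meanCurvNorm, meanCurvNorm, h.data.meanCurvSq_eq y hy,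
    h.ref.meanCurvSq_eq y hy]
  congr 2
  field_simp

lemma contDiffAt_refAngle (h : IsReferencePair U g γ γ₀ s m α f) {θ : ℝ}
    (hθ : θ ∈ Ioo 0 Real.pi) : ContDiffAt ℝ ∞ (refAngle γ₀ s m) θ :=
  ((h.ref.profile.contDiffAt_refDilation hθ).div
    ((contDiffAt_const.mul (h.data.m_smooth θ hθ)).sqrt (h.norm_sq_pos hθ).ne')
    (Real.sqrt_pos.2 (h.norm_sq_pos hθ)).ne').arsinh

lemma contDiffAt_slipAngle (h : IsReferencePair U g γ γ₀ s m α f) {θ : ℝ}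
    (hθ : θ ∈ Ioo 0 Real.pi) : ContDiffAt ℝ ∞ (fun t => slipAngle s (m t)) θ := by
  have hm := h.data.m_smooth θ hθ
  exact (((contDiffAt_const.sub hm).div_const 2).div
    ((contDiffAt_const.mul hm).sqrt (h.norm_sq_pos hθ).ne')
    (Real.sqrt_pos.2 (h.norm_sq_pos hθ)).ne').arsinh

lemma contDiffAt_refArsinh (h : IsReferencePair U g γ γ₀ s m α f) {θ : ℝ}
    (hθ : θ ∈ Ioo 0 Real.pi) : ContDiffAt ℝ ∞ (fun t => Real.arsinh
      (refDilation γ₀ t / √(refCurvature γ₀ f t ^ 2 - refDilation γ₀ t ^ 2))) θ := by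
  have h1 := h.ref.profile.contDiffAt_refDilation hθ
  have h2 := h.ref.profile.contDiffAt_refCurvature hθ h.ref.smooth.contDiffAt
  have h3 := h.ref.spacelike θ hθ
  exact (h1.div (((h2.pow 2).sub (h1.pow 2)).sqrt h3.ne') (Real.sqrt_pos.2 h3).ne').arsinh

/-- With X = √(s m + x²), the sum of ρτ' = (k − X)τ'/W and the frame part −(k − f/r)τ'/W of −α_{H₀}
no longer contains k. The boost of α_{H₀} cancels against half of the arsinh term. -/
lemma flux_eq (h : IsReferencePair U g γ γ₀ s m α f) (hy : y ∈ polarDomain) :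
    flux g (spin γ) (spin γ₀) 0 y = profileFlux g γ γ₀ s m α f (y 0) ∧
    flux g (spin γ) (spin γ₀) 1 y = 0 := by
  have d1 := (h.contDiffAt_refAngle hy).differentiableAt (by simp)
  have d2 := (h.contDiffAt_refArsinh hy).differentiableAt (by simp)
  have d3 := (h.contDiffAt_slipAngle hy).differentiableAt (by simp)
  have e1 := pd_eq_of_polar hy (fun z hz => h.arsinh_eq hz) (d1.hasDerivAt.fun_sub d2.hasDerivAt)
  have e2 := pd_eq_of_polar (h := fun t => γ₀ t 0) hy (fun z _ => timeFn_spin z)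
    (h.contDiff_time.differentiable (by simp) _).hasDerivAt
  constructor
  · rw [flux, e1.1, e2.1, h.massDensity_eq hy, h.data.alphaH_zero y hy, h.ref.alphaH_zero y hy,
      profileFlux, h.deriv_time, (d1.hasDerivAt.fun_sub d3.hasDerivAt).deriv, h.radius_eq]
    ring
  · rw [flux, e1.2, e2.2, h.data.alphaH_one y hy, h.ref.alphaH_one y hy]
    ring

/-- The optimal embedding equation can be integrated once. -/
lemma exists_flux_const (h : IsReferencePair U g γ γ₀ s m α f)
    (hα : ∀ θ ∈ Ioo 0 Real.pi, DifferentiableAt ℝ α θ)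
    (hO : ∀ y ∈ polarDomain, divergence g (spin γ) (flux g (spin γ) (spin γ₀)) y = 0) :
    ∃ C, ∀ θ ∈ Ioo 0 Real.pi, radius g γ θ / speed g γ θ * profileFlux g γ γ₀ s m α f θ = C := by
  have hd : ∀ θ ∈ Ioo 0 Real.pi, DifferentiableAt ℝ (profileFlux g γ γ₀ s m α f) θ := by
    intro θ hθ
    have hW := h.ref.profile.contDiff_lorentzFactor.contDiffAt (x := θ)
    have hx := h.ref.profile.contDiffAt_refDilation hθ
    have hnn : s * m θ + refDilation γ₀ θ ^ 2 ≠ 0 := by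
      have := h.norm_sq_pos hθ; positivity
    have c1 := (((h.ref.profile.contDiff_deriv_apply 0).contDiffAt (x := θ)).div hW
        (IsProfile.lorentzFactor_pos γ₀ θ).ne').mul
      ((h.ref.smooth.contDiffAt.div (h.slice.contDiffAt_radius hθ) (h.slice.radius_pos hθ).ne').sub
        (((contDiffAt_const.mul (h.data.m_smooth θ hθ)).add (hx.pow 2)).sqrt hnn))
    have c2 := contDiffAt_deriv ((h.contDiffAt_refAngle hθ).sub (h.contDiffAt_slipAngle hθ))
    exact ((c1.differentiableAt (by simp)).add (hα θ hθ)).sub (c2.differentiableAt (by simp))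
  have hd' : ∀ θ ∈ Ioo 0 Real.pi, DifferentiableAt ℝ
      (fun t => radius g γ t / speed g γ t * profileFlux g γ γ₀ s m α f t) θ := fun θ hθ =>
    (((h.slice.contDiffAt_radius hθ).div h.slice.contDiff_speed.contDiffAt
      (h.slice.speed_pos _).ne').differentiableAt (by simp)).mul (hd θ hθ)
  have h0 : ∀ θ ∈ Ioo 0 Real.pi,
      deriv (fun t => radius g γ t / speed g γ t * profileFlux g γ γ₀ s m α f t) θ = 0 := by
    intro θ hθ
    have h1 := hO _ (meridianPoint_mem hθ)
    rw [h.slice.divergence_spin (meridianPoint_mem hθ) (fun z hz => (h.flux_eq hz).1)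
      (fun z hz => (h.flux_eq hz).2) (hd θ hθ)] at h1
    refine (mul_eq_zero.1 h1).resolve_left ?_
    exact inv_ne_zero (mul_ne_zero (h.slice.speed_pos _).ne' (h.slice.radius_pos hθ).ne')
  have hpi := Real.pi_pos
  refine ⟨radius g γ (Real.pi / 2) / speed g γ (Real.pi / 2)
    * profileFlux g γ γ₀ s m α f (Real.pi / 2), fun θ hθ => ?_⟩
  exact isOpen_Ioo.is_const_of_deriv_eq_zero isPreconnected_Ioo
    (fun t ht => (hd' t ht).differentiableWithinAt) h0 hθ
    (show Real.pi / 2 ∈ Ioo 0 Real.pi from ⟨by linarith, by linarith⟩)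

end IsReferencePair

end
end WangYau

namespace WangYau
noncomputable section

/-! ### Comparison lemmas on an interval -/

/-- −η is compared with the line b + D(x − p). The slope bound is only known while |η| ≤ M; the last
hypothesis keeps the line below M, so the bound is available at any contact. -/
lemma barrier_le {η η' : ℝ → ℝ} {p t b D M : ℝ} (hpt : p ≤ t) (hb : 0 ≤ b) (hD : 0 ≤ D)
    (hη : ∀ x ∈ Icc p t, HasDerivAt η (η' x) x) (hp : -b ≤ η p)
    (hstep : ∀ x ∈ Icc p t, |η x| ≤ M → -D < η' x) (hM : b + D * (t - p) ≤ M) :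
    -(b + D * (t - p)) ≤ η t := by
  have hB : ∀ x, HasDerivAt (fun x => b + D * (x - p)) D x := fun x => by
    simpa using (((hasDerivAt_id x).sub_const p).const_mul D).const_add b
  have key := image_le_of_deriv_right_lt_deriv_boundary (f := fun x => -η x) (f' := fun x => -η' x)
    (a := p) (b := t) (B := fun x => b + D * (x - p)) (B' := fun _ => D)
    (fun x hx => (hη x hx).continuousAt.neg.continuousWithinAt)
    (fun x hx => (hη x ⟨hx.1, hx.2.le⟩).neg.hasDerivWithinAt) (by simp; linarith) hB
    (fun x hx he => by
      have hx' : x ∈ Icc p t := ⟨hx.1, hx.2.le⟩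
      have h0 : 0 ≤ D * (x - p) := mul_nonneg hD (by linarith [hx.1])
      have h1 : D * (x - p) ≤ D * (t - p) := mul_le_mul_of_nonneg_left (by linarith [hx.2]) hD
      have h2 : |η x| ≤ M := by
        rw [← abs_neg, he, abs_of_nonneg (by linarith)]; linarith
      have := hstep x hx' h2
      linarith)
    (show t ∈ Icc p t from ⟨hpt, le_rfl⟩)
  linarith

/-- A function that vanishes at the left end and is positive at `t` increases somewhere on an
interval of positivity that ends at `t`. -/
lemma exists_deriv_pos {q q' : ℝ → ℝ} {t : ℝ} (ht : 0 < t) (hq : ContinuousOn q (Icc 0 t))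
    (hq' : ∀ x ∈ Ioo 0 t, HasDerivAt q (q' x) x) (h0 : q 0 = 0) (hqt : 0 < q t) :
    ∃ p ∈ Ioo 0 t, 0 < q' p ∧ ∀ x ∈ Icc p t, 0 < q x := by
  have hcl : IsCompact (Icc 0 t ∩ q ⁻¹' Iic 0) :=
    isCompact_Icc.of_isClosed_subset (hq.preimage_isClosed_of_isClosed isClosed_Icc isClosed_Iic)
      inter_subset_left
  -- `a` is the last point of the interval with q ≤ 0; the mean value theorem on [a, t] supplies
  -- `p`.
  obtain ⟨a, ⟨⟨ha0, hat⟩, hqa⟩, hmax⟩ := hcl.exists_isGreatest ⟨0, ⟨le_rfl, ht.le⟩, h0.le⟩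
  have hqa' : q a ≤ 0 := hqa
  have hlt : a < t := lt_of_le_of_ne hat (by rintro rfl; linarith)
  obtain ⟨p, hp, he⟩ := exists_hasDerivAt_eq_slope q q' hlt
    (hq.mono (Icc_subset_Icc ha0 le_rfl)) (fun x hx => hq' x ⟨by linarith [hx.1], hx.2⟩)
  refine ⟨p, ⟨by linarith [hp.1], hp.2⟩, ?_, fun x hx => ?_⟩
  · rw [he]; exact div_pos (by linarith) (by linarith)
  · by_contra hneg
    have := hmax (a := x) ⟨⟨by linarith [hp.1, hx.1], hx.2⟩, by
      simp only [mem_preimage, mem_Iic]; linarith⟩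
    linarith [hp.1, hx.1]

section Angle

variable {q c y η η' : ℝ → ℝ} {b D M L : ℝ}

/-- Some earlier p in the same interval of positivity has q'(p) > 0, hence y(p) > 0; from p on the
barrier keeps η from falling. The bound b between η and y is spent twice, once at p and once at t,
which explains the term 2b. -/
lemma angle_lower_bound (hb : 0 ≤ b) (hD : 0 ≤ D) (hM : 2 * b + D * L ≤ M)
    (hq : ContinuousOn q (Icc 0 L)) (h0 : q 0 = 0)
    (hq' : ∀ x ∈ Ioo 0 L, HasDerivAt q (c x * Real.sinh (y x)) x) (hc : ∀ x ∈ Ioo 0 L, 0 < c x)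
    (hη : ∀ x ∈ Ioo 0 L, HasDerivAt η (η' x) x) (hηy : ∀ x ∈ Ioo 0 L, |η x - y x| ≤ b)
    (hstep : ∀ x ∈ Ioo 0 L, 0 < q x → |y x| ≤ M → -D < η' x) {t : ℝ} (ht : t ∈ Ioo 0 L)
    (hqt : 0 < q t) : -M ≤ y t := by
  obtain ⟨p, hp, hpos, hqp⟩ := exists_deriv_pos ht.1 (hq.mono (Icc_subset_Icc le_rfl ht.2.le))
    (fun x hx => hq' x ⟨hx.1, hx.2.trans ht.2⟩) h0 hqt
  have hpL : p ∈ Ioo 0 L := ⟨hp.1, hp.2.trans ht.2⟩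
  have hy : 0 < y p := Real.sinh_pos_iff.1 (pos_of_mul_pos_right hpos (hc p hpL).le)
  have hsub : ∀ x ∈ Icc p t, x ∈ Ioo 0 L := fun x hx =>
    ⟨by linarith [hx.1, hp.1], by linarith [hx.2, ht.2]⟩
  have hDt : D * (t - p) ≤ D * L := mul_le_mul_of_nonneg_left (by linarith [ht.2, hp.1]) hD
  have := barrier_le (η := η) (η' := η') (M := M - b) hp.2.le hb hD (fun x hx => hη x (hsub x hx))
    (by have := abs_le.1 (hηy p hpL); linarith)
    (fun x hx hx2 => hstep x (hsub x hx) (hqp x hx) (by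
      have := abs_le.1 (hηy x (hsub x hx))
      have := abs_le.1 hx2
      exact abs_le.2 ⟨by linarith, by linarith⟩)) (by linarith)
  have := abs_le.1 (hηy t ht)
  linarith

/-- The substitution x ↦ L − x with y and η negated preserves the system, and turns the lower bound
from the left end into an upper bound from the right end. -/
lemma angle_bound_of_pos (hb : 0 ≤ b) (hD : 0 ≤ D) (hM : 2 * b + D * L ≤ M)
    (hq : ContinuousOn q (Icc 0 L)) (h0 : q 0 = 0) (hL : q L = 0)
    (hq' : ∀ x ∈ Ioo 0 L, HasDerivAt q (c x * Real.sinh (y x)) x) (hc : ∀ x ∈ Ioo 0 L, 0 < c x)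
    (hη : ∀ x ∈ Ioo 0 L, HasDerivAt η (η' x) x) (hηy : ∀ x ∈ Ioo 0 L, |η x - y x| ≤ b)
    (hstep : ∀ x ∈ Ioo 0 L, 0 < q x → |y x| ≤ M → -D < η' x) {t : ℝ} (ht : t ∈ Ioo 0 L)
    (hqt : 0 < q t) : |y t| ≤ M := by
  rw [abs_le]
  refine ⟨angle_lower_bound hb hD hM hq h0 hq' hc hη hηy hstep ht hqt, ?_⟩
  have hm : ∀ x ∈ Ioo 0 L, L - x ∈ Ioo 0 L := fun x hx => ⟨by linarith [hx.2], by linarith [hx.1]⟩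
  have hmc : MapsTo (fun x => L - x) (Icc 0 L) (Icc 0 L) := fun x hx =>
    ⟨by linarith [hx.2], by linarith [hx.1]⟩
  have hd : ∀ x : ℝ, HasDerivAt (fun x => L - x) (-1) x := fun x => by
    simpa using (hasDerivAt_id x).const_sub L
  have := angle_lower_bound (q := fun x => q (L - x)) (c := fun x => c (L - x))
    (y := fun x => -y (L - x)) (η := fun x => -η (L - x)) (η' := fun x => η' (L - x))
    (t := L - t) hb hD hM
    (hq.comp (continuous_const.sub continuous_id).continuousOn hmc) (by simpa using hL)
    (fun x hx => by
      have h1 := (hq' _ (hm x hx)).comp x (hd x)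
      refine h1.congr_deriv ?_
      rw [Real.sinh_neg]; ring)
    (fun x hx => hc _ (hm x hx))
    (fun x hx => by
      have h1 := ((hη _ (hm x hx)).comp x (hd x)).neg
      refine h1.congr_deriv ?_
      ring)
    (fun x hx => by
      rw [← abs_neg]
      have := hηy _ (hm x hx)
      convert this using 2
      ring)
    (fun x hx h1 h2 => hstep _ (hm x hx) h1 (by rwa [abs_neg] at h2)) (hm t ht)
    (by simpa using hqt)
  simp only [sub_sub_cancel] at this
  linarith

/-- A priori bound of the angle `y` in the system `q' = c sinh y`, `η' ≥ -D` (resp. `≤ D`) where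
`q > 0` (resp. `q < 0`) and `y` is bounded. -/
lemma angle_bound (hb : 0 ≤ b) (hD : 0 ≤ D) (hM : 2 * b + D * L ≤ M) (hM0 : 0 ≤ M)
    (hq : ContinuousOn q (Icc 0 L)) (h0 : q 0 = 0) (hL : q L = 0)
    (hq' : ∀ x ∈ Ioo 0 L, HasDerivAt q (c x * Real.sinh (y x)) x) (hc : ∀ x ∈ Ioo 0 L, 0 < c x)
    (hη : ∀ x ∈ Ioo 0 L, HasDerivAt η (η' x) x) (hηy : ∀ x ∈ Ioo 0 L, |η x - y x| ≤ b)
    (hy : ContinuousOn y (Ioo 0 L))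
    (hpos : ∀ x ∈ Ioo 0 L, 0 < q x → |y x| ≤ M → -D < η' x)
    (hneg : ∀ x ∈ Ioo 0 L, q x < 0 → |y x| ≤ M → η' x < D) {t : ℝ} (ht : t ∈ Ioo 0 L) :
    |y t| ≤ M := by
  have key : ∀ x ∈ Ioo 0 L, q x ≠ 0 → |y x| ≤ M := by
    intro x hx hqx
    rcases lt_or_gt_of_ne hqx with h | h
    -- Negating q, y and η together preserves the system.
    · have := angle_bound_of_pos (q := fun x => -q x) (y := fun x => -y x) (η := fun x => -η x)
        (η' := fun x => -η' x) hb hD hM hq.neg (by simpa using h0) (by simpa using hL)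
        (fun x hx => by
          refine (hq' x hx).neg.congr_deriv ?_
          rw [Real.sinh_neg]; ring) hc (fun x hx => (hη x hx).neg)
        (fun x hx => by
          rw [← abs_neg]
          convert hηy x hx using 2
          ring)
        (fun x hx h1 h2 => by
          have := hneg x hx (by linarith) (by rwa [abs_neg] at h2)
          linarith) hx (by linarith)
      rwa [abs_neg] at this
    · exact angle_bound_of_pos hb hD hM hq h0 hL hq' hc hη hηy hpos hx h
  by_contra hcon
  -- A violation can only occur at a zero of q with y ≠ 0. There q' ≠ 0, so the zero is isolated and
  -- the bound passes to it by continuity of y.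
  have hy0 : y t ≠ 0 := by
    intro h; rw [h, abs_zero] at hcon; exact hcon hM0
  have hd : c t * Real.sinh (y t) ≠ 0 :=
    mul_ne_zero (hc t ht).ne' (by rwa [Ne, Real.sinh_eq_zero])
  have h1 : ∀ᶠ z in 𝓝[≠] t, |y z| ≤ M := by
    filter_upwards [(hq' t ht).eventually_ne (c := 0) hd,
      mem_nhdsWithin_of_mem_nhds (isOpen_Ioo.mem_nhds ht)] with z hz hz'
    exact key z hz' hz
  have h2 : Tendsto (fun z => |y z|) (𝓝[≠] t) (𝓝 |y t|) :=
    ((hy.continuousAt (isOpen_Ioo.mem_nhds ht)).abs.tendsto).mono_left nhdsWithin_le_nhds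
  exact hcon (le_of_tendsto h2 h1)

end Angle

/-- A function vanishing at the left end that increases where it is negative is nonnegative. -/
lemma nonneg_of_deriv_pos {f f' : ℝ → ℝ} {a : ℝ} (ha : 0 < a) (hf : ContinuousOn f (Icc 0 a))
    (h0 : f 0 = 0) (hd : ∀ x ∈ Ioc 0 a, HasDerivAt f (f' x) x)
    (hpos : ∀ x ∈ Ioc 0 a, f x < 0 → 0 < f' x) : 0 ≤ f a := by
  by_contra hneg
  push Not at hneg
  -- At a negative minimum the derivative is positive, so smaller values occur just to the left.
  obtain ⟨x, hx, hmin⟩ := isCompact_Icc.exists_isMinOn ⟨0, ⟨le_rfl, ha.le⟩⟩ hf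
  have hfx : f x < 0 := (hmin ⟨ha.le, le_rfl⟩ : f x ≤ f a).trans_lt hneg
  have hx0 : 0 < x := lt_of_le_of_ne hx.1 (by rintro rfl; linarith)
  have hx' : x ∈ Ioc 0 a := ⟨hx0, hx.2⟩
  have h1 := (hasDerivAt_iff_tendsto_slope.1 (hd x hx')).eventually
    (lt_mem_nhds (hpos x hx' hfx))
  have h2 : ∀ᶠ z in 𝓝[<] x, 0 < slope f x z :=
    h1.filter_mono (nhdsWithin_mono _ fun z (hz : z < x) => hz.ne)
  obtain ⟨z, hz, hz0, hzx⟩ := (h2.and ((Ioo_mem_nhdsLT hx0))).exists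
  have h3 : f x ≤ f z := hmin ⟨hz0.le, by linarith [hx.2]⟩
  rw [slope_def_field] at hz
  have := mul_neg_of_pos_of_neg hz (show z - x < 0 by linarith)
  rw [div_mul_cancel₀ _ (by linarith)] at this
  linarith

/-- A quadratic bound for a function with a small linear growth rate. -/
lemma quadratic_bound {q q' : ℝ → ℝ} {t κ Λ : ℝ} (ht : 0 < t)
    (hq : ContinuousOn q (Icc 0 t)) (h0 : q 0 = 0) (hd : ∀ x ∈ Ioo 0 t, HasDerivAt q (q' x) x)
    (hb : ∀ x ∈ Ioo 0 t, |q' x| ≤ κ * (Λ * x + |q x|)) (hκ : 0 ≤ κ) (hΛ : 0 ≤ Λ)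
    (hκt : κ * t ≤ 1 / 2) : |q t| ≤ 2 * κ * Λ * t ^ 2 := by
  obtain ⟨x, hx, hmax⟩ := isCompact_Icc.exists_isMaxOn ⟨0, ⟨le_rfl, ht.le⟩⟩ hq.abs
  have hmax' : ∀ z ∈ Icc 0 t, |q z| ≤ |q x| := fun z hz => hmax hz
  refine (hmax' t ⟨ht.le, le_rfl⟩).trans ?_
  rcases hx.1.eq_or_lt with h | h
  · rw [← h, h0, abs_zero]; positivity
  · obtain ⟨p, hp, he⟩ := exists_hasDerivAt_eq_slope q q' h
      (hq.mono (Icc_subset_Icc le_rfl hx.2)) (fun z hz => hd z ⟨hz.1, hz.2.trans_le hx.2⟩)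
    have hp' : p ∈ Ioo 0 t := ⟨hp.1, hp.2.trans_le hx.2⟩
    have h1 := hb p hp'
    rw [he, h0, sub_zero, sub_zero, abs_div, abs_of_pos h, div_le_iff₀ h] at h1
    have h2 := hmax' p ⟨hp'.1.le, hp'.2.le⟩
    have h3 : κ * (Λ * p + |q p|) * x ≤ κ * (Λ * t + |q x|) * t := by
      have := hp'.2.le
      have := hp'.1.le
      have := hx.2
      gcongr
    -- The growth term is absorbed into the maximum of |q|, which costs the factor 2.
    have h4 : κ * |q x| * t ≤ 1 / 2 * |q x| := by
      nlinarith [abs_nonneg (q x)]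
    nlinarith

end
end WangYau

namespace WangYau
noncomputable section

/-! ### A priori estimates for solutions of the optimal embedding equation -/

/-- A reference pair for a closed surface: the profile curves end on the axis. -/
structure IsClosedPair (U : Set R4) (g : R4 → Form) (γ γ₀ : ℝ → R4) (s : ℝ) (m α f : ℝ → ℝ) :
    Prop extends IsReferencePair U g γ γ₀ s m α f where
  radius_zero : radius g γ 0 = 0
  radius_pi : radius g γ Real.pi = 0
  f_zero : f 0 = 0
  f_pi : f Real.pi = 0

/-- Quantitative bounds of the geometry of a surface of revolution. -/
structure ProfileBounds (g : R4 → Form) (γ : ℝ → R4) (s : ℝ) (m α : ℝ → ℝ) (Λ d ε : ℝ) :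
    Prop where
  one_le : 1 ≤ Λ
  d_pos : 0 < d
  speed_le : ∀ θ ∈ Ioo 0 Real.pi, speed g γ θ ≤ Λ
  le_speed : ∀ θ ∈ Ioo 0 Real.pi, 1 ≤ Λ * speed g γ θ
  radius_le : ∀ θ ∈ Ioo 0 Real.pi, radius g γ θ ≤ Λ * θ
  radius_le' : ∀ θ ∈ Ioo 0 Real.pi, radius g γ θ ≤ Λ * (Real.pi - θ)
  le_radius : ∀ θ ∈ Ioo 0 Real.pi, θ * (Real.pi - θ) ≤ Λ * radius g γ θ
  deriv_radius_le : ∀ θ ∈ Ioo 0 Real.pi, |deriv (radius g γ) θ| ≤ Λ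
  deriv_ratio_le : ∀ θ ∈ Ioo 0 Real.pi,
    |deriv (fun t => deriv (radius g γ) t / speed g γ t) θ| ≤ Λ
  deriv_radius_pos : ∀ θ ∈ Ioo 0 Real.pi, θ < d → 0 < deriv (radius g γ) θ
  deriv_radius_neg : ∀ θ ∈ Ioo 0 Real.pi, Real.pi - d < θ → deriv (radius g γ) θ < 0
  connection_le : ∀ θ ∈ Ioo 0 Real.pi, |α θ| ≤ Λ
  slipAngle_le : ∃ c, ∀ θ ∈ Ioo 0 Real.pi, |slipAngle s (m θ) - c| ≤ Λ
  norm_le : ∀ θ ∈ Ioo 0 Real.pi, √(s * m θ) ≤ ε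

/-- The derivative bound used in the estimate of the angle. -/
def angleSlope (Λ d : ℝ) : ℝ := Λ * (Λ / d ^ 2 + 1) + Λ + 1

/-- The a priori bound of the angle. -/
def angleConst (Λ d : ℝ) : ℝ := 2 * Λ + angleSlope Λ d * Real.pi

/-- The hyperbolic sine of the tilt of the reference surface, `∂_θ τ / |∂_θ|`. -/
def tilt (g : R4 → Form) (γ γ₀ : ℝ → R4) (θ : ℝ) : ℝ := deriv γ₀ θ 0 / speed g γ θ

namespace IsClosedPair

variable {U : Set R4} {g : R4 → Form} {γ γ₀ : ℝ → R4} {s : ℝ} {m α f : ℝ → ℝ} {Λ d ε θ : ℝ}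

lemma factor_sq (h : IsClosedPair U g γ γ₀ s m α f) (θ : ℝ) :
    lorentzFactor γ₀ θ ^ 2 = 1 + tilt g γ γ₀ θ ^ 2 := by
  rw [IsProfile.lorentzFactor_sq, h.speed_eq]; rfl

lemma abs_tilt_le (h : IsClosedPair U g γ γ₀ s m α f) (θ : ℝ) :
    |tilt g γ γ₀ θ| ≤ lorentzFactor γ₀ θ :=
  abs_le_of_sq_le_sq (by rw [h.factor_sq]; linarith) (IsProfile.lorentzFactor_pos _ _).le

lemma factor_le (h : IsClosedPair U g γ γ₀ s m α f) (θ : ℝ) :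
    lorentzFactor γ₀ θ ≤ 1 + |tilt g γ γ₀ θ| := by
  refine abs_le_of_sq_le_sq' ?_ (by positivity) |>.2
  rw [h.factor_sq]
  nlinarith [abs_nonneg (tilt g γ γ₀ θ), sq_abs (tilt g γ γ₀ θ)]

lemma contDiff_tilt (h : IsClosedPair U g γ γ₀ s m α f) : ContDiff ℝ ∞ (tilt g γ γ₀) :=
  (h.ref.profile.contDiff_deriv_apply 0).div h.slice.contDiff_speed fun θ =>
    (h.slice.speed_pos θ).ne'

/-- The Laplacian of τ in divergence form: r S is the flux of ∇τ through the orbit, up to 2π. -/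
lemma hasDerivAt_radius_tilt (h : IsClosedPair U g γ γ₀ s m α f) (hθ : θ ∈ Ioo 0 Real.pi) :
    HasDerivAt (fun t => radius g γ t * tilt g γ γ₀ t)
      (speed g γ θ * radius g γ θ * lorentzFactor γ₀ θ * refDilation γ₀ θ) θ := by
  have hr := h.slice.contDiffAt_radius hθ
  have e : (fun t => radius g γ t * tilt g γ γ₀ t)
      = fun t => radius flat γ₀ t / speed flat γ₀ t * deriv γ₀ t 0 := by
    ext t; rw [tilt, h.speed_eq, h.radius_eq]; ring
  have hd : DifferentiableAt ℝ (fun t => radius g γ t * tilt g γ γ₀ t) θ :=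
    (hr.mul h.contDiff_tilt.contDiffAt).differentiableAt (by simp)
  refine hd.hasDerivAt.congr_deriv ?_
  have h1 := (h.slice.speed_pos θ).ne'
  have h2 := (h.slice.radius_pos hθ).ne'
  have h3 := (IsProfile.lorentzFactor_pos γ₀ θ).ne'
  rw [refDilation, e, h.speed_eq, h.radius_eq]
  field_simp

/-- The angle parametrizes x and √(|H|² + x²) as |H| sinh y and |H| cosh y, so a bound of y uniform
in s makes both small with |H|. -/
lemma refDilation_eq (h : IsClosedPair U g γ γ₀ s m α f) (hθ : θ ∈ Ioo 0 Real.pi) :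
    refDilation γ₀ θ = √(s * m θ) * Real.sinh (refAngle γ₀ s m θ) := by
  have := (Real.sqrt_pos.2 (h.norm_sq_pos hθ)).ne'
  rw [refAngle, Real.sinh_arsinh]; field_simp

lemma sqrt_eq (h : IsClosedPair U g γ γ₀ s m α f) (hθ : θ ∈ Ioo 0 Real.pi) :
    √(s * m θ + refDilation γ₀ θ ^ 2) = √(s * m θ) * Real.cosh (refAngle γ₀ s m θ) := by
  have h1 := Real.sq_sqrt (h.norm_sq_pos hθ).le
  rw [h.refDilation_eq hθ, ← Real.sqrt_sq (show 0 ≤ √(s * m θ) * Real.cosh (refAngle γ₀ s m θ) by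
    have := Real.cosh_pos (refAngle γ₀ s m θ); positivity)]
  congr 1
  rw [mul_pow, mul_pow, h1, Real.cosh_sq]; ring

lemma abs_f_le (h : IsClosedPair U g γ γ₀ s m α f) (hθ : θ ∈ Ioo 0 Real.pi) : |f θ| ≤ 1 := by
  have := h.ref.sq θ hθ
  exact abs_le_of_sq_le_sq (by nlinarith [sq_nonneg (refCos γ₀ θ)]) (by norm_num)

lemma refCos_eq (h : IsClosedPair U g γ γ₀ s m α f) (θ : ℝ) :
    refCos γ₀ θ = deriv (radius g γ) θ / speed g γ θ / lorentzFactor γ₀ θ := by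
  rw [refCos, h.radius_eq, h.speed_eq, div_div]

lemma hasDerivAt_f (h : IsClosedPair U g γ γ₀ s m α f) (θ : ℝ) : HasDerivAt f (deriv f θ) θ :=
  (h.ref.smooth.differentiable (by simp) θ).hasDerivAt

/-- The sign of `∂_θ f` where `f` is negative. -/
lemma deriv_f_pos (h : IsClosedPair U g γ γ₀ s m α f) (hθ : θ ∈ Ioo 0 Real.pi) (hf : f θ < 0) :
    (0 < deriv (radius g γ) θ → 0 < deriv f θ) ∧ (deriv (radius g γ) θ < 0 → deriv f θ < 0) := by
  have hW := IsProfile.lorentzFactor_pos γ₀ θ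
  have hs := h.slice.speed_pos θ
  have hr := h.slice.radius_pos hθ
  have hk := h.ref.curvature_pos θ hθ
  have hc : HasDerivAt (refCos γ₀) (deriv (refCos γ₀) θ) θ :=
    ((h.ref.profile.contDiffAt_refCos hθ).differentiableAt (by simp)).hasDerivAt
  have hsq : refCos γ₀ θ * deriv (refCos γ₀) θ + f θ * deriv f θ = 0 := by
    have e : (fun t => refCos γ₀ t ^ 2 + f t ^ 2) =ᶠ[𝓝 θ] fun _ => 1 := by
      filter_upwards [isOpen_Ioo.mem_nhds hθ] with t ht using h.ref.sq t ht
    have h1 := e.deriv_eq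
    rw [((hc.fun_pow 2).fun_add ((h.hasDerivAt_f θ).fun_pow 2)).deriv] at h1
    simp at h1
    linarith
  -- Multiplying the curvature by the cosine and using cos² + f² = 1 with its derivative isolates
  -- f'. Where f < 0 and k > 0, the sign of f' is therefore that of the cosine, which is the sign of
  -- r'.
  have key : refCos γ₀ θ * refCurvature γ₀ f θ
      = lorentzFactor γ₀ θ / speed g γ θ * deriv f θ + refCos γ₀ θ * (f θ / radius g γ θ) := by
    rw [refCurvature, h.speed_eq, h.radius_eq]
    have := h.ref.sq θ hθ
    linear_combination (lorentzFactor γ₀ θ / speed g γ θ * deriv f θ) * this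
      - (lorentzFactor γ₀ θ / speed g γ θ * f θ) * hsq
  have hWs : 0 < lorentzFactor γ₀ θ / speed g γ θ := div_pos hW hs
  have hfr : f θ / radius g γ θ < 0 := div_neg_of_neg_of_pos hf hr
  constructor
  · intro h1
    have hcp : 0 < refCos γ₀ θ := by rw [h.refCos_eq]; positivity
    have h2 := mul_pos hcp hk
    have h3 := mul_neg_of_pos_of_neg hcp hfr
    exact pos_of_mul_pos_right (a := lorentzFactor γ₀ θ / speed g γ θ) (by linarith) hWs.le
  · intro h1
    have hcp : refCos γ₀ θ < 0 := by
      rw [h.refCos_eq, div_div]; exact div_neg_of_neg_of_pos h1 (mul_pos hs hW)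
    have h2 := mul_neg_of_neg_of_pos hcp hk
    have h3 := mul_pos_of_neg_of_neg hcp hfr
    by_contra h4
    push Not at h4
    have := mul_nonneg hWs.le h4
    linarith

/-- Lower bound of the principal curvature of the projection along the orbits. -/
lemma curvature_lower (h : IsClosedPair U g γ γ₀ s m α f) (B : ProfileBounds g γ s m α Λ d ε)
    (hθ : θ ∈ Ioo 0 Real.pi) : -(Λ / d ^ 2) ≤ f θ / radius g γ θ := by
  have hr := h.slice.radius_pos hθ
  have hd := B.d_pos
  have hΛ : 0 < Λ := by linarith [B.one_le]
  have hfc : Continuous f := h.ref.smooth.continuous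
  -- Near a pole r is monotone, so f, which vanishes at the pole, cannot become negative. Away from
  -- both poles r is bounded below by d²/Λ and |f| ≤ 1.
  rcases lt_or_ge θ d with h1 | h1
  · have : 0 ≤ f θ := by
      refine nonneg_of_deriv_pos (f' := deriv f) hθ.1 hfc.continuousOn h.f_zero
        (fun x _ => h.hasDerivAt_f x) fun x hx hfx => ?_
      have hx' : x ∈ Ioo 0 Real.pi := ⟨hx.1, hx.2.trans_lt hθ.2⟩
      exact (h.deriv_f_pos hx' hfx).1 (B.deriv_radius_pos x hx' (by linarith [hx.2]))
    have h2 : 0 ≤ f θ / radius g γ θ := by positivity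
    have h3 : 0 < Λ / d ^ 2 := by positivity
    linarith
  rcases lt_or_ge (Real.pi - d) θ with h2 | h2
  · have : 0 ≤ f (Real.pi - (Real.pi - θ)) := by
      refine nonneg_of_deriv_pos (f := fun x => f (Real.pi - x)) (a := Real.pi - θ)
        (f' := fun x => -deriv f (Real.pi - x)) (by linarith [hθ.2])
        (hfc.comp (continuous_const.sub continuous_id)).continuousOn (by simpa using h.f_pi)
        (fun x _ => ?_) fun x hx hfx => ?_
      · exact ((h.hasDerivAt_f (Real.pi - x)).scomp x
          ((hasDerivAt_id x).const_sub Real.pi)).congr_deriv (by simp)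
      · have hx' : Real.pi - x ∈ Ioo 0 Real.pi :=
          ⟨by linarith [hx.2, hθ.1], by linarith [hx.1]⟩
        have := (h.deriv_f_pos hx' hfx).2 (B.deriv_radius_neg _ hx' (by linarith [hx.2]))
        linarith
    rw [sub_sub_cancel] at this
    have h2 : 0 ≤ f θ / radius g γ θ := by positivity
    have h3 : 0 < Λ / d ^ 2 := by positivity
    linarith
  · have h3 : d ^ 2 ≤ Λ * radius g γ θ := by
      have := B.le_radius θ hθ
      nlinarith
    have h4 := (abs_le.1 (h.abs_f_le hθ)).1
    rw [neg_le, ← neg_div, div_le_div_iff₀ hr (by positivity)]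
    nlinarith [sq_nonneg d]

lemma angleSlope_nonneg (B : ProfileBounds g γ s m α Λ d ε) : 0 ≤ angleSlope Λ d := by
  have := B.one_le
  have := B.d_pos
  rw [angleSlope]; positivity

lemma angleConst_nonneg (B : ProfileBounds g γ s m α Λ d ε) : 0 ≤ angleConst Λ d := by
  have := B.one_le
  have := angleSlope_nonneg B
  have := Real.pi_pos
  rw [angleConst]; positivity

/-- A priori bound of the angle of the reference surface. -/
lemma abs_refAngle_le (h : IsClosedPair U g γ γ₀ s m α f) (B : ProfileBounds g γ s m α Λ d ε)
    (hj : ∀ θ ∈ Ioo 0 Real.pi, profileFlux g γ γ₀ s m α f θ = 0)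
    (hε : ε * Real.cosh (angleConst Λ d) ≤ 1) (hθ : θ ∈ Ioo 0 Real.pi) :
    |refAngle γ₀ s m θ| ≤ angleConst Λ d := by
  obtain ⟨c, hc⟩ := B.slipAngle_le
  have hΛ : 0 < Λ := by linarith [B.one_le]
  have hM := angleConst_nonneg B
  -- Vanishing of the current, solved for the derivative of the angle. The constant `c` centres the
  -- slip angle.
  have hder : ∀ x ∈ Ioo 0 Real.pi,
      HasDerivAt (fun t => refAngle γ₀ s m t - slipAngle s (m t) + c)
        (deriv γ₀ x 0 / lorentzFactor γ₀ x *
          (f x / radius g γ x - √(s * m x + refDilation γ₀ x ^ 2)) + α x) x := by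
    intro x hx
    have h1 := ((h.contDiffAt_refAngle hx).sub (h.contDiffAt_slipAngle hx)).differentiableAt
      (by simp)
    have h2 := hj x hx
    rw [profileFlux] at h2
    refine (h1.hasDerivAt.add_const c).congr_deriv ?_
    linarith
  -- As long as |y| ≤ M the square root is |H| cosh y ≤ ε cosh M ≤ 1; this is what the smallness
  -- hypothesis on ε is for.
  have hbr : ∀ x ∈ Ioo 0 Real.pi, |refAngle γ₀ s m x| ≤ angleConst Λ d →
      -(Λ / d ^ 2 + 1) ≤ f x / radius g γ x - √(s * m x + refDilation γ₀ x ^ 2) := by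
    intro x hx hy
    have h1 := h.curvature_lower B hx
    have h2 : √(s * m x + refDilation γ₀ x ^ 2) ≤ 1 := by
      rw [h.sqrt_eq hx]
      refine le_trans ?_ hε
      have h3 : Real.cosh (refAngle γ₀ s m x) ≤ Real.cosh (angleConst Λ d) := by
        rw [Real.cosh_le_cosh, abs_of_nonneg hM]; exact hy
      have hn := B.norm_le x hx
      have := Real.cosh_pos (refAngle γ₀ s m x)
      gcongr
      exact (Real.sqrt_nonneg _).trans hn
    linarith
  have hfac : ∀ x ∈ Ioo 0 Real.pi, |deriv γ₀ x 0 / lorentzFactor γ₀ x| ≤ Λ := by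
    intro x hx
    have h1 := h.slice.speed_pos x
    have hW := IsProfile.lorentzFactor_pos γ₀ x
    have e : deriv γ₀ x 0 = speed g γ x * tilt g γ γ₀ x := by rw [tilt]; field_simp
    rw [abs_div, abs_of_pos hW, div_le_iff₀ hW, e, abs_mul, abs_of_pos h1]
    exact mul_le_mul (B.speed_le x hx) (h.abs_tilt_le x) (abs_nonneg _) hΛ.le
  -- τ' has the sign of q = r S. Hence a large positive f/r pushes the angle in the harmless
  -- direction, and the lower bound of f/r suffices.
  have hsign : ∀ x ∈ Ioo 0 Real.pi, deriv γ₀ x 0 / lorentzFactor γ₀ x =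
      (radius g γ x * tilt g γ γ₀ x) *
        (speed g γ x / (radius g γ x * lorentzFactor γ₀ x)) := by
    intro x hx
    have h1 := (h.slice.speed_pos x).ne'
    have h2 := (h.slice.radius_pos hx).ne'
    have h3 := (IsProfile.lorentzFactor_pos γ₀ x).ne'
    rw [tilt]; field_simp
  have hfpos : ∀ x ∈ Ioo 0 Real.pi, 0 < speed g γ x / (radius g γ x * lorentzFactor γ₀ x) :=
    fun x hx => div_pos (h.slice.speed_pos x)
      (mul_pos (h.slice.radius_pos hx) (IsProfile.lorentzFactor_pos γ₀ x))
  have hK : 0 < Λ / d ^ 2 + 1 := by have := B.d_pos; positivity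
  -- The slope D collects Λ for |τ'|/W times the bound of the bracket, Λ for the connection form,
  -- and 1 to make the inequality strict; M is then exactly 2Λ + Dπ.
  refine angle_bound (q := fun t => radius g γ t * tilt g γ γ₀ t)
    (c := fun x => speed g γ x * radius g γ x * lorentzFactor γ₀ x * √(s * m x))
    (y := refAngle γ₀ s m) (b := Λ) (D := angleSlope Λ d) (L := Real.pi)
    hΛ.le (angleSlope_nonneg B) le_rfl hM ?_ ?_ ?_ ?_ ?_ hder ?_ ?_ ?_ ?_ hθ
  · exact ((h.slice.contDiff_orbitSq.continuous.sqrt).mul h.contDiff_tilt.continuous).continuousOn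
  · simp [h.radius_zero]
  · simp [h.radius_pi]
  · intro x hx
    refine (h.hasDerivAt_radius_tilt hx).congr_deriv ?_
    rw [h.refDilation_eq hx]; ring
  · intro x hx
    have h1 := h.slice.speed_pos x
    have h2 := h.slice.radius_pos hx
    have h3 := IsProfile.lorentzFactor_pos γ₀ x
    have h4 := Real.sqrt_pos.2 (h.norm_sq_pos hx)
    positivity
  · intro x hx
    rw [show refAngle γ₀ s m x - slipAngle s (m x) + c - refAngle γ₀ s m x
      = -(slipAngle s (m x) - c) by ring, abs_neg]
    exact hc x hx
  · exact fun x hx => (h.contDiffAt_refAngle hx).continuousAt.continuousWithinAt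
  · intro x hx hq hy
    have h1 := hbr x hx hy
    have h2 := abs_le.1 (hfac x hx)
    have h3 := abs_le.1 (B.connection_le x hx)
    have h4 : 0 < deriv γ₀ x 0 / lorentzFactor γ₀ x := by
      rw [hsign x hx]; exact mul_pos hq (hfpos x hx)
    rw [angleSlope]
    nlinarith
  · intro x hx hq hy
    have h1 := hbr x hx hy
    have h2 := abs_le.1 (hfac x hx)
    have h3 := abs_le.1 (B.connection_le x hx)
    have h4 : deriv γ₀ x 0 / lorentzFactor γ₀ x < 0 := by
      rw [hsign x hx]; exact mul_neg_of_neg_of_pos hq (hfpos x hx)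
    rw [angleSlope]
    nlinarith

/-- The dilation is controlled by the length of the mean curvature vector. -/
lemma abs_refDilation_le (h : IsClosedPair U g γ γ₀ s m α f) (B : ProfileBounds g γ s m α Λ d ε)
    (hj : ∀ θ ∈ Ioo 0 Real.pi, profileFlux g γ γ₀ s m α f θ = 0)
    (hε : ε * Real.cosh (angleConst Λ d) ≤ 1) (hθ : θ ∈ Ioo 0 Real.pi) :
    |refDilation γ₀ θ| ≤ ε * Real.sinh (angleConst Λ d) := by
  have h1 := h.abs_refAngle_le B hj hε hθ
  have h2 := B.norm_le θ hθ
  have h3 : 0 ≤ √(s * m θ) := Real.sqrt_nonneg _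
  rw [h.refDilation_eq hθ, abs_mul, abs_of_nonneg h3, Real.abs_sinh]
  exact mul_le_mul h2 (Real.sinh_le_sinh.2 h1) (Real.sinh_nonneg_iff.2 (abs_nonneg _))
    (h3.trans h2)

/-- The tilt is controlled by the dilation. -/
lemma abs_tilt_le_of_dilation (h : IsClosedPair U g γ γ₀ s m α f)
    (B : ProfileBounds g γ s m α Λ d ε) {K : ℝ}
    (hx : ∀ θ ∈ Ioo 0 Real.pi, |refDilation γ₀ θ| ≤ K) (hK : Λ * K * Real.pi ≤ 1 / 2)
    (hθ : θ ∈ Ioo 0 Real.pi) : |tilt g γ γ₀ θ| ≤ 2 * Λ ^ 3 * K := by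
  have hΛ : 0 < Λ := by linarith [B.one_le]
  have hK0 : 0 ≤ K := (abs_nonneg _).trans (hx θ hθ)
  have hr := h.slice.radius_pos hθ
  have hcont : Continuous (fun t => radius g γ t * tilt g γ γ₀ t) :=
    (h.slice.contDiff_orbitSq.continuous.sqrt).mul h.contDiff_tilt.continuous
  -- From W ≤ 1 + |S|, the derivative of q is bounded by a small multiple of r + |q|.
  have hbound : ∀ x ∈ Ioo 0 Real.pi, ∀ R, radius g γ x ≤ R →
      |speed g γ x * radius g γ x * lorentzFactor γ₀ x * refDilation γ₀ x|
        ≤ Λ * K * (R + |radius g γ x * tilt g γ γ₀ x|) := by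
    intro x hx' R hR
    have hr := h.slice.radius_pos hx'
    have hs := h.slice.speed_pos x
    have hW := IsProfile.lorentzFactor_pos γ₀ x
    rw [abs_mul, abs_mul, abs_mul, abs_of_pos hs, abs_of_pos hr, abs_of_pos hW, abs_mul,
      abs_of_pos hr]
    have h1 : radius g γ x * lorentzFactor γ₀ x ≤ R + radius g γ x * |tilt g γ γ₀ x| := by
      have := mul_le_mul_of_nonneg_left (h.factor_le x) hr.le
      linarith
    calc _ = speed g γ x * |refDilation γ₀ x| * (radius g γ x * lorentzFactor γ₀ x) := by ring
      _ ≤ Λ * K * (R + radius g γ x * |tilt g γ γ₀ x|) := by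
        have h2 := B.speed_le x hx'
        have h3 := hx x hx'
        gcongr
  -- Here t is the distance to the nearer pole, so t² ≤ t(π − t) ≤ Λ r: the quadratic decay of q
  -- more than pays for the division by r.
  have key : ∀ t, 0 < t → t ≤ Real.pi / 2 → t * (Real.pi - t) ≤ Λ * radius g γ θ →
      |radius g γ θ * tilt g γ γ₀ θ| ≤ 2 * (Λ * K) * Λ * t ^ 2 →
      |tilt g γ γ₀ θ| ≤ 2 * Λ ^ 3 * K := by
    intro t ht ht2 h1 h2
    rw [abs_mul, abs_of_pos hr] at h2
    have h3 : t ^ 2 ≤ Λ * radius g γ θ := by nlinarith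
    have h4 : radius g γ θ * |tilt g γ γ₀ θ| ≤ radius g γ θ * (2 * Λ ^ 3 * K) := by
      calc _ ≤ 2 * (Λ * K) * Λ * t ^ 2 := h2
        _ ≤ 2 * (Λ * K) * Λ * (Λ * radius g γ θ) := by gcongr
        _ = _ := by ring
    exact le_of_mul_le_mul_left h4 hr
  have hπ := Real.pi_pos
  have hΛK : 0 ≤ Λ * K := by positivity
  rcases le_total θ (Real.pi / 2) with hle | hle
  · refine key θ hθ.1 hle (B.le_radius θ hθ) ?_
    refine quadratic_bound (q := fun t => radius g γ t * tilt g γ γ₀ t) hθ.1 hcont.continuousOn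
      (by simp [h.radius_zero])
      (fun x hx' => h.hasDerivAt_radius_tilt ⟨hx'.1, hx'.2.trans hθ.2⟩)
      (fun x hx' => hbound x ⟨hx'.1, hx'.2.trans hθ.2⟩ _
        (B.radius_le x ⟨hx'.1, hx'.2.trans hθ.2⟩)) hΛK hΛ.le ?_
    have := mul_le_mul_of_nonneg_left hθ.2.le hΛK
    linarith
  · have hlt : 0 < Real.pi - θ := by linarith [hθ.2]
    refine key (Real.pi - θ) hlt (by linarith)
      (by have := B.le_radius θ hθ; linarith) ?_
    have hm : ∀ x ∈ Ioo 0 (Real.pi - θ), Real.pi - x ∈ Ioo 0 Real.pi := fun x hx' =>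
      ⟨by linarith [hx'.2, hθ.1], by linarith [hx'.1]⟩
    have := quadratic_bound (q := fun t => radius g γ (Real.pi - t) * tilt g γ γ₀ (Real.pi - t))
      (t := Real.pi - θ) (κ := Λ * K) (Λ := Λ) hlt
      (hcont.comp (continuous_const.sub continuous_id)).continuousOn
      (by simp [h.radius_pi])
      (fun x hx' => (h.hasDerivAt_radius_tilt (hm x hx')).comp x
        ((hasDerivAt_id x).const_sub Real.pi))
      (fun x hx' => by
        rw [mul_neg_one, abs_neg]
        have := B.radius_le' _ (hm x hx')
        rw [sub_sub_cancel] at this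
        exact hbound _ (hm x hx') _ this) hΛK hΛ.le
      (by
        have := mul_le_mul_of_nonneg_left (show Real.pi - θ ≤ Real.pi by linarith [hθ.1]) hΛK
        linarith)
    simpa using this

end IsClosedPair

end
end WangYau

namespace WangYau
noncomputable section

/-! ### Integrals over the surface -/

lemma setIntegral_polarCell (H : ℝ → ℝ) :
    ∫ y in polarCell, H (y 0) = 2 * Real.pi * ∫ θ in Ioo 0 Real.pi, H θ := by
  have e := MeasureTheory.volume_preserving_finTwoArrow ℝ
  have hcell : polarCell = (MeasurableEquiv.finTwoArrow : (Fin 2 → ℝ) ≃ᵐ ℝ × ℝ) ⁻¹'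
      (Ioo 0 Real.pi ×ˢ Ioo 0 (2 * Real.pi)) := by
    ext y
    simp [polarCell, and_assoc]
  have h1 : ∫ y in polarCell, H (y 0) =
      ∫ z in Ioo 0 Real.pi ×ˢ Ioo 0 (2 * Real.pi), H z.1 * 1 := by
    rw [← e.setIntegral_preimage_emb (MeasurableEquiv.measurableEmbedding _), ← hcell]
    simp
  rw [h1, MeasureTheory.Measure.volume_eq_prod, setIntegral_prod_mul (f := H) (g := fun _ => (1 : ℝ))]
  have := Real.pi_pos
  simp only [integral_const, smul_eq_mul, mul_one, Measure.real, Measure.restrict_apply MeasurableSet.univ, univ_inter, Real.volume_Ioo, sub_zero]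
  rw [ENNReal.toReal_ofReal (by positivity)]
  ring

/-- The constant in the bound of the total mean curvature of the projection. -/
def curvatureConst (Λ : ℝ) : ℝ :=
  Λ ^ 3 + 2 * Λ ^ 2 * Real.pi + Λ ^ 2 * (Λ ^ 2 * Real.pi + Λ) + Λ

namespace IsClosedPair

variable {U : Set R4} {g : R4 → Form} {γ γ₀ : ℝ → R4} {s : ℝ} {m α f : ℝ → ℝ} {Λ d ε θ : ℝ}

/-- The primitive that controls the total mean curvature of the projection. -/
def curvaturePrimitive (g : R4 → Form) (γ : ℝ → R4) (f : ℝ → ℝ) (θ : ℝ) : ℝ :=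
  f θ * (radius g γ θ * (deriv (radius g γ) θ / speed g γ θ))

lemma hasDerivAt_curvaturePrimitive (h : IsClosedPair U g γ γ₀ s m α f)
    (hθ : θ ∈ Ioo 0 Real.pi) :
    HasDerivAt (curvaturePrimitive g γ f) (deriv (curvaturePrimitive g γ f) θ) θ := by
  have hr := h.slice.contDiffAt_radius hθ
  exact (((h.ref.smooth.contDiffAt).mul (hr.mul ((contDiffAt_deriv hr).div
    h.slice.contDiff_speed.contDiffAt (h.slice.speed_pos θ).ne'))).differentiableAt
      (by simp)).hasDerivAt

/-- The pointwise estimate behind `curvature_density_le`, with the derivatives as parameters: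
`f, f'` for the normal, `u, u'` for `r'/l`, and `W, W', S, S'` for the tilt. -/
lemma curvature_density_bound {f f' r r' l u u' W W' S S' x Λ : ℝ} (hΛ : 1 ≤ Λ) (hr : 0 < r)
    (hl : 0 < l) (hW : 0 < W) (hlΛ : l ≤ Λ) (hrΛ : r ≤ Λ * Real.pi) (hr' : |r'| ≤ Λ)
    (hu : |u| ≤ Λ ^ 2) (hu' : |u'| ≤ Λ) (hf : |f| ≤ 1) (hSW : |S| ≤ W) (hx : |x| ≤ 1)
    (hWW : W * W' = S * S') (hrS : r' * S + r * S' = l * r * W * x) :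
    r * l * (W / l * (f' * (u / W) - (u' * W - u * W') / W ^ 2 * f) + f / r)
      ≤ f' * (r * u) + f * (r' * u + r * u') + curvatureConst Λ := by
  have hπ := Real.pi_pos
  -- There is no bound of S' alone, but r S' is determined by the dilation equation and W W' = S S',
  -- which bounds r W'/W by known quantities.
  have hω : |r * W' / W| ≤ Λ ^ 2 * Real.pi + Λ := by
    have e : r * W' / W = (S / W) * (l * r * x - r' * (S / W)) := by
      field_simp
      linear_combination r * hWW + S * hrS
    have h1 : |S / W| ≤ 1 := by rw [abs_div, abs_of_pos hW, div_le_one hW]; exact hSW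
    have h2 : |l * r * x - r' * (S / W)| ≤ Λ ^ 2 * Real.pi + Λ := by
      refine (abs_sub _ _).trans ?_
      rw [abs_mul, abs_mul, abs_mul, abs_of_pos hl, abs_of_pos hr]
      have h3 : l * r * |x| ≤ Λ * (Λ * Real.pi) * 1 := by gcongr
      have h4 : |r'| * |S / W| ≤ Λ * 1 := by gcongr
      linarith
    rw [e, abs_mul]
    calc _ ≤ 1 * (Λ ^ 2 * Real.pi + Λ) := by gcongr
      _ = _ := one_mul _
  -- The density is rewritten as the derivative of f r u plus terms without f'. Four absolute bounds
  -- then give the summands of `curvatureConst`.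
  have key : r * l * (W / l * (f' * (u / W) - (u' * W - u * W') / W ^ 2 * f) + f / r)
      = f' * (r * u) + f * (r' * u + r * u') - f * r' * u
        - 2 * (f * r * u') + u * f * (r * W' / W) + l * f := by
    field_simp
    ring
  have a1 : |f * r' * u| ≤ 1 * Λ * Λ ^ 2 := by
    rw [abs_mul, abs_mul]; gcongr
  have a2 : |f * r * u'| ≤ 1 * (Λ * Real.pi) * Λ := by
    rw [abs_mul, abs_mul, abs_of_pos hr]; gcongr
  have a3 : |u * f * (r * W' / W)| ≤ Λ ^ 2 * 1 * (Λ ^ 2 * Real.pi + Λ) := by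
    rw [abs_mul, abs_mul]; gcongr
  have a4 : |l * f| ≤ Λ * 1 := by
    rw [abs_mul, abs_of_pos hl]; gcongr
  rw [key, curvatureConst]
  have b1 := (abs_le.1 a1).1
  have b2 := (abs_le.1 a2).1
  have b3 := (abs_le.1 a3).2
  have b4 := (abs_le.1 a4).2
  linarith

lemma curvature_density_le (h : IsClosedPair U g γ γ₀ s m α f)
    (B : ProfileBounds g γ s m α Λ d ε) (hθ : θ ∈ Ioo 0 Real.pi) (hx : |refDilation γ₀ θ| ≤ 1) :
    radius g γ θ * speed g γ θ * refCurvature γ₀ f θ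
      ≤ deriv (curvaturePrimitive g γ f) θ + curvatureConst Λ := by
  have hW := IsProfile.lorentzFactor_pos γ₀ θ
  have hs := h.slice.speed_pos θ
  have hr := h.slice.radius_pos hθ
  have hrs := h.slice.contDiffAt_radius hθ
  have hΛ := B.one_le
  have hrd : HasDerivAt (radius g γ) (deriv (radius g γ) θ) θ :=
    (hrs.differentiableAt (by simp)).hasDerivAt
  have hud : HasDerivAt (fun t => deriv (radius g γ) t / speed g γ t)
      (deriv (fun t => deriv (radius g γ) t / speed g γ t) θ) θ :=
    (((contDiffAt_deriv hrs).div h.slice.contDiff_speed.contDiffAt hs.ne').differentiableAt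
      (by simp)).hasDerivAt
  have hWd : HasDerivAt (lorentzFactor γ₀) (deriv (lorentzFactor γ₀) θ) θ :=
    (h.ref.profile.contDiff_lorentzFactor.differentiable (by simp) θ).hasDerivAt
  have hSd : HasDerivAt (tilt g γ γ₀) (deriv (tilt g γ γ₀) θ) θ :=
    (h.contDiff_tilt.differentiable (by simp) θ).hasDerivAt
  have hΦ : deriv (curvaturePrimitive g γ f) θ = _ :=
    ((h.hasDerivAt_f θ).fun_mul (hrd.fun_mul hud)).deriv
  have hc : deriv (refCos γ₀) θ = _ :=
    (funext h.refCos_eq : refCos γ₀ = _) ▸ (hud.fun_div hWd hW.ne').deriv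
  have hWW : lorentzFactor γ₀ θ * deriv (lorentzFactor γ₀) θ
      = tilt g γ γ₀ θ * deriv (tilt g γ γ₀) θ := by
    have e : (fun t => lorentzFactor γ₀ t ^ 2) = fun t => 1 + tilt g γ γ₀ t ^ 2 :=
      funext h.factor_sq
    have h1 := congrArg (fun q => deriv q θ) e
    simp only [(hWd.fun_pow 2).deriv, ((hSd.fun_pow 2).const_add 1).deriv] at h1
    simp at h1
    linarith
  have hrS := (hrd.fun_mul hSd).unique (h.hasDerivAt_radius_tilt hθ)
  have hu : |deriv (radius g γ) θ / speed g γ θ| ≤ Λ ^ 2 := by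
    rw [abs_div, abs_of_pos hs, div_le_iff₀ hs]
    nlinarith [abs_nonneg (deriv (radius g γ) θ), B.deriv_radius_le θ hθ, B.le_speed θ hθ]
  rw [hΦ, refCurvature, h.speed_eq, h.radius_eq, hc, h.refCos_eq]
  exact curvature_density_bound hΛ hr hs hW (B.speed_le θ hθ)
    ((B.radius_le θ hθ).trans (by gcongr; exact hθ.2.le)) (B.deriv_radius_le θ hθ) hu
    (B.deriv_ratio_le θ hθ) (h.abs_f_le hθ) (h.abs_tilt_le θ) hx hWW hrS

/-- The radius need not be differentiable at the poles, but the factor r makes the primitive vanish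
there, and the bound by Λ² r gives continuity. -/
lemma continuousOn_curvaturePrimitive (h : IsClosedPair U g γ γ₀ s m α f)
    (B : ProfileBounds g γ s m α Λ d ε) :
    ContinuousOn (curvaturePrimitive g γ f) (Icc 0 Real.pi) := by
  have hrc : Continuous (radius g γ) := h.slice.contDiff_orbitSq.continuous.sqrt
  have hb : ∀ x ∈ Icc 0 Real.pi, |curvaturePrimitive g γ f x| ≤ Λ ^ 2 * radius g γ x := by
    intro x hx
    by_cases hx' : x ∈ Ioo 0 Real.pi
    · have hs := h.slice.speed_pos x
      have hr := h.slice.radius_pos hx'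
      have hΛ := B.one_le
      have hu : |deriv (radius g γ) x / speed g γ x| ≤ Λ ^ 2 := by
        rw [abs_div, abs_of_pos hs, div_le_iff₀ hs]
        nlinarith [abs_nonneg (deriv (radius g γ) x), B.deriv_radius_le x hx', B.le_speed x hx']
      rw [curvaturePrimitive, abs_mul, abs_mul, abs_of_pos hr]
      calc _ ≤ 1 * (radius g γ x * Λ ^ 2) := by gcongr; exact h.abs_f_le hx'
        _ = _ := by ring
    · have : x = 0 ∨ x = Real.pi := by
        rcases hx.1.eq_or_lt with h1 | h1
        · exact Or.inl h1.symm
        · exact Or.inr (le_antisymm hx.2 (not_lt.1 fun h2 => hx' ⟨h1, h2⟩))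
      rcases this with rfl | rfl <;> simp [curvaturePrimitive, h.radius_zero, h.radius_pi]
  intro x hx
  by_cases hx' : x ∈ Ioo 0 Real.pi
  · exact (h.hasDerivAt_curvaturePrimitive hx').continuousAt.continuousWithinAt
  · have hr0 : radius g γ x = 0 := by
      rcases hx.1.eq_or_lt with h1 | h1
      · rw [← h1, h.radius_zero]
      · rw [le_antisymm hx.2 (not_lt.1 fun h2 => hx' ⟨h1, h2⟩), h.radius_pi]
    have h0 : curvaturePrimitive g γ f x = 0 := by simp [curvaturePrimitive, hr0]
    rw [ContinuousWithinAt, h0]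
    refine squeeze_zero_norm' (a := fun y => Λ ^ 2 * radius g γ y) ?_ ?_
    · filter_upwards [self_mem_nhdsWithin] with y hy using hb y hy
    · have := ((hrc.const_mul (Λ ^ 2)).tendsto x).mono_left (nhdsWithin_le_nhds (s := Icc 0 Real.pi))
      simpa [hr0] using this

lemma continuousOn_curvature_density (h : IsClosedPair U g γ γ₀ s m α f) :
    ContinuousOn (refCurvature γ₀ f) (Ioo 0 Real.pi) := fun _ hx =>
  (h.ref.profile.contDiffAt_refCurvature hx h.ref.smooth.contDiffAt).continuousAt.continuousWithinAt

/-- The total mean curvature of the projection is bounded. -/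
lemma integral_curvature_le (h : IsClosedPair U g γ γ₀ s m α f)
    (B : ProfileBounds g γ s m α Λ d ε) (hx : ∀ θ ∈ Ioo 0 Real.pi, |refDilation γ₀ θ| ≤ 1) :
    IntegrableOn (fun θ => radius g γ θ * speed g γ θ * refCurvature γ₀ f θ) (Ioo 0 Real.pi) ∧
    ∫ θ in Ioo 0 Real.pi, radius g γ θ * speed g γ θ * refCurvature γ₀ f θ
      ≤ curvatureConst Λ * Real.pi := by
  have hπ := Real.pi_pos
  have hrc : Continuous (radius g γ) := h.slice.contDiff_orbitSq.continuous.sqrt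
  have hlc : Continuous (speed g γ) := h.slice.contDiff_speed.continuous
  have hder : ∀ x ∈ Ioo 0 Real.pi,
      HasDerivAt (fun t => curvaturePrimitive g γ f t + curvatureConst Λ * t)
        (deriv (curvaturePrimitive g γ f) x + curvatureConst Λ) x := fun x hx' => by
    simpa using (h.hasDerivAt_curvaturePrimitive hx').fun_add
      ((hasDerivAt_id x).const_mul (curvatureConst Λ))
  have hcont : ContinuousOn (fun t => curvaturePrimitive g γ f t + curvatureConst Λ * t)
      (Icc 0 Real.pi) := (h.continuousOn_curvaturePrimitive B).add (by fun_prop)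
  have hpos : ∀ x ∈ Ioo 0 Real.pi, 0 ≤ radius g γ x * speed g γ x * refCurvature γ₀ f x :=
    fun x hx' => (mul_pos (mul_pos (h.slice.radius_pos hx') (h.slice.speed_pos x))
      (h.ref.curvature_pos x hx')).le
  have hle := fun x hx' => h.curvature_density_le B hx' (hx x hx')
  -- Positivity of k makes the majorant nonnegative; a nonnegative derivative of a continuous
  -- function is integrable, without any bound of f'.
  have hint := intervalIntegral.integrableOn_deriv_of_nonneg hcont hder
    fun x hx' => (hpos x hx').trans (hle x hx')
  have hint' := hint.mono_set (Ioo_subset_Ioc_self)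
  have hI : IntegrableOn (fun θ => radius g γ θ * speed g γ θ * refCurvature γ₀ f θ)
      (Ioo 0 Real.pi) := by
    refine Integrable.mono' hint' (ContinuousOn.aestronglyMeasurable
      ((hrc.mul hlc).continuousOn.mul h.continuousOn_curvature_density) measurableSet_Ioo) ?_
    filter_upwards [ae_restrict_mem measurableSet_Ioo] with x hx'
    rw [Real.norm_of_nonneg (hpos x hx')]
    exact hle x hx'
  refine ⟨hI, (setIntegral_mono_on hI hint' measurableSet_Ioo hle).trans ?_⟩
  rw [← integral_Ioc_eq_integral_Ioo, ← intervalIntegral.integral_of_le hπ.le,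
    intervalIntegral.integral_eq_sub_of_hasDerivAt_of_le hπ.le hcont hder
      ((intervalIntegrable_iff_integrableOn_Ioc_of_le hπ.le).2 hint)]
  simp [curvaturePrimitive, h.radius_zero, h.radius_pi]

/-- The mass differs little from the integral of `|H₀|`. -/
lemma abs_mass_sub_le (h : IsClosedPair U g γ γ₀ s m α f)
    (B : ProfileBounds g γ s m α Λ d ε) {K T : ℝ} (hK : K ≤ 1)
    (hx : ∀ θ ∈ Ioo 0 Real.pi, |refDilation γ₀ θ| ≤ K)
    (hT : ∀ θ ∈ Ioo 0 Real.pi, |tilt g γ γ₀ θ| ≤ T) :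
    |(1 / (8 * Real.pi)) * (∫ y in polarCell,
        massDensity g (spin γ) (spin γ₀) y * areaDensity g (spin γ) y)
      - (1 / (8 * Real.pi)) * (∫ y in polarCell,
        meanCurvNorm flat (spin γ₀) y * areaDensity g (spin γ) y)|
      ≤ T * (curvatureConst Λ * Real.pi) + (ε + 2 * K) * (Λ ^ 2 * Real.pi * Real.pi) := by
  have hπ := Real.pi_pos
  have hrc : Continuous (radius g γ) := h.slice.contDiff_orbitSq.continuous.sqrt
  have hlc : Continuous (speed g γ) := h.slice.contDiff_speed.continuous
  have hΛ := B.one_le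
  set ρ : ℝ → ℝ := fun θ => (refCurvature γ₀ f θ - √(s * m θ + refDilation γ₀ θ ^ 2))
    / lorentzFactor γ₀ θ with hρ
  set k₀ : ℝ → ℝ := fun θ => √(refCurvature γ₀ f θ ^ 2 - refDilation γ₀ θ ^ 2) with hk₀
  set w : ℝ → ℝ := fun θ => radius g γ θ * speed g γ θ with hw
  have hcell : ∀ (q : R2 → ℝ) (p : ℝ → ℝ), (∀ y ∈ polarDomain, q y = p (y 0)) →
      ∫ y in polarCell, q y * areaDensity g (spin γ) y
        = 2 * Real.pi * ∫ θ in Ioo 0 Real.pi, p θ * w θ := by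
    intro q p hq
    rw [← setIntegral_polarCell]
    have hmeas : MeasurableSet polarCell := by
      have : polarCell = (fun y : R2 => y 0) ⁻¹' Ioo 0 Real.pi ∩
          (fun y : R2 => y 1) ⁻¹' Ioo 0 (2 * Real.pi) := by
        ext y; simp [polarCell, and_assoc]
      rw [this]
      exact (measurableSet_Ioo.preimage (measurable_pi_apply 0)).inter
        (measurableSet_Ioo.preimage (measurable_pi_apply 1))
    refine setIntegral_congr_fun hmeas fun y hy => ?_
    simp only [hq y ⟨hy.1, hy.2.1⟩, h.slice.areaDensity_spin, hw]
    ring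
  rw [hcell _ ρ fun y hy => h.massDensity_eq hy,
    hcell _ k₀ fun y hy => by rw [meanCurvNorm, h.ref.meanCurvSq_eq y hy]]
  obtain ⟨hI, hIle⟩ := h.integral_curvature_le B fun θ hθ => (hx θ hθ).trans hK
  have hp : (Real.pi / 2) ∈ Ioo 0 Real.pi := ⟨by linarith, by linarith⟩
  have hK0 : 0 ≤ K := (abs_nonneg _).trans (hx _ hp)
  have hT0 : 0 ≤ T := (abs_nonneg _).trans (hT _ hp)
  have hε0 : 0 ≤ ε := (Real.sqrt_nonneg _).trans (B.norm_le _ hp)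
  have hW : ∀ θ, 1 ≤ lorentzFactor γ₀ θ := fun θ => IsProfile.one_le_lorentzFactor γ₀ θ
  have hX : ∀ θ ∈ Ioo 0 Real.pi, √(s * m θ + refDilation γ₀ θ ^ 2) ≤ ε + K := by
    intro θ hθ
    refine le_trans (Real.sqrt_le_iff.2 ⟨by positivity, ?_⟩)
      (add_le_add (B.norm_le θ hθ) (hx θ hθ))
    have h1 := Real.sq_sqrt (h.norm_sq_pos hθ).le
    have h2 := mul_nonneg (Real.sqrt_nonneg (s * m θ)) (abs_nonneg (refDilation γ₀ θ))
    nlinarith [sq_abs (refDilation γ₀ θ)]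
  have hwpos : ∀ θ ∈ Ioo 0 Real.pi, 0 < w θ := fun θ hθ =>
    mul_pos (h.slice.radius_pos hθ) (h.slice.speed_pos θ)
  have hwle : ∀ θ ∈ Ioo 0 Real.pi, w θ ≤ Λ ^ 2 * Real.pi := by
    intro θ hθ
    have h1 : radius g γ θ ≤ Λ * Real.pi := (B.radius_le θ hθ).trans (by gcongr; exact hθ.2.le)
    have h2 := B.speed_le θ hθ
    have h3 := h.slice.speed_pos θ
    calc w θ ≤ (Λ * Real.pi) * Λ := by simp only [hw]; gcongr
      _ = _ := by ring
  have hk₀le : ∀ θ ∈ Ioo 0 Real.pi, k₀ θ ≤ refCurvature γ₀ f θ := fun θ hθ => by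
    rw [hk₀, Real.sqrt_le_left (h.ref.curvature_pos θ hθ).le]
    linarith [sq_nonneg (refDilation γ₀ θ)]
  -- k − |x| ≤ √(k² − x²), since |x| < k.
  have hk₀ge : ∀ θ ∈ Ioo 0 Real.pi, refCurvature γ₀ f θ - K ≤ k₀ θ := fun θ hθ => by
    have h1 := h.ref.spacelike θ hθ
    have h2 := h.ref.curvature_pos θ hθ
    have h3 : |refDilation γ₀ θ| < refCurvature γ₀ f θ := abs_lt_of_sq_lt_sq (by linarith) h2.le
    have h4 : refCurvature γ₀ f θ - |refDilation γ₀ θ| ≤ k₀ θ := by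
      refine Real.le_sqrt_of_sq_le ?_
      nlinarith [sq_abs (refDilation γ₀ θ), abs_nonneg (refDilation γ₀ θ)]
    linarith [hx θ hθ]
  -- Replacing k/W by k costs at most T k, because W − 1 ≤ T; the term √(s m + x²)/W is at most ε +
  -- K, and replacing k by |H₀| costs K. The first error is controlled only after integration.
  have hdiff : ∀ θ ∈ Ioo 0 Real.pi,
      |ρ θ - k₀ θ| ≤ T * refCurvature γ₀ f θ + (ε + 2 * K) := by
    intro θ hθ
    have h1 := hW θ
    have h2 := h.ref.curvature_pos θ hθ
    have h3 := hX θ hθ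
    have h4 : 0 ≤ √(s * m θ + refDilation γ₀ θ ^ 2) := Real.sqrt_nonneg _
    have h5 : lorentzFactor γ₀ θ - 1 ≤ T := by linarith [h.factor_le θ, hT θ hθ]
    have h6 : refCurvature γ₀ f θ / lorentzFactor γ₀ θ ≤ refCurvature γ₀ f θ :=
      div_le_self h2.le h1
    have h7 : (1 - T) * refCurvature γ₀ f θ ≤ refCurvature γ₀ f θ / lorentzFactor γ₀ θ := by
      rw [le_div_iff₀ (by linarith)]
      have : (1 - T) * lorentzFactor γ₀ θ ≤ 1 := by nlinarith
      nlinarith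
    have h8 : √(s * m θ + refDilation γ₀ θ ^ 2) / lorentzFactor γ₀ θ ≤ ε + K :=
      (div_le_self h4 h1).trans h3
    have h9 : 0 ≤ √(s * m θ + refDilation γ₀ θ ^ 2) / lorentzFactor γ₀ θ := by positivity
    have h10 : ρ θ = refCurvature γ₀ f θ / lorentzFactor γ₀ θ
        - √(s * m θ + refDilation γ₀ θ ^ 2) / lorentzFactor γ₀ θ := sub_div _ _ _
    have h11 := hk₀le θ hθ
    have h12 := hk₀ge θ hθ
    have h13 : 0 ≤ T * refCurvature γ₀ f θ := by positivity
    rw [abs_le, h10]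
    constructor <;> nlinarith
  have hIdiff : IntegrableOn (fun θ => T * (radius g γ θ * speed g γ θ * refCurvature γ₀ f θ)
      + (ε + 2 * K) * (Λ ^ 2 * Real.pi)) (Ioo 0 Real.pi) :=
    (hI.const_mul T).add (integrableOn_const (by simp) enorm_ne_top)
  have hdens : ∀ θ ∈ Ioo 0 Real.pi, |ρ θ * w θ - k₀ θ * w θ| ≤
      T * (radius g γ θ * speed g γ θ * refCurvature γ₀ f θ)
      + (ε + 2 * K) * (Λ ^ 2 * Real.pi) := by
    intro θ hθ
    rw [← sub_mul, abs_mul, abs_of_pos (hwpos θ hθ)]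
    calc _ ≤ (T * refCurvature γ₀ f θ + (ε + 2 * K)) * w θ := by
          have := (hwpos θ hθ).le
          gcongr; exact hdiff θ hθ
      _ = T * (radius g γ θ * speed g γ θ * refCurvature γ₀ f θ) + (ε + 2 * K) * w θ := by
          simp only [hw]; ring
      _ ≤ _ := by gcongr; exact hwle θ hθ
  have hxc : ContinuousOn (refDilation γ₀) (Ioo 0 Real.pi) := fun θ hθ =>
    (h.ref.profile.contDiffAt_refDilation hθ).continuousAt.continuousWithinAt
  have hmc : ContinuousOn m (Ioo 0 Real.pi) := fun θ hθ =>
    (h.data.m_smooth θ hθ).continuousAt.continuousWithinAt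
  have hkc := h.continuousOn_curvature_density
  have hwc : ContinuousOn w (Ioo 0 Real.pi) := (hrc.mul hlc).continuousOn
  have hIk₀ : IntegrableOn (fun θ => k₀ θ * w θ) (Ioo 0 Real.pi) := by
    refine Integrable.mono' hI (ContinuousOn.aestronglyMeasurable
      ((((hkc.pow 2).sub (hxc.pow 2)).sqrt).mul hwc) measurableSet_Ioo) ?_
    filter_upwards [ae_restrict_mem measurableSet_Ioo] with θ hθ
    have h1 : 0 ≤ k₀ θ := Real.sqrt_nonneg _
    have h2 := (hwpos θ hθ).le
    rw [Real.norm_of_nonneg (by positivity), mul_comm]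
    exact mul_le_mul_of_nonneg_left (hk₀le θ hθ) h2
  have hIsub : IntegrableOn (fun θ => ρ θ * w θ - k₀ θ * w θ) (Ioo 0 Real.pi) := by
    refine Integrable.mono' hIdiff (ContinuousOn.aestronglyMeasurable
      ((((hkc.sub ((continuousOn_const.mul hmc).add (hxc.pow 2)).sqrt).div
        h.ref.profile.contDiff_lorentzFactor.continuous.continuousOn
        fun θ _ => (IsProfile.lorentzFactor_pos γ₀ θ).ne').mul hwc).sub
        ((((hkc.pow 2).sub (hxc.pow 2)).sqrt).mul hwc)) measurableSet_Ioo) ?_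
    filter_upwards [ae_restrict_mem measurableSet_Ioo] with θ hθ using hdens θ hθ
  have hIρ : IntegrableOn (fun θ => ρ θ * w θ) (Ioo 0 Real.pi) := by
    have := hIsub.add hIk₀
    simpa [Pi.add_def] using this
  rw [← mul_sub, ← mul_sub, ← integral_sub hIρ hIk₀, ← mul_assoc,
    show 1 / (8 * Real.pi) * (2 * Real.pi) = 1 / 4 by field_simp; norm_num, abs_mul]
  have hnorm : |∫ θ in Ioo 0 Real.pi, (ρ θ * w θ - k₀ θ * w θ)| ≤
      T * (curvatureConst Λ * Real.pi) + (ε + 2 * K) * (Λ ^ 2 * Real.pi * Real.pi) := by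
    refine (abs_integral_le_integral_abs).trans ((setIntegral_mono_on hIsub.abs hIdiff
      measurableSet_Ioo hdens).trans ?_)
    rw [integral_add (hI.const_mul T) (integrableOn_const (by simp) enorm_ne_top), integral_const_mul]
    have h1 := mul_le_mul_of_nonneg_left hIle hT0
    have h2 : ∫ _ in Ioo 0 Real.pi, (ε + 2 * K) * (Λ ^ 2 * Real.pi)
        = (ε + 2 * K) * (Λ ^ 2 * Real.pi * Real.pi) := by
      simp [Measure.real, hπ.le]; ring
    rw [h2]
    linarith
  have : (0:ℝ) ≤ |∫ θ in Ioo 0 Real.pi, (ρ θ * w θ - k₀ θ * w θ)| := abs_nonneg _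
  rw [abs_of_pos (by norm_num : (0:ℝ) < 1 / 4)]
  linarith

end IsClosedPair

end
end WangYau

namespace WangYau
noncomputable section

/-! ### Vanishing of the current -/

/-- A bounded function has no logarithmic singularity. -/
lemma nonpos_of_log_singularity {η β κ : ℝ → ℝ} {b c C M N : ℝ} (hb : 0 < b) (hc : 0 < c)
    (hη : ∀ x ∈ Ioo 0 b, HasDerivAt η (β x - C * κ x) x) (hβ : ∀ x ∈ Ioo 0 b, |β x| ≤ M)
    (hκ : ∀ x ∈ Ioo 0 b, c ≤ κ x * x) (hN : ∀ x ∈ Ioo 0 b, |η x| ≤ N) : C ≤ 0 := by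
  by_contra hC
  push Not at hC
  have hder : ∀ x ∈ Ioo 0 b, HasDerivAt (fun x => η x + C * c * Real.log x - M * x)
      (β x - C * κ x + C * c * x⁻¹ - M) x := by
    intro x hx
    simpa using ((hη x hx).fun_add ((Real.hasDerivAt_log hx.1.ne').const_mul (C * c))).fun_sub
      ((hasDerivAt_id x).const_mul M)
  -- Since κ ≥ c/x, adding C c log x − M x gives a nonincreasing function. Going towards 0 this
  -- keeps log x bounded below, a contradiction.
  have hanti : AntitoneOn (fun x => η x + C * c * Real.log x - M * x) (Ioo 0 b) := by
    refine antitoneOn_of_deriv_nonpos (convex_Ioo 0 b)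
      (fun x hx => (hder x hx).continuousAt.continuousWithinAt)
      (fun x hx => ((hder x (interior_subset hx)).differentiableAt).differentiableWithinAt) ?_
    intro x hx
    have hx := interior_subset hx
    rw [(hder x hx).deriv]
    have h1 : c * x⁻¹ ≤ κ x := by rw [← div_eq_mul_inv, div_le_iff₀ hx.1]; exact hκ x hx
    have h2 := (abs_le.1 (hβ x hx)).2
    nlinarith
  have hx₀ : b / 2 ∈ Ioo 0 b := ⟨by linarith, by linarith⟩
  set A := η (b / 2) + C * c * Real.log (b / 2) - M * (b / 2) with hA
  have hM : 0 ≤ M := (abs_nonneg _).trans (hβ _ hx₀)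
  have hlow : ∀ x ∈ Ioo 0 (b / 2), (A - N) / (C * c) ≤ Real.log x := by
    intro x hx
    have hx' : x ∈ Ioo 0 b := ⟨hx.1, hx.2.trans hx₀.2⟩
    have h1 := hanti hx' hx₀ hx.2.le
    have h2 := (abs_le.1 (hN x hx')).2
    have h3 : 0 ≤ M * x := mul_nonneg hM hx.1.le
    rw [div_le_iff₀ (by positivity)]
    simp only at h1
    linarith
  have hev := Real.tendsto_log_nhdsGT_zero.eventually_lt_atBot ((A - N) / (C * c))
  obtain ⟨x, h1, h2⟩ := (hev.and (Ioo_mem_nhdsGT hx₀.1)).exists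
  linarith [hlow x h2]

lemma eq_zero_of_log_singularity {η β κ : ℝ → ℝ} {b c C M N : ℝ} (hb : 0 < b) (hc : 0 < c)
    (hη : ∀ x ∈ Ioo 0 b, HasDerivAt η (β x - C * κ x) x) (hβ : ∀ x ∈ Ioo 0 b, |β x| ≤ M)
    (hκ : ∀ x ∈ Ioo 0 b, c ≤ κ x * x) (hN : ∀ x ∈ Ioo 0 b, |η x| ≤ N) : C = 0 := by
  refine le_antisymm (nonpos_of_log_singularity hb hc hη hβ hκ hN) ?_
  have := nonpos_of_log_singularity (η := fun x => -η x) (β := fun x => -β x) (C := -C) hb hc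
    (fun x hx => (hη x hx).fun_neg.congr_deriv (by ring)) (fun x hx => by rw [abs_neg]; exact hβ x hx)
    hκ (fun x hx => by rw [abs_neg]; exact hN x hx)
  linarith

namespace IsClosedPair

variable {U : Set R4} {g : R4 → Form} {γ γ₀ : ℝ → R4} {s : ℝ} {m α f : ℝ → ℝ} {Λ d ε θ : ℝ}

/-- The current of a solution of the optimal embedding equation vanishes. -/
theorem profileFlux_eq_zero (h : IsClosedPair U g γ γ₀ s m α f)
    (B : ProfileBounds g γ s m α Λ d ε) (h0 : tilt g γ γ₀ 0 = 0) {C : ℝ}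
    (hC : ∀ θ ∈ Ioo 0 Real.pi, radius g γ θ / speed g γ θ * profileFlux g γ γ₀ s m α f θ = C)
    (hθ : θ ∈ Ioo 0 Real.pi) : profileFlux g γ γ₀ s m α f θ = 0 := by
  have hπ := Real.pi_pos
  have hΛ : 0 < Λ := by linarith [B.one_le]
  have hs := h.s_pos
  have hsub : ∀ x ∈ Ioo 0 (Real.pi / 2), x ∈ Ioo 0 Real.pi := fun x hx =>
    ⟨hx.1, by linarith [hx.2]⟩
  -- the tilt vanishes to first order at the pole
  have hSdiff : Differentiable ℝ (tilt g γ γ₀) := h.contDiff_tilt.differentiable (by simp)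
  have hScont : Continuous (deriv (tilt g γ γ₀)) :=
    h.contDiff_tilt.continuous_deriv (by simp)
  obtain ⟨M, hM⟩ := isCompact_Icc.exists_bound_of_continuousOn
    (hScont.continuousOn (s := Icc 0 Real.pi))
  have hM0 : 0 ≤ M := (norm_nonneg _).trans (hM 0 ⟨le_rfl, hπ.le⟩)
  have hS : ∀ x ∈ Ioo 0 Real.pi, |tilt g γ γ₀ x| ≤ M * x := by
    intro x hx
    have := (convex_Icc 0 Real.pi).norm_image_sub_le_of_norm_deriv_le
      (fun y _ => hSdiff y) hM ⟨le_rfl, hπ.le⟩ ⟨hx.1.le, hx.2.le⟩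
    simpa [h0, abs_of_pos hx.1] using this
  have hrlow : ∀ x ∈ Ioo 0 (Real.pi / 2), x ≤ Λ * radius g γ x := by
    intro x hx
    have h1 := B.le_radius x (hsub x hx)
    have h2 : 1 ≤ Real.pi - x := by linarith [hx.2, Real.pi_gt_three]
    nlinarith [hx.1]
  have hSr : ∀ x ∈ Ioo 0 (Real.pi / 2), |tilt g γ γ₀ x| ≤ M * Λ * radius g γ x := by
    intro x hx
    calc _ ≤ M * x := hS x (hsub x hx)
      _ ≤ M * (Λ * radius g γ x) := by gcongr; exact hrlow x hx
      _ = _ := by ring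
  -- bound of the dilation
  have hx : ∀ x ∈ Ioo 0 (Real.pi / 2), |refDilation γ₀ x| ≤ Λ * (M * Λ * Λ + M) := by
    intro x hx
    have hx' := hsub x hx
    have hr := h.slice.radius_pos hx'
    have hl := h.slice.speed_pos x
    have hW := IsProfile.lorentzFactor_pos γ₀ x
    have hW1 := IsProfile.one_le_lorentzFactor γ₀ x
    have hrd : HasDerivAt (radius g γ) (deriv (radius g γ) x) x :=
      ((h.slice.contDiffAt_radius hx').differentiableAt (by simp)).hasDerivAt
    have e := (hrd.fun_mul (hSdiff x).hasDerivAt).unique (h.hasDerivAt_radius_tilt hx')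
    have h1 : |deriv (radius g γ) x * tilt g γ γ₀ x + radius g γ x * deriv (tilt g γ γ₀) x|
        ≤ radius g γ x * (M * Λ * Λ + M) := by
      refine (abs_add_le _ _).trans ?_
      rw [abs_mul, abs_mul, abs_of_pos hr]
      have h2 : |deriv (radius g γ) x| * |tilt g γ γ₀ x| ≤ Λ * (M * Λ * radius g γ x) := by
        have := B.deriv_radius_le x hx'
        have := hSr x hx
        gcongr
      have h3 : radius g γ x * |deriv (tilt g γ γ₀) x| ≤ radius g γ x * M := by
        have := hM x ⟨hx'.1.le, hx'.2.le⟩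
        rw [Real.norm_eq_abs] at this
        gcongr
      linarith
    rw [e, abs_mul, abs_mul, abs_mul, abs_of_pos hl, abs_of_pos hr, abs_of_pos hW] at h1
    have h4 : speed g γ x * |refDilation γ₀ x| ≤ M * Λ * Λ + M := by
      refine le_of_mul_le_mul_left (le_trans ?_ h1) hr
      have : 0 ≤ radius g γ x * (speed g γ x * |refDilation γ₀ x|) := by positivity
      nlinarith
    calc |refDilation γ₀ x| ≤ Λ * speed g γ x * |refDilation γ₀ x| :=
          le_mul_of_one_le_left (abs_nonneg _) (B.le_speed x hx')
      _ = Λ * (speed g γ x * |refDilation γ₀ x|) := by ring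
      _ ≤ _ := by gcongr
  set K := Λ * (M * Λ * Λ + M) with hK
  have hK0 : 0 ≤ K := by positivity
  obtain ⟨c, hc⟩ := B.slipAngle_le
  -- positive lower bound of the length of the mean curvature vector
  set m₀ := Real.exp (Real.log s - 2 * (|c| + Λ)) with hm₀
  have hm : ∀ x ∈ Ioo 0 Real.pi, m₀ ≤ m x := by
    intro x hx
    have h1 := hc x hx
    rw [slipAngle_eq hs (h.data.m_pos x hx)] at h1
    rw [hm₀, ← Real.le_log_iff_exp_le (h.data.m_pos x hx)]
    linarith [(abs_le.1 h1).2, le_abs_self c]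
  have hm₀0 : 0 < √(s * m₀) := Real.sqrt_pos.2 (mul_pos hs (Real.exp_pos _))
  have hy : ∀ x ∈ Ioo 0 (Real.pi / 2), |refAngle γ₀ s m x| ≤ Real.arsinh (K / √(s * m₀)) := by
    intro x hx'
    have h1 := hx x hx'
    have h2 : √(s * m₀) ≤ √(s * m x) := by
      apply Real.sqrt_le_sqrt; gcongr; exact hm x (hsub x hx')
    have h3 : |refDilation γ₀ x / √(s * m x)| ≤ K / √(s * m₀) := by
      rw [abs_div, abs_of_nonneg (Real.sqrt_nonneg _)]
      gcongr
    rw [refAngle, abs_le]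
    rw [abs_le] at h3
    rw [← Real.arsinh_neg, Real.arsinh_le_arsinh, Real.arsinh_le_arsinh]
    exact h3
  have hε0 : 0 ≤ ε := (Real.sqrt_nonneg _).trans (B.norm_le θ hθ)
  have hX : ∀ x ∈ Ioo 0 (Real.pi / 2), √(s * m x + refDilation γ₀ x ^ 2) ≤ ε + K := by
    intro x hx'
    refine Real.sqrt_le_iff.2 ⟨by positivity, ?_⟩
    have h1 := Real.sq_sqrt (h.norm_sq_pos (hsub x hx')).le
    have h2 := B.norm_le x (hsub x hx')
    have h3 : s * m x ≤ ε ^ 2 := by nlinarith [Real.sqrt_nonneg (s * m x)]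
    have h4 : refDilation γ₀ x ^ 2 ≤ K ^ 2 := sq_le_sq' (by linarith [(abs_le.1 (hx x hx')).1])
      (abs_le.1 (hx x hx')).2
    nlinarith [mul_nonneg hε0 hK0]
  -- The relation j = C l/r is solved for the derivative of the angle, and l/r ≥ 1/(Λ²x) is the
  -- nonintegrable coefficient. The bounds used here need only be finite for this one surface, not
  -- uniform in s.
  have hC0 : C = 0 := by
    refine eq_zero_of_log_singularity (b := Real.pi / 2) (c := 1 / Λ ^ 2)
      (η := fun t => refAngle γ₀ s m t - slipAngle s (m t))
      (β := fun x => deriv γ₀ x 0 / lorentzFactor γ₀ x *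
          (f x / radius g γ x - √(s * m x + refDilation γ₀ x ^ 2)) + α x)
      (κ := fun x => speed g γ x / radius g γ x)
      (M := Λ * (M * Λ) + Λ * (ε + K) + Λ)
      (N := Real.arsinh (K / √(s * m₀)) + (Λ + |c|)) (by linarith) (by positivity) ?_ ?_ ?_ ?_
    · intro x hx'
      have hx' := hsub x hx'
      have h1 := (((h.contDiffAt_refAngle hx').sub (h.contDiffAt_slipAngle hx')).differentiableAt
        (by simp)).hasDerivAt
      refine h1.congr_deriv ?_
      have h2 := hC x hx'
      have hr := (h.slice.radius_pos hx').ne'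
      have hl := (h.slice.speed_pos x).ne'
      have h3 : profileFlux g γ γ₀ s m α f x = C * (speed g γ x / radius g γ x) := by
        rw [← h2]; field_simp
      rw [profileFlux] at h3
      have h4 : deriv (refAngle γ₀ s m - fun t => slipAngle s (m t)) x
        = deriv (fun t => refAngle γ₀ s m t - slipAngle s (m t)) x := rfl
      linarith
    · intro x hx'
      have hx'' := hsub x hx'
      have hr := h.slice.radius_pos hx''
      have hl := h.slice.speed_pos x
      have hW := IsProfile.lorentzFactor_pos γ₀ x
      have hW1 := IsProfile.one_le_lorentzFactor γ₀ x
      have e : deriv γ₀ x 0 / lorentzFactor γ₀ x *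
          (f x / radius g γ x - √(s * m x + refDilation γ₀ x ^ 2)) + α x
        = speed g γ x * ((tilt g γ γ₀ x / radius g γ x) * (f x / lorentzFactor γ₀ x))
          - speed g γ x * ((tilt g γ γ₀ x / lorentzFactor γ₀ x) *
            √(s * m x + refDilation γ₀ x ^ 2)) + α x := by
        rw [tilt]; field_simp
      rw [e]
      have h1 : |tilt g γ γ₀ x / radius g γ x| ≤ M * Λ := by
        rw [abs_div, abs_of_pos hr, div_le_iff₀ hr]; exact hSr x hx'
      have h2 : |f x / lorentzFactor γ₀ x| ≤ 1 := by
        rw [abs_div, abs_of_pos hW, div_le_one hW]; exact (h.abs_f_le hx'').trans hW1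
      have h3 : |tilt g γ γ₀ x / lorentzFactor γ₀ x| ≤ 1 := by
        rw [abs_div, abs_of_pos hW, div_le_one hW]; exact h.abs_tilt_le x
      have h4 := hX x hx'
      have h5 := B.speed_le x hx''
      have a1 : |speed g γ x * ((tilt g γ γ₀ x / radius g γ x) * (f x / lorentzFactor γ₀ x))|
          ≤ Λ * (M * Λ * 1) := by
        rw [abs_mul, abs_mul, abs_of_pos hl]; gcongr
      have a2 : |speed g γ x * ((tilt g γ γ₀ x / lorentzFactor γ₀ x) *
            √(s * m x + refDilation γ₀ x ^ 2))| ≤ Λ * (1 * (ε + K)) := by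
        rw [abs_mul, abs_mul, abs_of_pos hl, abs_of_nonneg (Real.sqrt_nonneg _)]; gcongr
      have a3 := B.connection_le x hx''
      refine (abs_add_le _ _).trans (add_le_add ((abs_sub _ _).trans ?_) a3)
      linarith
    · intro x hx'
      have hx'' := hsub x hx'
      have hr := h.slice.radius_pos hx''
      rw [div_mul_eq_mul_div, div_le_div_iff₀ (by positivity) hr]
      have h1 := B.radius_le x hx''
      have h2 := B.le_speed x hx''
      calc 1 * radius g γ x ≤ Λ * x * 1 := by linarith
        _ ≤ Λ * x * (Λ * speed g γ x) := by
          have := hx'.1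
          gcongr
        _ = _ := by ring
    · intro x hx'
      refine (abs_sub _ _).trans (add_le_add (hy x hx') ?_)
      have := hc x (hsub x hx')
      calc |slipAngle s (m x)| = |(slipAngle s (m x) - c) + c| := by ring_nf
        _ ≤ _ := (abs_add_le _ _).trans (by gcongr)
  have h1 := hC θ hθ
  rw [hC0] at h1
  exact (mul_eq_zero.1 h1).resolve_left
    (div_pos (h.slice.radius_pos hθ) (h.slice.speed_pos θ)).ne'

end IsClosedPair

end
end WangYau

namespace WangYau
noncomputable section

/-! ### Families of functions on an interval -/

section Families

variable {ι : Type*} {l : Filter ι}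

/-- A local property of a family of functions holds uniformly on the compact interval. -/
lemma eventually_forall_Ioo {P : ι → ℝ → Prop} {a b : ℝ}
    (h : ∀ x ∈ Icc a b, ∀ᶠ z in l ×ˢ 𝓝[Ioo a b] x, P z.1 z.2) :
    ∀ᶠ s in l, ∀ θ ∈ Ioo a b, P s θ := by
  have key : ∀ᶠ s in l, ∀ θ ∈ Icc a b, θ ∈ Ioo a b → P s θ := by
    refine isCompact_Icc.induction_on (p := fun K => ∀ᶠ s in l, ∀ θ ∈ K, θ ∈ Ioo a b → P s θ)
      (by simp) (fun s t hst ht => ht.mono fun x hx θ hθ => hx θ (hst hθ))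
      (fun s t hs ht => (hs.and ht).mono fun x hx θ hθ => hθ.elim (hx.1 θ) (hx.2 θ)) ?_
    intro x hx
    obtain ⟨pa, ha, pb, hb, hab⟩ := eventually_prod_iff.1 (h x hx)
    rw [eventually_nhdsWithin_iff] at hb
    exact ⟨_, mem_nhdsWithin_of_mem_nhds hb, ha.mono fun s hs θ hθ hθ' => hab hs (hθ hθ')⟩
  exact key.mono fun s hs θ hθ => hs θ (Ioo_subset_Icc_self hθ) hθ

/-- A locally bounded family of functions is uniformly bounded on the compact interval. -/
lemma exists_eventually_abs_le {q : ι → ℝ → ℝ} {a b : ℝ}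
    (h : ∀ x ∈ Icc a b, ∃ L, Tendsto (fun z : ι × ℝ => q z.1 z.2) (l ×ˢ 𝓝[Ioo a b] x) (𝓝 L)) :
    ∃ Λ, ∀ᶠ s in l, ∀ θ ∈ Ioo a b, |q s θ| ≤ Λ := by
  have key : ∃ Λ, ∀ᶠ s in l, ∀ θ ∈ Icc a b, θ ∈ Ioo a b → |q s θ| ≤ Λ := by
    refine isCompact_Icc.induction_on
      (p := fun K => ∃ Λ, ∀ᶠ s in l, ∀ θ ∈ K, θ ∈ Ioo a b → |q s θ| ≤ Λ)
      ⟨0, by simp⟩ (fun s t hst ⟨Λ, ht⟩ => ⟨Λ, ht.mono fun x hx θ hθ => hx θ (hst hθ)⟩)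
      (fun s t ⟨Λ, hs⟩ ⟨Λ', ht⟩ => ⟨max Λ Λ', (hs.and ht).mono fun x hx θ hθ h' =>
        hθ.elim (fun h1 => (hx.1 θ h1 h').trans (le_max_left _ _))
          fun h1 => (hx.2 θ h1 h').trans (le_max_right _ _)⟩) ?_
    intro x hx
    obtain ⟨L, hL⟩ := h x hx
    have hev : ∀ᶠ z in l ×ˢ 𝓝[Ioo a b] x, |q z.1 z.2| ≤ |L| + 1 :=
      (hL.abs.eventually (gt_mem_nhds (lt_add_one |L|))).mono fun z hz => hz.le
    obtain ⟨pa, ha, pb, hb, hab⟩ := eventually_prod_iff.1 hev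
    rw [eventually_nhdsWithin_iff] at hb
    exact ⟨_, mem_nhdsWithin_of_mem_nhds hb, |L| + 1,
      ha.mono fun s hs θ hθ hθ' => hab hs (hθ hθ')⟩
  obtain ⟨Λ, hΛ⟩ := key
  exact ⟨Λ, hΛ.mono fun s hs θ hθ => hs θ (Ioo_subset_Icc_self hθ) hθ⟩

/-- Cauchy's mean value theorem at a common zero, on either side. -/
lemma exists_deriv_ratio {f f' h h' : ℝ → ℝ} {a x r : ℝ} (hx : x ≠ a) (hxr : |x - a| < r)
    (hf : ∀ y, |y - a| < r → HasDerivAt f (f' y) y) (hh : ∀ y, |y - a| < r → HasDerivAt h (h' y) y)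
    (f0 : f a = 0) (h0 : h a = 0) (hne : ∀ y, |y - a| < r → h' y ≠ 0) :
    ∃ y, |y - a| < r ∧ f x / h x = f' y / h' y := by
  have hb : ∀ y ∈ uIcc a x, |y - a| < r := fun y hy =>
    (abs_sub_left_of_mem_uIcc hy).trans_lt hxr
  -- Applied first to F(y) = y − a, to see that the denominator does not vanish at x, and then to f.
  have key : ∀ (F F' : ℝ → ℝ), (∀ y, |y - a| < r → HasDerivAt F (F' y) y) → F a = 0 →
      ∃ y, |y - a| < r ∧ h x * F' y = F x * h' y := by
    intro F F' hF F0
    rcases lt_or_gt_of_ne hx with h1 | h1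
    · have hu : ∀ y ∈ Icc x a, |y - a| < r := fun y hy => hb y (by rwa [uIcc_of_ge h1.le])
      obtain ⟨c, hc, e⟩ := exists_ratio_hasDerivAt_eq_ratio_slope F F' h1
        (fun y hy => (hF y (hu y hy)).continuousAt.continuousWithinAt)
        (fun y hy => hF y (hu y (Ioo_subset_Icc_self hy))) h h'
        (fun y hy => (hh y (hu y hy)).continuousAt.continuousWithinAt)
        (fun y hy => hh y (hu y (Ioo_subset_Icc_self hy)))
      exact ⟨c, hu c (Ioo_subset_Icc_self hc), by rw [F0, h0] at e; linarith⟩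
    · have hu : ∀ y ∈ Icc a x, |y - a| < r := fun y hy => hb y (by rwa [uIcc_of_le h1.le])
      obtain ⟨c, hc, e⟩ := exists_ratio_hasDerivAt_eq_ratio_slope F F' h1
        (fun y hy => (hF y (hu y hy)).continuousAt.continuousWithinAt)
        (fun y hy => hF y (hu y (Ioo_subset_Icc_self hy))) h h'
        (fun y hy => (hh y (hu y hy)).continuousAt.continuousWithinAt)
        (fun y hy => hh y (hu y (Ioo_subset_Icc_self hy)))
      exact ⟨c, hu c (Ioo_subset_Icc_self hc), by rw [F0, h0] at e; linarith⟩
  have hhx : h x ≠ 0 := by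
    obtain ⟨y, hy, e⟩ := key (fun y => y - a) (fun _ => 1)
      (fun y _ => (hasDerivAt_id y).sub_const a) (sub_self a)
    intro h2
    rw [h2, zero_mul] at e
    exact mul_ne_zero (sub_ne_zero.2 hx) (hne y hy) e.symm
  obtain ⟨y, hy, e⟩ := key f f' hf f0
  exact ⟨y, hy, by rw [div_eq_div_iff hhx (hne y hy)]; linarith⟩

/-- L'Hospital's rule for families. -/
lemma tendsto_div_of_deriv {f f' h h' : ι → ℝ → ℝ} {a A B : ℝ}
    (hf : ∀ᶠ s in l, ∀ y, HasDerivAt (f s) (f' s y) y)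
    (hh : ∀ᶠ s in l, ∀ y, HasDerivAt (h s) (h' s y) y)
    (f0 : ∀ᶠ s in l, f s a = 0) (h0 : ∀ᶠ s in l, h s a = 0)
    (hA : Tendsto (fun z : ι × ℝ => f' z.1 z.2) (l ×ˢ 𝓝 a) (𝓝 A))
    (hB : Tendsto (fun z : ι × ℝ => h' z.1 z.2) (l ×ˢ 𝓝 a) (𝓝 B)) (hB0 : B ≠ 0) :
    Tendsto (fun z : ι × ℝ => f z.1 z.2 / h z.1 z.2) (l ×ˢ 𝓝[≠] a) (𝓝 (A / B)) := by
  intro V hV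
  have h1 := (hA.div hB hB0).eventually hV
  have h2 := hB.eventually_ne hB0
  obtain ⟨pa, ha, pb, hb, hab⟩ := eventually_prod_iff.1 (h1.and h2)
  obtain ⟨r, hr, hball⟩ := Metric.eventually_nhds_iff.1 hb
  change ∀ᶠ z in l ×ˢ 𝓝[≠] a, f z.1 z.2 / h z.1 z.2 ∈ V
  rw [eventually_prod_iff]
  refine ⟨_, ha.and (hf.and (hh.and (f0.and h0))), fun x => x ≠ a ∧ |x - a| < r, ?_, ?_⟩
  · rw [eventually_nhdsWithin_iff, Metric.eventually_nhds_iff]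
    exact ⟨r, hr, fun y hy hya => ⟨hya, hy⟩⟩
  · rintro s ⟨hs, hfs, hhs, f0s, h0s⟩ x ⟨hxa, hxr⟩
    obtain ⟨y, hy, e⟩ := exists_deriv_ratio hxa hxr (fun y _ => hfs y) (fun y _ => hhs y) f0s h0s
      fun y hy => (hab hs (hball hy)).2
    rw [e]
    exact (hab hs (hball hy)).1

end Families

/-! ### Smooth limits of profile curves -/

/-- A family of closed profile curves in the slice that converges, with two derivatives and jointly
in the parameter and the point, to a closed profile curve. -/
structure IsProfileLimit (U : Set R4) (g : R4 → Form) (l : Filter ℝ) (γ : ℝ → ℝ → R4)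
    (ξ : ℝ → R4) : Prop where
  slice : ∀ᶠ s in l, IsSliceProfile U g (γ s)
  limit : IsSliceProfile U g ξ
  axis_zero : ∀ᶠ s in l, γ s 0 1 = 0
  axis_pi : ∀ᶠ s in l, γ s Real.pi 1 = 0
  ne_zero : ∀ θ ∈ Ioo 0 Real.pi, ξ θ 1 ≠ 0
  limit_zero : ξ 0 1 = 0
  limit_pi : ξ Real.pi 1 = 0
  pole_zero : deriv ξ 0 1 ≠ 0
  pole_pi : deriv ξ Real.pi 1 ≠ 0
  tendsto : ∀ θ, Tendsto (fun z : ℝ × ℝ => (γ z.1 z.2, deriv (γ z.1) z.2)) (l ×ˢ 𝓝 θ)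
    (𝓝 (ξ θ, deriv ξ θ))
  tendsto_deriv : ∀ θ, Tendsto (fun z : ℝ × ℝ => deriv (deriv (γ z.1)) z.2) (l ×ˢ 𝓝 θ)
    (𝓝 (deriv (deriv ξ) θ))

/-- The distance to the axis, with the sign of the coordinate. -/
def axisDist (g : R4 → Form) (p : R4) : ℝ := p 1 * √(g p 2 2)

namespace IsAxisymmetricSpacetime

variable {E : Type*} [NormedAddCommGroup E] [NormedSpace ℝ E] {e : E}
  {U : Set R4} {g : R4 → Form} {p q : R4}

lemma contDiffAt_axisDist (h : IsAxisymmetricSpacetime U g) (hp : p ∈ U) (h0 : p 0 = 0) :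
    ContDiffAt ℝ ∞ (axisDist g) p :=
  (contDiffAt_apply contDiffAt_id 1).mul ((h.contDiffAt_comp contDiffAt_id hp 2 2).sqrt
    (h.entry_pos hp h0 (by simp)).ne')

lemma contDiffAt_fderiv_axisDist (h : IsAxisymmetricSpacetime U g) (hp : p ∈ U) (h0 : p 0 = 0) :
    ContDiffAt ℝ ∞ (fun z : R4 × R4 => fderiv ℝ (axisDist g) z.1 z.2) (p, q) :=
  (((h.contDiffAt_axisDist hp h0).fderiv_right (m := ∞) (by simp)).comp (p, q)
    contDiffAt_fst).clm_apply contDiffAt_snd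

lemma contDiffAt_norm (h : IsAxisymmetricSpacetime U g) (hp : p ∈ U) (hq : 0 < ip (g p) q q) :
    ContDiffAt ℝ ∞ (fun z : R4 × R4 => √(ip (g z.1) z.2 z.2)) (p, q) :=
  (h.contDiffAt_ip contDiffAt_fst hp contDiffAt_snd contDiffAt_snd).sqrt hq.ne'

end IsAxisymmetricSpacetime

namespace IsSliceProfile

variable {U : Set R4} {g : R4 → Form} {γ : ℝ → R4} {σ θ : ℝ}

lemma hasDerivAt_comp {N : R4 → ℝ} (h : IsSliceProfile U g γ) (hN : ContDiffAt ℝ ∞ N (γ θ)) :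
    HasDerivAt (fun t => N (γ t)) (fderiv ℝ N (γ θ) (deriv γ θ)) θ :=
  (hN.differentiableAt (by simp)).hasFDerivAt.comp_hasDerivAt θ (h.differentiable θ).hasDerivAt

lemma hasDerivAt_axisDist (h : IsSliceProfile U g γ) (θ : ℝ) :
    HasDerivAt (fun t => axisDist g (γ t)) (fderiv ℝ (axisDist g) (γ θ) (deriv γ θ)) θ :=
  h.hasDerivAt_comp (h.spacetime.contDiffAt_axisDist (h.mem θ) (h.zero θ))

/-- The signed distance is smooth across the axis while the radius is not; limits at the poles are
therefore taken for `axisDist` and transferred with the sign σ. -/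
lemma radius_eq_abs (h : IsSliceProfile U g γ) (θ : ℝ) : radius g γ θ = |axisDist g (γ θ)| := by
  rw [radius, h.orbitSq_eq, Real.sqrt_mul (sq_nonneg _), Real.sqrt_sq_eq_abs, axisDist, abs_mul,
    abs_of_nonneg (Real.sqrt_nonneg _)]

lemma radius_eq_smul (h : IsSliceProfile U g γ) (hσ : σ ^ 2 = 1) (hR : 0 < σ * γ θ 1) :
    radius g γ θ = σ * axisDist g (γ θ) := by
  have hg := Real.sqrt_pos.2 (h.spacetime.entry_pos (h.mem θ) (h.zero θ) (i := 2) (by simp))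
  have h1 : 0 < σ * axisDist g (γ θ) := by
    rw [axisDist, ← mul_assoc]; exact mul_pos hR hg
  have h2 : |σ| = 1 := by
    rw [← Real.sqrt_sq_eq_abs, hσ, Real.sqrt_one]
  rw [h.radius_eq_abs, ← one_mul |axisDist g (γ θ)|, ← h2, ← abs_mul, abs_of_pos h1]

lemma deriv_radius (h : IsSliceProfile U g γ) (hσ : σ ^ 2 = 1)
    (hR : ∀ t ∈ Ioo 0 Real.pi, 0 < σ * γ t 1) (hθ : θ ∈ Ioo 0 Real.pi) :
    deriv (radius g γ) θ = σ * fderiv ℝ (axisDist g) (γ θ) (deriv γ θ) := by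
  have e : radius g γ =ᶠ[𝓝 θ] fun t => σ * axisDist g (γ t) := by
    filter_upwards [isOpen_Ioo.mem_nhds hθ] with t ht using h.radius_eq_smul hσ (hR t ht)
  rw [e.deriv_eq, ((h.hasDerivAt_axisDist θ).const_mul σ).deriv]

lemma deriv_radius_div (h : IsSliceProfile U g γ) (hσ : σ ^ 2 = 1)
    (hR : ∀ t ∈ Ioo 0 Real.pi, 0 < σ * γ t 1) (hθ : θ ∈ Ioo 0 Real.pi) :
    deriv (fun t => deriv (radius g γ) t / speed g γ t) θ = σ * deriv (fun t =>
      fderiv ℝ (axisDist g) (γ t) (deriv γ t) / √(ip (g (γ t)) (deriv γ t) (deriv γ t))) θ := by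
  have e : (fun t => deriv (radius g γ) t / speed g γ t) =ᶠ[𝓝 θ] fun t =>
      σ * (fderiv ℝ (axisDist g) (γ t) (deriv γ t) / √(ip (g (γ t)) (deriv γ t) (deriv γ t))) := by
    filter_upwards [isOpen_Ioo.mem_nhds hθ] with t ht
    rw [h.deriv_radius hσ hR ht, mul_div_assoc]; rfl
  rw [e.deriv_eq, deriv_const_mul_field']

/-- The expansion of the normal of the slice. -/
lemma profileExpansion_timeField (h : IsSliceProfile U g γ) (hθ : θ ∈ Ioo 0 Real.pi) :
    profileExpansion g γ (timeField g γ) θ =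
      (ip (g (γ θ)) (deriv γ θ) (deriv γ θ))⁻¹ *
        ip (g (γ θ)) (deriv (timeField g γ) θ
          + chr g (γ θ) (deriv γ θ) (timeNormal (g (γ θ)))) (deriv γ θ)
      + (timeNormal (g (γ θ)) 1 / γ θ 1 + ip (g (γ θ)) (chr g (γ θ) (Pi.single 2 1)
          (timeNormal (g (γ θ)))) (Pi.single 2 1) / g (γ θ) 2 2) := by
  have hR : γ θ 1 ≠ 0 := by
    intro h1
    have := h.orbitSq_pos θ hθ
    rw [h.orbitSq_eq, h1] at this
    simp at this
  have hg := (h.spacetime.entry_pos (h.mem θ) (h.zero θ) (i := 2) (by simp)).ne'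
  -- On the meridian both rotation fields are multiples of ∂_y. After cancellation the only quotient
  -- singular at the poles is u¹/γ¹.
  have e1 : rotGen (γ θ) = γ θ 1 • (Pi.single 2 1 : R4) := by
    ext i; fin_cases i <;> simp [rotGen, h.two θ]
  have e2 : rotGen (timeNormal (g (γ θ))) = timeNormal (g (γ θ)) 1 • (Pi.single 2 1 : R4) := by
    ext i; fin_cases i <;> simp [rotGen, h.spacetime.timeNormal_two (h.mem θ) (h.two θ)]
  have key : (orbitSq g γ θ)⁻¹ * ip (g (γ θ)) (rotGen (timeNormal (g (γ θ)))
      + chr g (γ θ) (rotGen (γ θ)) (timeNormal (g (γ θ)))) (rotGen (γ θ))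
      = timeNormal (g (γ θ)) 1 / γ θ 1 + ip (g (γ θ)) (chr g (γ θ) (Pi.single 2 1)
          (timeNormal (g (γ θ)))) (Pi.single 2 1) / g (γ θ) 2 2 := by
    rw [h.orbitSq_eq, e1, e2, chr_smul_left, ip_add_left, ip_smul_left, ip_smul_left,
      ip_smul_right, ip_smul_right, IsAxisymmetricSpacetime.ip_single]
    field_simp
  rw [← key]; rfl

end IsSliceProfile

end
end WangYau

/-! ### Convergence of geometric quantities up to the poles. -/

namespace WangYau
noncomputable section

namespace IsAxisymmetricSpacetime

variable {U : Set R4} {g : R4 → Form} {p : R4}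

/-- The normal of the slice is parallel to the axis on the axis. -/
lemma timeNormal_one_of_axis (h : IsAxisymmetricSpacetime U g) (hp : p ∈ U) (h1 : p 1 = 0)
    (h2 : p 2 = 0) : timeNormal (g p) 1 = 0 := by
  have e : rot4 Real.pi p = p := by
    ext i; fin_cases i <;> simp [rot4, h1, h2]
  have := h.timeNormal_rot hp Real.pi
  rw [e] at this
  have h3 := congrFun this 1
  simp [rot4] at h3
  linarith

end IsAxisymmetricSpacetime

namespace IsSliceProfile

variable {U : Set R4} {g : R4 → Form} {ξ : ℝ → R4} {a : ℝ}

/-- On the axis the product rule leaves only the derivative of the coordinate factor. -/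
lemma fderiv_axisDist_ne_zero (h : IsSliceProfile U g ξ) (h1 : ξ a 1 = 0) (h2 : deriv ξ a 1 ≠ 0) :
    fderiv ℝ (axisDist g) (ξ a) (deriv ξ a) ≠ 0 := by
  have hg := Real.sqrt_pos.2 (h.spacetime.entry_pos (h.mem a) (h.zero a) (i := 2) (by simp))
  have d1 : HasDerivAt (fun t => ξ t 1) (deriv ξ a 1) a :=
    hasDerivAt_pi.1 (h.differentiable a).hasDerivAt 1
  have d2 := h.hasDerivAt_comp (N := fun p => √(g p 2 2)) (θ := a)
    ((h.spacetime.contDiffAt_comp contDiffAt_id (h.mem a) 2 2).sqrt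
      (h.spacetime.entry_pos (h.mem a) (h.zero a) (by simp)).ne')
  have := (d1.fun_mul d2).unique (h.hasDerivAt_axisDist a)
  rw [← this, h1, zero_mul, add_zero]
  exact mul_ne_zero h2 hg.ne'

end IsSliceProfile

namespace IsProfileLimit

variable {U : Set R4} {g : R4 → Form} {l : Filter ℝ} {γ : ℝ → ℝ → R4} {ξ : ℝ → R4} {θ a : ℝ}
  {E : Type*} [NormedAddCommGroup E] [NormedSpace ℝ E]

lemma tendsto_comp (h : IsProfileLimit U g l γ ξ) {N : R4 × R4 → E}
    (hN : ContDiffAt ℝ ∞ N (ξ θ, deriv ξ θ)) :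
    Tendsto (fun z : ℝ × ℝ => N (γ z.1 z.2, deriv (γ z.1) z.2)) (l ×ˢ 𝓝 θ)
      (𝓝 (N (ξ θ, deriv ξ θ))) :=
  hN.continuousAt.tendsto.comp (h.tendsto θ)

/-- By the chain rule the derivative of N(γ, γ') involves only γ, γ' and γ''; this is why
convergence with two derivatives is all that is required of the profiles. -/
lemma tendsto_deriv_comp (h : IsProfileLimit U g l γ ξ) {N : R4 × R4 → E}
    (hN : ContDiffAt ℝ ∞ N (ξ θ, deriv ξ θ)) :
    Tendsto (fun z : ℝ × ℝ => deriv (fun t => N (γ z.1 t, deriv (γ z.1) t)) z.2) (l ×ˢ 𝓝 θ)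
      (𝓝 (deriv (fun t => N (ξ t, deriv ξ t)) θ)) := by
  have chain : ∀ {c : ℝ → R4} {t : ℝ}, IsSliceProfile U g c →
      DifferentiableAt ℝ N (c t, deriv c t) → deriv (fun t => N (c t, deriv c t)) t
        = fderiv ℝ N (c t, deriv c t) (deriv c t, deriv (deriv c) t) := fun {c t} hc hd =>
    (hd.hasFDerivAt.comp_hasDerivAt t ((hc.differentiable t).hasDerivAt.prodMk
      ((contDiff_deriv hc.smooth).differentiable (by simp) t).hasDerivAt)).deriv
  rw [chain h.limit (hN.differentiableAt (by simp))]
  have h1 : Tendsto (fun z : ℝ × ℝ => fderiv ℝ N (γ z.1 z.2, deriv (γ z.1) z.2)) (l ×ˢ 𝓝 θ)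
      (𝓝 (fderiv ℝ N (ξ θ, deriv ξ θ))) :=
    (hN.fderiv_right (m := ∞) (by simp)).continuousAt.tendsto.comp (h.tendsto θ)
  have h2 : Tendsto (fun z : ℝ × ℝ => (deriv (γ z.1) z.2, deriv (deriv (γ z.1)) z.2)) (l ×ˢ 𝓝 θ)
      (𝓝 (deriv ξ θ, deriv (deriv ξ) θ)) :=
    ((continuous_snd.tendsto _).comp (h.tendsto θ)).prodMk_nhds (h.tendsto_deriv θ)
  have h3 : ∀ᶠ e in 𝓝 (ξ θ, deriv ξ θ), DifferentiableAt ℝ N e :=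
    ((hN.of_le (m := 1) (by exact_mod_cast le_top)).eventually (by simp)).mono
      fun e he => he.differentiableAt (by simp)
  refine ((isBoundedBilinearMap_apply.continuous.tendsto _).comp (h1.prodMk_nhds h2)).congr' ?_
  filter_upwards [(h.tendsto θ).eventually h3, h.slice.prod_inl (𝓝 θ)] with z hz hs
  exact (chain hs hz).symm

lemma tendsto_speed (h : IsProfileLimit U g l γ ξ) :
    Tendsto (fun z : ℝ × ℝ => speed g (γ z.1) z.2) (l ×ˢ 𝓝 θ) (𝓝 (speed g ξ θ)) :=
  h.tendsto_comp (h.limit.spacetime.contDiffAt_norm (h.limit.mem θ) (h.limit.speedSq_pos θ))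

lemma tendsto_axisDist (h : IsProfileLimit U g l γ ξ) :
    Tendsto (fun z : ℝ × ℝ => axisDist g (γ z.1 z.2)) (l ×ˢ 𝓝 θ) (𝓝 (axisDist g (ξ θ))) :=
  h.tendsto_comp (N := fun e => axisDist g e.1) ((h.limit.spacetime.contDiffAt_axisDist
    (h.limit.mem θ) (h.limit.zero θ)).comp (ξ θ, deriv ξ θ) contDiffAt_fst)

lemma tendsto_slope (h : IsProfileLimit U g l γ ξ) :
    Tendsto (fun z : ℝ × ℝ => fderiv ℝ (axisDist g) (γ z.1 z.2) (deriv (γ z.1) z.2)) (l ×ˢ 𝓝 θ)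
      (𝓝 (fderiv ℝ (axisDist g) (ξ θ) (deriv ξ θ))) :=
  h.tendsto_comp (h.limit.spacetime.contDiffAt_fderiv_axisDist (h.limit.mem θ) (h.limit.zero θ))

lemma tendsto_deriv_ratio (h : IsProfileLimit U g l γ ξ) : ∃ L,
    Tendsto (fun z : ℝ × ℝ => deriv (fun t => fderiv ℝ (axisDist g) (γ z.1 t) (deriv (γ z.1) t) /
      √(ip (g (γ z.1 t)) (deriv (γ z.1) t) (deriv (γ z.1) t))) z.2) (l ×ˢ 𝓝 θ) (𝓝 L) :=
  ⟨_, h.tendsto_deriv_comp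
    (N := fun e => fderiv ℝ (axisDist g) e.1 e.2 / √(ip (g e.1) e.2 e.2))
    ((h.limit.spacetime.contDiffAt_fderiv_axisDist (h.limit.mem θ) (h.limit.zero θ)).div
      (h.limit.spacetime.contDiffAt_norm (h.limit.mem θ) (h.limit.speedSq_pos θ))
      (h.limit.speed_pos θ).ne')⟩

lemma tendsto_sliceConnection (h : IsProfileLimit U g l γ ξ) : ∃ L,
    Tendsto (fun z : ℝ × ℝ => sliceConnection g (γ z.1) z.2) (l ×ˢ 𝓝 θ) (𝓝 L) := by
  have S := h.limit.spacetime
  have hm := h.limit.mem θ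
  have h0 := h.limit.zero θ
  have hs := h.limit.speedSq_pos θ
  have hd := h.tendsto_deriv_comp (N := fun e => planeNormal g e.1 e.2)
    (S.contDiffAt_planeNormal (e := (ξ θ, deriv ξ θ)) contDiffAt_fst hm h0 contDiffAt_snd hs)
  have hQ : ContDiffAt ℝ ∞ (fun e : (R4 × R4) × R4 => ip (g e.1.1)
      (e.2 + chr g e.1.1 e.1.2 (planeNormal g e.1.1 e.1.2)) (timeNormal (g e.1.1)))
      ((ξ θ, deriv ξ θ), deriv (fun t => planeNormal g (ξ t) (deriv ξ t)) θ) := by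
    have f1 : ContDiffAt ℝ ∞ (fun e : (R4 × R4) × R4 => e.1.1)
      ((ξ θ, deriv ξ θ), deriv (fun t => planeNormal g (ξ t) (deriv ξ t)) θ) :=
      contDiffAt_fst.fst
    have f2 : ContDiffAt ℝ ∞ (fun e : (R4 × R4) × R4 => e.1.2)
      ((ξ θ, deriv ξ θ), deriv (fun t => planeNormal g (ξ t) (deriv ξ t)) θ) :=
      contDiffAt_fst.snd
    exact S.contDiffAt_ip f1 hm (contDiffAt_snd.add (S.contDiffAt_chr f1 hm f2
      (S.contDiffAt_planeNormal f1 hm h0 f2 hs))) (S.contDiffAt_timeNormal f1 hm h0)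
  have hq := hQ.continuousAt.tendsto.comp ((h.tendsto θ).prodMk_nhds hd)
  refine ⟨_, hq.congr fun z => ?_⟩
  simp only [Function.comp, sliceConnection, covProfile]
  rfl

lemma nhdsWithin_Ioo_le (ha : a = 0 ∨ a = Real.pi) : 𝓝[Ioo 0 Real.pi] a ≤ 𝓝[≠] a :=
  nhdsWithin_mono _ fun x hx => by
    rintro rfl
    rcases ha with rfl | rfl
    · exact lt_irrefl _ hx.1
    · exact lt_irrefl _ hx.2

lemma axis (h : IsProfileLimit U g l γ ξ) (ha : a = 0 ∨ a = Real.pi) :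
    (∀ᶠ s in l, γ s a 1 = 0) ∧ ξ a 1 = 0 ∧ deriv ξ a 1 ≠ 0 := by
  rcases ha with rfl | rfl
  · exact ⟨h.axis_zero, h.limit_zero, h.pole_zero⟩
  · exact ⟨h.axis_pi, h.limit_pi, h.pole_pi⟩

/-- A smooth function of the point that vanishes on the axis, divided by a function that vanishes
there to first order. -/
lemma tendsto_div_pole (h : IsProfileLimit U g l γ ξ) (ha : a = 0 ∨ a = Real.pi)
    {M N : R4 → ℝ} (hM : ∀ p ∈ U, p 0 = 0 → ContDiffAt ℝ ∞ M p)
    (hN : ∀ p ∈ U, p 0 = 0 → ContDiffAt ℝ ∞ N p)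
    (hM0 : ∀ p ∈ U, p 1 = 0 → p 2 = 0 → M p = 0) (hN0 : ∀ p ∈ U, p 1 = 0 → p 2 = 0 → N p = 0)
    (hne : fderiv ℝ N (ξ a) (deriv ξ a) ≠ 0) :
    ∃ L, Tendsto (fun z : ℝ × ℝ => M (γ z.1 z.2) / N (γ z.1 z.2)) (l ×ˢ 𝓝[Ioo 0 Real.pi] a)
      (𝓝 L) := by
  have hT : ∀ K : R4 → ℝ, (∀ p ∈ U, p 0 = 0 → ContDiffAt ℝ ∞ K p) →
      Tendsto (fun z : ℝ × ℝ => fderiv ℝ K (γ z.1 z.2) (deriv (γ z.1) z.2)) (l ×ˢ 𝓝 a)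
        (𝓝 (fderiv ℝ K (ξ a) (deriv ξ a))) := fun K hK =>
    h.tendsto_comp (N := fun e => fderiv ℝ K e.1 e.2)
      ((((hK _ (h.limit.mem a) (h.limit.zero a)).fderiv_right (m := ∞) (by simp)).comp
        (ξ a, deriv ξ a) contDiffAt_fst).clm_apply contDiffAt_snd)
  refine ⟨_, (tendsto_div_of_deriv (f := fun s t => M (γ s t)) (h := fun s t => N (γ s t))
    (h.slice.mono fun s hs t => hs.hasDerivAt_comp (hM _ (hs.mem t) (hs.zero t)))
    (h.slice.mono fun s hs t => hs.hasDerivAt_comp (hN _ (hs.mem t) (hs.zero t)))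
    ?_ ?_ (hT M hM) (hT N hN) hne).mono_left (prod_mono_right _ (nhdsWithin_Ioo_le ha))⟩
  · filter_upwards [h.slice, (h.axis ha).1] with s hs h1 using hM0 _ (hs.mem a) h1 (hs.two a)
  · filter_upwards [h.slice, (h.axis ha).1] with s hs h1 using hN0 _ (hs.mem a) h1 (hs.two a)

lemma endpoint_or_mem {x : ℝ} (hx : x ∈ Icc 0 Real.pi) :
    (x = 0 ∨ x = Real.pi) ∨ x ∈ Ioo 0 Real.pi := by
  rcases hx.1.eq_or_lt with h1 | h1
  · exact Or.inl (Or.inl h1.symm)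
  · rcases hx.2.eq_or_lt with h2 | h2
    · exact Or.inl (Or.inr h2)
    · exact Or.inr ⟨h1, h2⟩

lemma nhdsWithin_le (l : Filter ℝ) (a : ℝ) (s : Set ℝ) : l ×ˢ 𝓝[s] a ≤ l ×ˢ 𝓝 a :=
  prod_mono_right _ nhdsWithin_le_nhds

/-- The expansion of the slice normal converges, also at the poles. -/
lemma exists_tendsto_expansion (h : IsProfileLimit U g l γ ξ) {x : ℝ} (hx : x ∈ Icc 0 Real.pi) :
    ∃ L, Tendsto (fun z : ℝ × ℝ => profileExpansion g (γ z.1) (timeField g (γ z.1)) z.2)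
      (l ×ˢ 𝓝[Ioo 0 Real.pi] x) (𝓝 L) := by
  have S := h.limit.spacetime
  have hm := h.limit.mem x
  have h0 := h.limit.zero x
  have hs := h.limit.speedSq_pos x
  have f1 : ContDiffAt ℝ ∞ (fun e : R4 × R4 => e.1) (ξ x, deriv ξ x) := contDiffAt_fst
  have hd := h.tendsto_deriv_comp (N := fun e => timeNormal (g e.1))
    (S.contDiffAt_timeNormal (e := (ξ x, deriv ξ x)) contDiffAt_fst hm h0)
  have hQ : ContDiffAt ℝ ∞ (fun e : (R4 × R4) × R4 => (ip (g e.1.1) e.1.2 e.1.2)⁻¹ * ip (g e.1.1)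
      (e.2 + chr g e.1.1 e.1.2 (timeNormal (g e.1.1))) e.1.2)
      ((ξ x, deriv ξ x), deriv (fun t => timeNormal (g (ξ t))) x) := by
    have f1 : ContDiffAt ℝ ∞ (fun e : (R4 × R4) × R4 => e.1.1)
      ((ξ x, deriv ξ x), deriv (fun t => timeNormal (g (ξ t))) x) := contDiffAt_fst.fst
    have f2 : ContDiffAt ℝ ∞ (fun e : (R4 × R4) × R4 => e.1.2)
      ((ξ x, deriv ξ x), deriv (fun t => timeNormal (g (ξ t))) x) := contDiffAt_fst.snd
    exact ((S.contDiffAt_ip f1 hm f2 f2).inv hs.ne').mul (S.contDiffAt_ip f1 hm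
      (contDiffAt_snd.add (S.contDiffAt_chr f1 hm f2 (S.contDiffAt_timeNormal f1 hm h0))) f2)
  have hA := (hQ.continuousAt.tendsto.comp ((h.tendsto x).prodMk_nhds hd)).mono_left
    (nhdsWithin_le l x (Ioo 0 Real.pi))
  have hB := (h.tendsto_comp (N := fun e => ip (g e.1) (chr g e.1 (Pi.single 2 1)
      (timeNormal (g e.1))) (Pi.single 2 1) / g e.1 2 2)
    ((S.contDiffAt_ip f1 hm (S.contDiffAt_chr f1 hm contDiffAt_const
      (S.contDiffAt_timeNormal f1 hm h0)) contDiffAt_const).div (S.contDiffAt_comp f1 hm 2 2)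
      (S.entry_pos hm h0 (by simp)).ne')).mono_left (nhdsWithin_le l x (Ioo 0 Real.pi))
  -- By rotation symmetry u¹ vanishes on the axis, so l'Hospital's rule applies at a pole; elsewhere
  -- the quotient is continuous.
  have hC : ∃ L, Tendsto (fun z : ℝ × ℝ => timeNormal (g (γ z.1 z.2)) 1 / γ z.1 z.2 1)
      (l ×ˢ 𝓝[Ioo 0 Real.pi] x) (𝓝 L) := by
    rcases endpoint_or_mem hx with hx | hx
    · refine h.tendsto_div_pole hx (M := fun p => timeNormal (g p) 1) (N := fun p => p 1)
        (fun p hp hp0 => contDiffAt_apply (S.contDiffAt_timeNormal contDiffAt_id hp hp0) 1)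
        (fun p _ _ => contDiffAt_apply contDiffAt_id 1)
        (fun p hp h1 h2 => S.timeNormal_one_of_axis hp h1 h2) (fun p _ h1 _ => h1) ?_
      have : (fun p : R4 => p 1) = ⇑(ContinuousLinearMap.proj (R := ℝ) (φ := fun _ : Fin 4 => ℝ) 1) :=
        rfl
      rw [this, ContinuousLinearMap.fderiv]
      exact (h.axis hx).2.2
    · refine ⟨_, ((h.tendsto_comp (θ := x) (N := fun e => timeNormal (g e.1) 1 / e.1 1) ?_).mono_left
        (nhdsWithin_le l x _))⟩
      exact (contDiffAt_apply (S.contDiffAt_timeNormal f1 hm h0) 1).div (contDiffAt_apply f1 1)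
        (h.ne_zero x hx)
  obtain ⟨L, hL⟩ := hC
  refine ⟨_, (hA.add (hL.add hB)).congr' ?_⟩
  have hmem : ∀ᶠ z in l ×ˢ 𝓝[Ioo 0 Real.pi] x, z.2 ∈ Ioo 0 Real.pi :=
    Eventually.prod_inr self_mem_nhdsWithin l
  filter_upwards [h.slice.prod_inl _, hmem] with z hz hz2
  rw [hz.profileExpansion_timeField hz2]
  rfl

end IsProfileLimit

end
end WangYau

/-! ### Uniform geometric bounds along a convergent family. -/

namespace WangYau
noncomputable section

namespace IsProfileLimit

variable {U : Set R4} {g : R4 → Form} {l : Filter ℝ} {γ : ℝ → ℝ → R4} {ξ : ℝ → R4} {θ a : ℝ}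

lemma axisDist_axis (h : IsProfileLimit U g l γ ξ) (ha : a = 0 ∨ a = Real.pi) :
    ∀ᶠ s in l, axisDist g (γ s a) = 0 :=
  (h.axis ha).1.mono fun s hs => by rw [axisDist, hs, zero_mul]

lemma tendsto_sub_const (l : Filter ℝ) (x a : ℝ) :
    Tendsto (fun z : ℝ × ℝ => z.2 - a) (l ×ˢ 𝓝 x) (𝓝 (x - a)) :=
  (tendsto_snd (f := l) (g := 𝓝 x)).sub_const a

/-- Yields the upper bounds of r by the distances in θ to the two poles: l'Hospital's rule at `a`,
continuity elsewhere. -/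
lemma exists_tendsto_axisDist_div (h : IsProfileLimit U g l γ ξ) (ha : a = 0 ∨ a = Real.pi)
    (x : ℝ) :
    ∃ L, Tendsto (fun z : ℝ × ℝ => axisDist g (γ z.1 z.2) / (z.2 - a))
      (l ×ˢ 𝓝[Ioo 0 Real.pi] x) (𝓝 L) := by
  by_cases hxa : x = a
  · subst hxa
    refine ⟨_, (tendsto_div_of_deriv (f := fun s t => axisDist g (γ s t)) (h := fun _ t => t - x)
      (h' := fun _ _ => 1) (h.slice.mono fun s hs t => hs.hasDerivAt_axisDist t)
      (Eventually.of_forall fun s y => (hasDerivAt_id y).sub_const x) (h.axisDist_axis ha)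
      (by simp) h.tendsto_slope tendsto_const_nhds one_ne_zero).mono_left
      (prod_mono_right _ (nhdsWithin_Ioo_le ha))⟩
  · exact ⟨_, (h.tendsto_axisDist.div (tendsto_sub_const l x a) (sub_ne_zero.2 hxa)).mono_left
      (nhdsWithin_le l x _)⟩

lemma slope_ne_zero (h : IsProfileLimit U g l γ ξ) (ha : a = 0 ∨ a = Real.pi) :
    fderiv ℝ (axisDist g) (ξ a) (deriv ξ a) ≠ 0 :=
  h.limit.fderiv_axisDist_ne_zero (h.axis ha).2.1 (h.axis ha).2.2

lemma axisDist_ne_zero (h : IsProfileLimit U g l γ ξ) (hθ : θ ∈ Ioo 0 Real.pi) :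
    axisDist g (ξ θ) ≠ 0 :=
  mul_ne_zero (h.ne_zero θ hθ) (Real.sqrt_pos.2
    (h.limit.spacetime.entry_pos (h.limit.mem θ) (h.limit.zero θ) (by simp))).ne'

/-- Yields the lower bound of r by θ(π − θ); the denominator has nonzero slope at the poles. -/
lemma exists_tendsto_div_axisDist (h : IsProfileLimit U g l γ ξ) {x : ℝ}
    (hx : x ∈ Icc 0 Real.pi) :
    ∃ L, Tendsto (fun z : ℝ × ℝ => z.2 * (Real.pi - z.2) / axisDist g (γ z.1 z.2))
      (l ×ˢ 𝓝[Ioo 0 Real.pi] x) (𝓝 L) := by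
  have hT : Tendsto (fun z : ℝ × ℝ => z.2) (l ×ˢ 𝓝 x) (𝓝 x) := tendsto_snd
  rcases endpoint_or_mem hx with hx | hx
  · refine ⟨_, (tendsto_div_of_deriv (f := fun _ t => t * (Real.pi - t))
      (f' := fun _ t => Real.pi - 2 * t) (h := fun s t => axisDist g (γ s t))
      (Eventually.of_forall fun s y => ?_) (h.slice.mono fun s hs t => hs.hasDerivAt_axisDist t)
      (Eventually.of_forall fun s => ?_) (h.axisDist_axis hx) ((hT.const_mul 2).const_sub Real.pi)
      h.tendsto_slope (h.slope_ne_zero hx)).mono_left (prod_mono_right _ (nhdsWithin_Ioo_le hx))⟩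
    · exact ((hasDerivAt_id y).fun_mul ((hasDerivAt_id y).const_sub Real.pi)).congr_deriv
        (by simp; ring)
    · rcases hx with rfl | rfl <;> simp
  · exact ⟨_, ((hT.mul (hT.const_sub Real.pi)).div h.tendsto_axisDist
      (h.axisDist_ne_zero hx)).mono_left (nhdsWithin_le l x _)⟩

/-- Near the poles the radius is strictly monotone, uniformly in the family. -/
lemma exists_slope_sign (h : IsProfileLimit U g l γ ξ) (ha : a = 0 ∨ a = Real.pi) :
    ∃ d > 0, ∀ᶠ s in l, ∀ θ ∈ Ioo 0 Real.pi, |θ - a| < d → ∀ σ, 0 < σ * axisDist g (γ s θ) →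
      0 < σ * fderiv ℝ (axisDist g) (γ s θ) (deriv (γ s) θ) * (θ - a) := by
  have hS := h.slope_ne_zero ha
  set S₀ := fderiv ℝ (axisDist g) (ξ a) (deriv ξ a) with hS₀
  have h1 : ∀ᶠ z in l ×ˢ 𝓝 a,
      0 < fderiv ℝ (axisDist g) (γ z.1 z.2) (deriv (γ z.1) z.2) * S₀ :=
    (h.tendsto_slope.mul_const S₀).eventually_const_lt (mul_self_pos.2 hS)
  obtain ⟨pa, hpa, pb, hpb, hab⟩ := eventually_prod_iff.1 h1
  obtain ⟨d, hd, hball⟩ := Metric.eventually_nhds_iff.1 hpb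
  refine ⟨d, hd, ?_⟩
  filter_upwards [hpa, h.slice, h.axisDist_axis ha] with s hs hsl hax θ hθ hθd σ hσ
  have hθa : θ ≠ a := by
    rintro rfl
    rw [hax, mul_zero] at hσ
    exact lt_irrefl _ hσ
  -- The quotient axisDist/(θ − a) is the slope at some nearby point, and all nearby slopes share
  -- the sign of the limiting one. So slope times (θ − a) has the sign of axisDist itself.
  obtain ⟨y, hy, e⟩ := exists_deriv_ratio (f := fun t => axisDist g (γ s t)) (h := fun t => t - a)
    (h' := fun _ => 1) hθa hθd (fun y _ => hsl.hasDerivAt_axisDist y)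
    (fun y _ => (hasDerivAt_id y).sub_const a) hax (sub_self a) (fun _ _ => one_ne_zero)
  have h2 := hab hs (hball hy)
  have h3 := hab hs (hball (show dist θ a < d from hθd))
  rw [div_one] at e
  rw [← e] at h2
  have hta := sub_ne_zero.2 hθa
  have h4 := mul_pos (mul_pos hσ h3) h2
  have e2 : σ * axisDist g (γ s θ) * (fderiv ℝ (axisDist g) (γ s θ) (deriv (γ s) θ) * S₀) *
      (axisDist g (γ s θ) / (θ - a) * S₀)
      = σ * fderiv ℝ (axisDist g) (γ s θ) (deriv (γ s) θ) * (θ - a) *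
        (axisDist g (γ s θ) * S₀ / (θ - a)) ^ 2 := by
    field_simp
  rw [e2] at h4
  exact pos_of_mul_pos_left h4 (sq_nonneg _)

/-- Uniform bounds of the geometry along a smoothly convergent family. -/
theorem exists_profileBounds (h : IsProfileLimit U g l γ ξ) :
    ∃ Λ d, ∀ᶠ s in l, ∀ Λ' ≥ Λ, ∀ σ : ℝ, σ ^ 2 = 1 → (∀ θ ∈ Ioo 0 Real.pi, 0 < σ * γ s θ 1) →
      ∀ (k : ℝ) (m : ℝ → ℝ) (ε : ℝ),
        (∃ c, ∀ θ ∈ Ioo 0 Real.pi, |slipAngle k (m θ) - c| ≤ Λ') →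
        (∀ θ ∈ Ioo 0 Real.pi, √(k * m θ) ≤ ε) →
        ProfileBounds g (γ s) k m (fun θ => σ * sliceConnection g (γ s) θ) Λ' d ε := by
  obtain ⟨Λ₁, h₁⟩ := exists_eventually_abs_le (l := l) (a := 0) (b := Real.pi)
    (q := fun s θ => speed g (γ s) θ) fun x _ => ⟨_, h.tendsto_speed.mono_left (nhdsWithin_le l x _)⟩
  obtain ⟨Λ₂, h₂⟩ := exists_eventually_abs_le (l := l) (a := 0) (b := Real.pi)
    (q := fun s θ => (speed g (γ s) θ)⁻¹) fun x _ =>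
      ⟨_, (h.tendsto_speed.inv₀ (h.limit.speed_pos x).ne').mono_left (nhdsWithin_le l x _)⟩
  obtain ⟨Λ₃, h₃⟩ := exists_eventually_abs_le (l := l) (a := 0) (b := Real.pi)
    (q := fun s θ => axisDist g (γ s θ) / (θ - 0)) fun x _ =>
      h.exists_tendsto_axisDist_div (Or.inl rfl) x
  obtain ⟨Λ₄, h₄⟩ := exists_eventually_abs_le (l := l) (a := 0) (b := Real.pi)
    (q := fun s θ => axisDist g (γ s θ) / (θ - Real.pi)) fun x _ =>
      h.exists_tendsto_axisDist_div (Or.inr rfl) x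
  obtain ⟨Λ₅, h₅⟩ := exists_eventually_abs_le (l := l) (a := 0) (b := Real.pi)
    (q := fun s θ => θ * (Real.pi - θ) / axisDist g (γ s θ)) fun x hx =>
      h.exists_tendsto_div_axisDist hx
  obtain ⟨Λ₆, h₆⟩ := exists_eventually_abs_le (l := l) (a := 0) (b := Real.pi)
    (q := fun s θ => fderiv ℝ (axisDist g) (γ s θ) (deriv (γ s) θ)) fun x _ =>
      ⟨_, h.tendsto_slope.mono_left (nhdsWithin_le l x _)⟩
  obtain ⟨Λ₇, h₇⟩ := exists_eventually_abs_le (l := l) (a := 0) (b := Real.pi)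
    (q := fun s θ => deriv (fun t => fderiv ℝ (axisDist g) (γ s t) (deriv (γ s) t) /
      √(ip (g (γ s t)) (deriv (γ s) t) (deriv (γ s) t))) θ) fun x _ => by
      obtain ⟨L, hL⟩ := h.tendsto_deriv_ratio (θ := x)
      exact ⟨L, hL.mono_left (nhdsWithin_le l x _)⟩
  obtain ⟨Λ₈, h₈⟩ := exists_eventually_abs_le (l := l) (a := 0) (b := Real.pi)
    (q := fun s θ => sliceConnection g (γ s) θ) fun x _ => by
      obtain ⟨L, hL⟩ := h.tendsto_sliceConnection (θ := x)
      exact ⟨L, hL.mono_left (nhdsWithin_le l x _)⟩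
  obtain ⟨d₁, hd₁, k₁⟩ := h.exists_slope_sign (Or.inl rfl)
  obtain ⟨d₂, hd₂, k₂⟩ := h.exists_slope_sign (Or.inr rfl)
  -- The sum dominates every constant and is at least 1. Any larger Λ' is admitted as well, so that
  -- the slip bound can later be merged into the same constant.
  refine ⟨1 + |Λ₁| + |Λ₂| + |Λ₃| + |Λ₄| + |Λ₅| + |Λ₆| + |Λ₇| + |Λ₈|, min d₁ d₂, ?_⟩
  filter_upwards [h.slice, h₁, h₂, h₃, h₄, h₅, h₆, h₇, h₈, k₁, k₂] with s hs h₁ h₂ h₃ h₄ h₅ h₆ h₇ h₈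
    k₁ k₂ Λ hΛ σ hσ hR k m ε hslip hnorm
  have a₁ := abs_nonneg Λ₁
  have a₂ := abs_nonneg Λ₂
  have a₃ := abs_nonneg Λ₃
  have a₄ := abs_nonneg Λ₄
  have a₅ := abs_nonneg Λ₅
  have a₆ := abs_nonneg Λ₆
  have a₇ := abs_nonneg Λ₇
  have a₈ := abs_nonneg Λ₈
  have b₁ := le_abs_self Λ₁
  have b₂ := le_abs_self Λ₂
  have b₃ := le_abs_self Λ₃
  have b₄ := le_abs_self Λ₄
  have b₅ := le_abs_self Λ₅
  have b₆ := le_abs_self Λ₆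
  have b₇ := le_abs_self Λ₇
  have b₈ := le_abs_self Λ₈
  have habs : |σ| = 1 := by rw [← Real.sqrt_sq_eq_abs, hσ, Real.sqrt_one]
  have hax : ∀ θ ∈ Ioo 0 Real.pi, 0 < σ * axisDist g (γ s θ) := fun θ hθ => by
    rw [← hs.radius_eq_smul hσ (hR θ hθ)]; exact hs.radius_pos hθ
  constructor
  · linarith
  · exact lt_min hd₁ hd₂
  · intro θ hθ
    linarith [(le_abs_self _).trans (h₁ θ hθ)]
  · intro θ hθ
    have h3 := hs.speed_pos θ
    have h4 := (le_abs_self _).trans (h₂ θ hθ)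
    calc (1:ℝ) = (speed g (γ s) θ)⁻¹ * speed g (γ s) θ := (inv_mul_cancel₀ h3.ne').symm
      _ ≤ Λ * speed g (γ s) θ := by gcongr; linarith
  · intro θ hθ
    have h3 := h₃ θ hθ
    have hp := hθ.1
    rw [sub_zero, abs_div, abs_of_pos hp, div_le_iff₀ hp] at h3
    rw [hs.radius_eq_abs]
    exact h3.trans (by gcongr; linarith)
  · intro θ hθ
    have h3 := h₄ θ hθ
    have hp : 0 < Real.pi - θ := sub_pos.2 hθ.2
    rw [abs_div, abs_sub_comm, abs_of_pos hp, div_le_iff₀ hp] at h3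
    rw [hs.radius_eq_abs]
    exact h3.trans (by gcongr; linarith)
  · intro θ hθ
    have h3 := h₅ θ hθ
    have hp := mul_pos hθ.1 (sub_pos.2 hθ.2)
    have hr := hs.radius_pos hθ
    rw [hs.radius_eq_abs] at hr ⊢
    rw [abs_div, abs_of_pos hp, div_le_iff₀ hr] at h3
    exact h3.trans (by gcongr; linarith)
  · intro θ hθ
    rw [hs.deriv_radius hσ hR hθ, abs_mul, habs, one_mul]
    linarith [h₆ θ hθ]
  · intro θ hθ
    rw [hs.deriv_radius_div hσ hR hθ, abs_mul, habs, one_mul]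
    linarith [h₇ θ hθ]
  · intro θ hθ hd
    rw [hs.deriv_radius hσ hR hθ]
    have := k₁ θ hθ (by
      rw [sub_zero, abs_of_pos hθ.1]; exact hd.trans_le (min_le_left _ _)) σ (hax θ hθ)
    rw [sub_zero] at this
    exact pos_of_mul_pos_left this hθ.1.le
  · intro θ hθ hd
    rw [hs.deriv_radius hσ hR hθ]
    have hp : 0 < Real.pi - θ := sub_pos.2 hθ.2
    have := k₂ θ hθ (by
      rw [abs_sub_comm, abs_of_pos hp]
      linarith [min_le_right d₁ d₂]) σ (hax θ hθ)
    by_contra hneg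
    push Not at hneg
    nlinarith
  · intro θ hθ
    rw [abs_mul, habs, one_mul]
    linarith [h₈ θ hθ]
  · exact hslip
  · exact hnorm

/-- The expansion of the slice normal is uniformly bounded along the family. -/
lemma exists_expansion_bound (h : IsProfileLimit U g l γ ξ) :
    ∃ C, ∀ᶠ s in l, ∀ θ ∈ Ioo 0 Real.pi,
      |profileExpansion g (γ s) (timeField g (γ s)) θ| ≤ C :=
  exists_eventually_abs_le fun _ hx => h.exists_tendsto_expansion hx

/-- A strict upper bound of the expansion of the slice normal persists along the family. -/
lemma eventually_expansion_lt (h : IsProfileLimit U g l γ ξ) {s₁ b b' : ℝ} (hs : pure s₁ ≤ l)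
    (hξ : γ s₁ = ξ) (hbb : b < b')
    (hb : ∀ θ ∈ Ioo 0 Real.pi, profileExpansion g ξ (timeField g ξ) θ ≤ b) :
    ∀ᶠ s in l, ∀ θ ∈ Ioo 0 Real.pi, profileExpansion g (γ s) (timeField g (γ s)) θ < b' := by
  refine eventually_forall_Ioo (P := fun s θ =>
    profileExpansion g (γ s) (timeField g (γ s)) θ < b') fun x hx => ?_
  obtain ⟨L, hL⟩ := h.exists_tendsto_expansion hx
  -- The parameter `s₁` belongs to the filter, so the joint limit can be computed on that curve
  -- alone; this gives L ≤ b also at the poles.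
  have h1 := hL.mono_left (prod_mono_left (𝓝[Ioo 0 Real.pi] x) hs)
  rw [pure_prod, tendsto_map'_iff] at h1
  have hne : (𝓝[Ioo 0 Real.pi] x).NeBot := by
    rw [← mem_closure_iff_nhdsWithin_neBot, closure_Ioo Real.pi_pos.ne]; exact hx
  have hLb : L ≤ b := le_of_tendsto h1 (by
    filter_upwards [self_mem_nhdsWithin] with θ hθ
    simp only [Function.comp, hξ]
    exact hb θ hθ)
  exact hL.eventually_lt_const (hLb.trans_lt hbb)

end IsProfileLimit

end
end WangYau

namespace WangYau
noncomputable section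

/-! ### Profile curves of parametrized spheres -/

/-- The tangent vectors of the sphere along the meridian. -/
def meridianTangent (θ : ℝ) : R3 := ![Real.cos θ, 0, -Real.sin θ]
def orbitTangent (θ : ℝ) : R3 := ![0, Real.sin θ, 0]

lemma isTangent_meridian (θ : ℝ) : IsTangent (meridian θ) (meridianTangent θ) := by
  simp [IsTangent, meridian, meridianTangent, dotProduct, Fin.sum_univ_three]; ring

lemma isTangent_orbit (θ : ℝ) : IsTangent (meridian θ) (orbitTangent θ) := by
  simp [IsTangent, meridian, orbitTangent, dotProduct, Fin.sum_univ_three]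

lemma hasDerivAt_meridian (θ : ℝ) : HasDerivAt meridian (meridianTangent θ) θ := by
  rw [hasDerivAt_pi]
  intro i
  fin_cases i
  · exact Real.hasDerivAt_sin θ
  · exact hasDerivAt_const θ 0
  · exact Real.hasDerivAt_cos θ

lemma hasDerivAt_meridianTangent (θ : ℝ) : HasDerivAt meridianTangent (-meridian θ) θ := by
  rw [hasDerivAt_pi]
  intro i
  fin_cases i
  · exact Real.hasDerivAt_cos θ
  · simpa [meridian, meridianTangent] using hasDerivAt_const θ (0 : ℝ)
  · exact (Real.hasDerivAt_sin θ).neg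

section Sphere

variable {U : Set R4} {g : R4 → Form} {F G : R3 → R4} {θ a : ℝ}

lemma deriv_curve (hF : ContDiff ℝ ∞ F) (θ : ℝ) :
    deriv (curve F) θ = fderiv ℝ F (meridian θ) (meridianTangent θ) :=
  ((hF.differentiable (by simp) _).hasFDerivAt.comp_hasDerivAt θ (hasDerivAt_meridian θ)).deriv

lemma deriv_deriv_curve (hF : ContDiff ℝ ∞ F) (θ : ℝ) :
    deriv (deriv (curve F)) θ
      = fderiv ℝ (fderiv ℝ F) (meridian θ) (meridianTangent θ) (meridianTangent θ)
        + fderiv ℝ F (meridian θ) (-meridian θ) := by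
  have h1 : HasDerivAt (fun t => fderiv ℝ F (meridian t))
      (fderiv ℝ (fderiv ℝ F) (meridian θ) (meridianTangent θ)) θ :=
    ((hF.fderiv_right (m := ∞) (by simp)).differentiable (by simp) _).hasFDerivAt.comp_hasDerivAt θ
      (hasDerivAt_meridian θ)
  rw [show deriv (curve F) = fun t => fderiv ℝ F (meridian t) (meridianTangent t) from
    funext (deriv_curve hF)]
  exact (h1.clm_apply (hasDerivAt_meridianTangent θ)).deriv

/-- Equivariance differentiated in φ at 0; it lets immersion and isometry hypotheses be tested on
the orbit direction. -/
lemma rotGen_curve (hF : ContDiff ℝ ∞ F) (hax : Axisymmetric F) (θ : ℝ) :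
    rotGen (curve F θ) = fderiv ℝ F (meridian θ) (orbitTangent θ) := by
  have h1 : HasDerivAt (fun φ => rot3 φ (meridian θ)) (orbitTangent θ) 0 := by
    rw [hasDerivAt_pi]
    intro i
    fin_cases i
    · simpa [rot3, meridian, orbitTangent] using
        (Real.hasDerivAt_cos 0).mul_const (Real.sin θ)
    · simpa [rot3, meridian, orbitTangent] using
        (Real.hasDerivAt_sin 0).mul_const (Real.sin θ)
    · exact hasDerivAt_const _ _
  have h2 : HasDerivAt (fun φ => rot4 φ (curve F θ)) (rotGen (curve F θ)) 0 := by
    rw [hasDerivAt_pi]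
    intro i
    fin_cases i
    · exact hasDerivAt_const _ _
    · simpa [rot4, rotGen] using ((Real.hasDerivAt_cos 0).mul_const (curve F θ 1)).fun_sub
        ((Real.hasDerivAt_sin 0).mul_const (curve F θ 2))
    · simpa [rot4, rotGen] using ((Real.hasDerivAt_sin 0).mul_const (curve F θ 1)).fun_add
        ((Real.hasDerivAt_cos 0).mul_const (curve F θ 2))
    · exact hasDerivAt_const _ _
  have e0 : rot3 0 (meridian θ) = meridian θ := by
    ext i; fin_cases i <;> simp [rot3, meridian]
  have h3 := (hF.differentiable (by simp) (rot3 0 (meridian θ))).hasFDerivAt.comp_hasDerivAt 0 h1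
  rw [e0] at h3
  have e : F ∘ (fun φ => rot3 φ (meridian θ)) = fun φ => rot4 φ (curve F θ) :=
    funext fun φ => (hax _ (meridian_mem θ)).1 φ
  rw [e] at h3
  exact h2.unique h3

lemma curve_reflect (hax : Axisymmetric F) (ha : a = 0 ∨ a = Real.pi) (t : ℝ) :
    curve F (2 * a - t) = rot4 Real.pi (curve F t) := by
  rcases ha with rfl | rfl
  · rw [mul_zero, zero_sub, curve_neg hax]
  · rw [curve_periodic, curve_neg hax]

lemma curve_one_pole (hax : Axisymmetric F) (ha : a = 0 ∨ a = Real.pi) : curve F a 1 = 0 := by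
  have := congrFun (curve_reflect hax ha a) 1
  rw [two_mul, add_sub_cancel_right, rot4_pi] at this
  simp at this
  linarith

/-- Differentiating the reflection through the pole gives −c' = R_π c', so the t- and z-components
vanish; the y-component is zero along the whole meridian. The curve thus meets the axis
orthogonally. -/
lemma deriv_curve_pole (hF : ContDiff ℝ ∞ F) (hax : Axisymmetric F) (ha : a = 0 ∨ a = Real.pi) :
    deriv (curve F) a 0 = 0 ∧ deriv (curve F) a 2 = 0 ∧ deriv (curve F) a 3 = 0 := by
  have hd : ∀ t, HasDerivAt (curve F) (deriv (curve F) t) t := fun t =>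
    ((contDiff_curve hF).differentiable (by simp) t).hasDerivAt
  have h1 : HasDerivAt (fun t => curve F (2 * a - t)) (-deriv (curve F) a) a := by
    have := (hd (2 * a - a)).scomp a ((hasDerivAt_id a).const_sub (2 * a))
    rw [two_mul, add_sub_cancel_right] at this
    rw [two_mul]
    exact this.congr_deriv (by simp)
  have h2 : HasDerivAt (fun t => rot4 Real.pi (curve F t)) (rot4 Real.pi (deriv (curve F) a)) a :=
    (rotL Real.pi).hasFDerivAt.comp_hasDerivAt a (hd a)
  have e : (fun t => curve F (2 * a - t)) = fun t => rot4 Real.pi (curve F t) :=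
    funext (curve_reflect hax ha)
  rw [e] at h1
  have h3 := h1.unique h2
  rw [rot4_pi] at h3
  have c0 := congrFun h3 0
  have c3 := congrFun h3 3
  simp at c0 c3
  refine ⟨by linarith, ?_, by linarith⟩
  have h4 : HasDerivAt (fun t => curve F t 2) (deriv (curve F) a 2) a := hasDerivAt_pi.1 (hd a) 2
  rw [show (fun t => curve F t 2) = fun _ => 0 from funext (curve_two hax)] at h4
  exact h4.unique (hasDerivAt_const a 0)

lemma fderiv_ne_zero_of_immersed (hi : IsImmersedSphere F) {v : R3}
    (hv : IsTangent (meridian θ) v) (hv0 : v ≠ 0) : fderiv ℝ F (meridian θ) v ≠ 0 :=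
  fun h => hv0 (hi _ (meridian_mem θ) v hv h)

lemma meridianTangent_ne_zero (θ : ℝ) : meridianTangent θ ≠ 0 := by
  intro h
  have h0 : Real.cos θ = 0 := congrFun h 0
  have h2 := congrFun h 2
  simp [meridianTangent] at h2
  nlinarith [Real.sin_sq_add_cos_sq θ]

lemma isSliceProfile_curve (hg : IsAxisymmetricSpacetime U g) (hF : ContDiff ℝ ∞ F)
    (hi : IsImmersedSphere F) (hm : ∀ x ∈ unitSphere, F x ∈ U) (h0 : ∀ x ∈ unitSphere, F x 0 = 0)
    (hax : Axisymmetric F) : IsSliceProfile U g (curve F) where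
  spacetime := hg
  smooth := contDiff_curve hF
  mem := fun θ => hm _ (meridian_mem θ)
  two := curve_two hax
  zero := fun θ => h0 _ (meridian_mem θ)
  speedSq_pos := fun θ => by
    refine hg.slice_spacelike _ (hm _ (meridian_mem θ)) (h0 _ (meridian_mem θ)) _ ?_ ?_
    · have h1 : HasDerivAt (fun t => curve F t 0) (deriv (curve F) θ 0) θ :=
        hasDerivAt_pi.1 ((contDiff_curve hF).differentiable (by simp) θ).hasDerivAt 0
      rw [show (fun t => curve F t 0) = fun _ => 0 from funext fun t => h0 _ (meridian_mem t)] at h1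
      exact h1.unique (hasDerivAt_const θ 0)
    · rw [deriv_curve hF]
      exact fderiv_ne_zero_of_immersed hi (isTangent_meridian θ) (meridianTangent_ne_zero θ)
  orbitSq_pos := fun θ hθ => by
    refine hg.slice_spacelike _ (hm _ (meridian_mem θ)) (h0 _ (meridian_mem θ)) _ rfl ?_
    rw [rotGen_curve hF hax]
    refine fderiv_ne_zero_of_immersed hi (isTangent_orbit θ) fun h => ?_
    have h1 : Real.sin θ = 0 := congrFun h 1
    exact (Real.sin_pos_of_pos_of_lt_pi hθ.1 hθ.2).ne' h1

/-- All other components vanish at the pole, so positive speed leaves this one nonzero. -/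
lemma deriv_curve_one_ne_zero (h : IsSliceProfile U g (curve F)) (hF : ContDiff ℝ ∞ F)
    (hax : Axisymmetric F) (ha : a = 0 ∨ a = Real.pi) : deriv (curve F) a 1 ≠ 0 := by
  intro h1
  obtain ⟨h0, h2, h3⟩ := deriv_curve_pole hF hax ha
  have h4 : deriv (curve F) a = 0 := by
    ext i; fin_cases i <;> simp [h0, h1, h2, h3]
  have := h.speedSq_pos a
  rw [speedSq, h4] at this
  simp [ip] at this

lemma speedSq_reference (hF : ContDiff ℝ ∞ F) (hG : ContDiff ℝ ∞ G)
    (hiso : IsIsometricReference g F G) : speedSq flat (curve G) = speedSq g (curve F) := by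
  ext θ
  rw [speedSq, speedSq, deriv_curve hF, deriv_curve hG]
  exact hiso _ (meridian_mem θ) _ _ (isTangent_meridian θ) (isTangent_meridian θ)

lemma orbitSq_reference (hF : ContDiff ℝ ∞ F) (hG : ContDiff ℝ ∞ G) (hax : Axisymmetric F)
    (hax' : Axisymmetric G) (hiso : IsIsometricReference g F G) :
    orbitSq flat (curve G) = orbitSq g (curve F) := by
  ext θ
  rw [orbitSq, orbitSq, rotGen_curve hF hax, rotGen_curve hG hax']
  exact hiso _ (meridian_mem θ) _ _ (isTangent_orbit θ) (isTangent_orbit θ)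

lemma isProfile_reference (h : IsSliceProfile U g (curve F)) (hF : ContDiff ℝ ∞ F)
    (hG : ContDiff ℝ ∞ G) (hax : Axisymmetric F) (hax' : Axisymmetric G)
    (hiso : IsIsometricReference g F G) : IsProfile univ flat (curve G) where
  spacetime := isAxisymmetricSpacetime_flat
  smooth := contDiff_curve hG
  mem := fun _ => mem_univ _
  two := curve_two hax'
  speedSq_pos := fun θ => by rw [speedSq_reference hF hG hiso]; exact h.speedSq_pos θ
  orbitSq_pos := fun θ hθ => by
    rw [orbitSq_reference hF hG hax hax' hiso]; exact h.orbitSq_pos θ hθ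

/-- The reference pair of a sphere with an isometric reference. -/
lemma exists_isClosedPair (h : IsSliceProfile U g (curve F)) (hF : ContDiff ℝ ∞ F)
    (hG : ContDiff ℝ ∞ G) (hax : Axisymmetric F) (hax' : Axisymmetric G)
    (hiso : IsIsometricReference g F G) {s : ℝ} (hs : 0 < s) {m α : ℝ → ℝ}
    (hd : IsSliceData g (curve F) s m α) (hH₀ : ∀ y ∈ polarDomain, 0 < meanCurvSq flat (patch G) y) :
    ∃ f, IsClosedPair U g (curve F) (curve G) s m α f := by
  have hP := isProfile_reference h hF hG hax hax' hiso
  rw [patch_eq_spin hax'] at hH₀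
  obtain ⟨c, hc⟩ := hP.exists_isReferenceData hH₀
  have hr : ∀ a, (a = 0 ∨ a = Real.pi) → radius g (curve F) a = 0 := fun a ha => by
    rw [h.radius_eq_abs, axisDist, curve_one_pole hax ha]; simp
  have hf : ∀ a, (a = 0 ∨ a = Real.pi) → c * refNormal (curve G) a 1 = 0 := fun a ha => by
    rw [IsProfile.refNormal_one, (deriv_curve_pole hG hax' ha).2.2, zero_div, mul_zero]
  exact ⟨_, { slice := h, s_pos := hs, data := hd, ref := hc
              speed_eq := by
                ext θ; rw [speed, speed, speedSq_reference hF hG hiso]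
              radius_eq := by
                ext θ; rw [radius, radius, orbitSq_reference hF hG hax hax' hiso]
              radius_zero := hr 0 (Or.inl rfl)
              radius_pi := hr _ (Or.inr rfl)
              f_zero := hf 0 (Or.inl rfl)
              f_pi := hf _ (Or.inr rfl) }⟩

end Sphere

/-! ### Time symmetry -/

lemma ip_timeNormal_chr {g : R4 → Form} {p v w : R4} (hv : v 0 = 0) (hw : w 0 = 0)
    (h : ∀ i j : Fin 4, i ≠ 0 → j ≠ 0 → sliceSecondForm g p i j = 0) :
    ip (g p) (timeNormal (g p)) (chr g p v w) = 0 := by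
  have e : chr g p v w = ∑ i, ∑ j, (v i * w j) • fun μ => christoffel g p μ i j := by
    ext μ
    simp only [chr, Finset.sum_apply, Pi.smul_apply, smul_eq_mul]
    exact Finset.sum_congr rfl fun i _ => Finset.sum_congr rfl fun j _ => by ring
  have hsum : ∀ (V : Fin 4 → R4), ip (g p) (timeNormal (g p)) (∑ i, V i)
      = ∑ i, ip (g p) (timeNormal (g p)) (V i) := fun V => by
    simp [Fin.sum_univ_four, ip_add_right]
  rw [e, hsum]
  refine Finset.sum_eq_zero fun i _ => ?_
  rw [hsum]
  refine Finset.sum_eq_zero fun j _ => ?_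
  rw [ip_smul_right]
  by_cases hi : i = 0
  · rw [hi, hv]; ring
  by_cases hj : j = 0
  · rw [hj, hw]; ring
  have := h i j hi hj
  rw [sliceSecondForm, neg_eq_zero] at this
  rw [this, mul_zero]

/-- In a time symmetric slice the normal of the slice has no expansion. -/
lemma IsSliceProfile.profileExpansion_eq_zero {U : Set R4} {g : R4 → Form} {γ : ℝ → R4} {θ : ℝ}
    (h : IsSliceProfile U g γ) (ht : IsTimeSymmetric U g) (hθ : θ ∈ Ioo 0 Real.pi) :
    profileExpansion g γ (timeField g γ) θ = 0 := by
  have hy : meridianPoint θ ∈ polarDomain := meridianPoint_mem hθ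
  set y := meridianPoint θ with hydef
  have hFS := h.isFramedSurface (fun θ _ => h.isProfileFrame (σ := 1) (by norm_num) θ)
  have hp0 : ∀ a z, pd a (spin γ) z 0 = 0 := by
    intro a z
    fin_cases a
    · change pd 0 (spin γ) z 0 = 0
      rw [h.pd_zero]; exact h.deriv_zero _
    · change pd 1 (spin γ) z 0 = 0
      rw [h.pd_one]; rfl
  have hX := h.spin_mem y
  have hip : ∀ w : R4, w 0 = 0 → ip (g (spin γ y)) (spin (timeField g γ) y) w = 0 := by
    intro w hw
    rw [← h.sliceNormal_spin, sliceNormal, ip_timeNormal (h.spacetime.lorentzian _ hX), hw]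
    simp
  -- The derivative is moved from u to the tangent field. As ∂_b X has no time component, only the
  -- second fundamental form of the slice remains.
  have key : ∀ a b, ip (g (spin γ y)) (covD g (spin γ) a (spin (timeField g γ)) y)
      (pd b (spin γ) y) = 0 := by
    intro a b
    have hsm := contDiffAt_pd (hFS.smooth y hy) b
    rw [hFS.ip_covD_of_const (c := 0) hy (hFS.smooth_T y hy) hsm (fun z hz => ?_) a, covD_eq,
      ip_add_right, hip, ← h.sliceNormal_spin, sliceNormal, ip_timeNormal_chr (hp0 a y) (hp0 b y)
        (ht _ hX (h.zero _))]
    · simp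
    · have h1 : HasFDerivAt (fun z => pd b (spin γ) z 0) _ y :=
        hasFDerivAt_pi'.1 (hsm.differentiableAt (by simp)).hasFDerivAt 0
      rw [show (fun z => pd b (spin γ) z 0) = fun _ => (0:ℝ) from funext (hp0 b)] at h1
      have h2 := h1.unique (hasFDerivAt_const (0:ℝ) y)
      exact DFunLike.congr_fun h2 (Pi.single a 1)
    · rw [← h.sliceNormal_spin, sliceNormal,
        ip_timeNormal (h.spacetime.lorentzian _ (h.spin_mem z)), hp0]
      simp
  have e := h.expansion_spin hy (h.contDiff_timeField.differentiable (by simp) (y 0))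
  have e2 : expansion g (spin γ) (spin (timeField g γ)) y = 0 := by
    simp [expansion, key]
  rw [e2] at e
  exact e.symm

end
end WangYau

namespace WangYau
noncomputable section

/-! ### Convergence of the profile curves of a family -/

section Limits

variable {U : Set R4} {g : R4 → Form} {s₀ : ℝ} {F : ℝ → R3 → R4}

/-- A constant family converges. -/
lemma isProfileLimit_pure {γ : ℝ → ℝ → R4} {s : ℝ} (h : IsSliceProfile U g (γ s))
    (h0 : γ s 0 1 = 0) (hπ : γ s Real.pi 1 = 0) (d0 : deriv (γ s) 0 1 ≠ 0)
    (dπ : deriv (γ s) Real.pi 1 ≠ 0) : IsProfileLimit U g (pure s) γ (γ s) where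
  slice := h
  limit := h
  axis_zero := h0
  axis_pi := hπ
  ne_zero := fun θ hθ h1 => by
    have := h.orbitSq_pos θ hθ
    rw [h.orbitSq_eq, h1] at this
    simp at this
  limit_zero := h0
  limit_pi := hπ
  pole_zero := d0
  pole_pi := dπ
  tendsto := fun θ => by
    rw [pure_prod, tendsto_map'_iff]
    exact (h.smooth.continuous.prodMk (contDiff_deriv h.smooth).continuous).tendsto θ
  tendsto_deriv := fun θ => by
    rw [pure_prod, tendsto_map'_iff]
    exact (contDiff_deriv (contDiff_deriv h.smooth)).continuous.tendsto θ

lemma IsConstantExpansionFamily.isSliceProfile (hg : IsAxisymmetricSpacetime U g)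
    (h : IsConstantExpansionFamily U g s₀ F) {s : ℝ} (hs : s ∈ Ico 0 s₀) :
    IsSliceProfile U g (curve (F s)) :=
  isSliceProfile_curve hg (h.smooth s hs) (h.immersed s hs) (h.mem s hs) (h.mem_slice s hs)
    (h.axisymmetric s hs)

/-- Families are taken along s ≥ 0, so that the limit surface is itself a member and its strict
inequality Θ₋ < 0 can be propagated. -/
lemma nhdsGE_eq_sup (a : ℝ) : 𝓝[≥] a = pure a ⊔ 𝓝[>] a := by
  rw [← Ioi_insert, nhdsWithin_insert]

/-- Uniform convergence together with continuity of the limit gives convergence jointly in the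
parameter and the point. -/
lemma IsConstantExpansionFamily.tendsto_iteratedFDeriv (h : IsConstantExpansionFamily U g s₀ F)
    (hs₀ : 0 < s₀) (n : ℕ) (θ : ℝ) :
    Tendsto (fun z : ℝ × ℝ => iteratedFDeriv ℝ n (F z.1) (meridian z.2)) (𝓝[≥] 0 ×ˢ 𝓝 θ)
      (𝓝 (iteratedFDeriv ℝ n (F 0) (meridian θ))) := by
  have h1 : Tendsto (fun z : ℝ × ℝ => iteratedFDeriv ℝ n (F 0) (meridian z.2)) (𝓝[≥] 0 ×ˢ 𝓝 θ)
      (𝓝 (iteratedFDeriv ℝ n (F 0) (meridian θ))) :=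
    (((h.smooth 0 ⟨le_rfl, hs₀⟩).continuous_iteratedFDeriv (m := n)
      (by exact_mod_cast le_top)).comp contDiff_meridian.continuous).continuousAt.tendsto.comp tendsto_snd
  refine h1.congr_uniformity ?_
  rw [nhdsGE_eq_sup, sup_prod, tendsto_sup]
  constructor
  · rw [pure_prod, tendsto_map'_iff]
    exact tendsto_diag_uniformity _ _
  · have h2 := tendstoUniformlyOn_iff_tendsto.1 (h.converges n)
    have h3 : Tendsto (fun z : ℝ × ℝ => (z.1, meridian z.2)) (𝓝[>] 0 ×ˢ 𝓝 θ)
        (𝓝[>] 0 ×ˢ 𝓟 unitSphere) :=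
      tendsto_fst.prodMk (tendsto_principal.2 (Eventually.of_forall fun z => meridian_mem z.2))
    exact h2.comp h3

/-- The profile curves of the family converge. -/
lemma IsConstantExpansionFamily.isProfileLimit (hg : IsAxisymmetricSpacetime U g)
    (h : IsConstantExpansionFamily U g s₀ F) (hs₀ : 0 < s₀) :
    IsProfileLimit U g (𝓝[≥] 0) (fun s => curve (F s)) (curve (F 0)) := by
  have hmem : Ico 0 s₀ ∈ 𝓝[≥] (0 : ℝ) := Ico_mem_nhdsGE hs₀
  have h0 : (0 : ℝ) ∈ Ico 0 s₀ := ⟨le_rfl, hs₀⟩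
  have hS := h.isSliceProfile hg h0
  have hP := isProfileLimit_pure (γ := fun s => curve (F s)) (s := 0) hS
    (curve_one_pole (h.axisymmetric 0 h0) (Or.inl rfl))
    (curve_one_pole (h.axisymmetric 0 h0) (Or.inr rfl))
    (deriv_curve_one_ne_zero hS (h.smooth 0 h0) (h.axisymmetric 0 h0) (Or.inl rfl))
    (deriv_curve_one_ne_zero hS (h.smooth 0 h0) (h.axisymmetric 0 h0) (Or.inr rfl))
  have eval : ∀ (n : ℕ) (V : ℝ → Fin n → R3) (θ : ℝ), Continuous V →
      Tendsto (fun z : ℝ × ℝ => iteratedFDeriv ℝ n (F z.1) (meridian z.2) (V z.2)) (𝓝[≥] 0 ×ˢ 𝓝 θ)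
        (𝓝 (iteratedFDeriv ℝ n (F 0) (meridian θ) (V θ))) := fun n V θ hV =>
    (continuous_eval.tendsto (iteratedFDeriv ℝ n (F 0) (meridian θ), V θ)).comp
      ((h.tendsto_iteratedFDeriv hs₀ n θ).prodMk_nhds ((hV.tendsto θ).comp tendsto_snd))
  have hc : ∀ θ, Tendsto (fun z : ℝ × ℝ => F z.1 (meridian z.2)) (𝓝[≥] 0 ×ˢ 𝓝 θ)
      (𝓝 (F 0 (meridian θ))) := fun θ => by
    simpa using eval 0 (fun _ i => i.elim0) θ continuous_const
  have hT : Continuous meridianTangent :=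
    continuous_iff_continuousAt.2 fun θ => (hasDerivAt_meridianTangent θ).continuousAt
  have hM : Continuous meridian := contDiff_meridian.continuous
  have hev : ∀ θ, ∀ᶠ z : ℝ × ℝ in 𝓝[≥] (0:ℝ) ×ˢ 𝓝 θ, z.1 ∈ Ico 0 s₀ := fun θ =>
    Eventually.prod_inl hmem _
  refine { hP with
    slice := by filter_upwards [hmem] with s hs using h.isSliceProfile hg hs
    axis_zero := by
      filter_upwards [hmem] with s hs using curve_one_pole (h.axisymmetric s hs) (Or.inl rfl)
    axis_pi := by
      filter_upwards [hmem] with s hs using curve_one_pole (h.axisymmetric s hs) (Or.inr rfl)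
    tendsto := fun θ => (hc θ).prodMk_nhds ?_
    tendsto_deriv := fun θ => ?_ }
  · have h1 := eval 1 (fun t _ => meridianTangent t) θ (continuous_pi fun _ => hT)
    simp only [iteratedFDeriv_one_apply] at h1
    rw [deriv_curve (h.smooth 0 h0)]
    refine h1.congr' ?_
    filter_upwards [hev θ] with z hz
    rw [deriv_curve (h.smooth _ hz)]
  · have h1 := eval 1 (fun t _ => -meridian t) θ (continuous_pi fun _ => hM.neg)
    have h2 := eval 2 (fun t _ => meridianTangent t) θ (continuous_pi fun _ => hT)
    simp only [iteratedFDeriv_one_apply] at h1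
    simp only [iteratedFDeriv_two_apply] at h2
    rw [deriv_deriv_curve (h.smooth 0 h0)]
    refine (h2.add h1).congr' ?_
    filter_upwards [hev θ] with z hz
    rw [deriv_deriv_curve (h.smooth _ hz)]

end Limits

end
end WangYau

namespace WangYau
noncomputable section

/-! ### Solutions of the optimal embedding equation along the family -/

/-- The centre (log s)/2 diverges as s → 0, which is harmless: only the oscillation of the slip
angle enters the estimates. -/
lemma abs_slipAngle_sub_le {s m a b : ℝ} (hs : 0 < s) (ha : 0 < a) (h1 : a ≤ m) (h2 : m ≤ b) :
    |slipAngle s m - Real.log s / 2| ≤ (|Real.log a| + |Real.log b|) / 2 := by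
  have hm := ha.trans_le h1
  rw [slipAngle_eq hs hm]
  have e1 := Real.log_le_log ha h1
  have e2 := Real.log_le_log hm h2
  rw [abs_le]
  constructor <;> linarith [neg_abs_le (Real.log a), le_abs_self (Real.log b),
    abs_nonneg (Real.log a), abs_nonneg (Real.log b)]

/-- The data of a member of the family: the sign of the outward normal, the length of the mean
curvature vector, and the reference surface. -/
structure IsMember (U : Set R4) (g : R4 → Form) (F G : R3 → R4) (s σ : ℝ) (m f : ℝ → ℝ) :
    Prop where
  pair : IsClosedPair U g (curve F) (curve G) s m (fun θ => σ * sliceConnection g (curve F) θ) f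
  sign_sq : σ ^ 2 = 1
  sign_pos : ∀ θ ∈ Ioo 0 Real.pi, 0 < σ * curve F θ 1
  m_eq : ∀ θ ∈ Ioo 0 Real.pi,
    m θ = s - 2 * profileExpansion g (curve F) (timeField g (curve F)) θ
  tilt_zero : tilt g (curve F) (curve G) 0 = 0

section Member

variable {U : Set R4} {g : R4 → Form} {s₀ s σ : ℝ} {F G : R3 → R4} {m f : ℝ → ℝ}

lemma exists_isMember (h : IsSliceProfile U g (curve F)) (hF : ContDiff ℝ ∞ F)
    (hG : ContDiff ℝ ∞ G) (hax : Axisymmetric F) (hax' : Axisymmetric G)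
    (hiso : IsIsometricReference g F G) (hs : 0 < s)
    (hΘ : ∀ y ∈ polarDomain, thetaPlus g (patch F) y = s)
    (hH : SpacelikeMeanCurvature g F) (hH₀ : SpacelikeMeanCurvature flat G) :
    ∃ σ m f, IsMember U g F G s σ m f := by
  obtain ⟨σ, hσ, hR⟩ := h.exists_sign
  obtain ⟨c, hc, hcH⟩ := hH
  obtain ⟨c₀, hc₀, hcH₀⟩ := hH₀
  rw [patch_eq_spin hax] at hΘ hcH
  have hd := h.isSliceData hσ hR hs hΘ fun y hy => hc.trans_le (hcH y hy)
  obtain ⟨f, hf⟩ := exists_isClosedPair h hF hG hax hax' hiso hs hd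
    fun y hy => hc₀.trans_le (hcH₀ y hy)
  refine ⟨σ, _, f, hf, hσ, hR, fun θ hθ => ?_, ?_⟩
  · have h1 := hΘ _ (meridianPoint_mem hθ)
    rw [(h.thetas_spin hσ hR (meridianPoint_mem hθ)).1] at h1
    change profileExpansion g (curve F) (timeField g (curve F)) θ
      + σ * profileExpansion g (curve F) (normalField g (curve F)) θ = s at h1
    linarith
  · rw [tilt, (deriv_curve_pole hG hax' (Or.inl rfl)).1, zero_div]

/-- Each member of the family satisfies the geometric bounds for some constants. -/
lemma IsMember.exists_bounds (h : IsMember U g F G s σ m f) (hF : ContDiff ℝ ∞ F)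
    (hax : Axisymmetric F) (hH : SpacelikeMeanCurvature g F) :
    ∃ Λ d ε, ProfileBounds g (curve F) s m (fun θ => σ * sliceConnection g (curve F) θ) Λ d ε := by
  have hS := h.pair.slice
  -- A single surface is treated as a family over the filter `pure s`, so the uniform bounds
  -- specialize to it.
  have hL := isProfileLimit_pure (γ := fun _ => curve F) (s := s) hS
    (curve_one_pole hax (Or.inl rfl)) (curve_one_pole hax (Or.inr rfl))
    (deriv_curve_one_ne_zero hS hF hax (Or.inl rfl))
    (deriv_curve_one_ne_zero hS hF hax (Or.inr rfl))
  obtain ⟨Λ, d, hB⟩ := hL.exists_profileBounds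
  obtain ⟨C, hC⟩ := hL.exists_expansion_bound
  rw [eventually_pure] at hB hC
  obtain ⟨c, hc, hcH⟩ := hH
  rw [patch_eq_spin hax] at hcH
  have hs := h.pair.s_pos
  have hlow : ∀ θ ∈ Ioo 0 Real.pi, c / s ≤ m θ := fun θ hθ => by
    rw [div_le_iff₀ hs, mul_comm]
    have := hcH _ (meridianPoint_mem hθ)
    rwa [h.pair.data.meanCurvSq_eq _ (meridianPoint_mem hθ)] at this
  have hupp : ∀ θ ∈ Ioo 0 Real.pi, m θ ≤ s + 2 * C := fun θ hθ => by
    rw [h.m_eq θ hθ]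
    linarith [(abs_le.1 (hC θ hθ)).1]
  refine ⟨max Λ ((|Real.log (c / s)| + |Real.log (s + 2 * C)|) / 2), d, √(s * (s + 2 * C)),
    hB _ (le_max_left _ _) σ h.sign_sq h.sign_pos s m _ ⟨Real.log s / 2, fun θ hθ => ?_⟩
      fun θ hθ => ?_⟩
  · exact (abs_slipAngle_sub_le hs (div_pos hc hs) (hlow θ hθ) (hupp θ hθ)).trans (le_max_right _ _)
  · exact Real.sqrt_le_sqrt (mul_le_mul_of_nonneg_left (hupp θ hθ) hs.le)

lemma IsMember.differentiableAt_connection (h : IsMember U g F G s σ m f) (θ : ℝ) :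
    DifferentiableAt ℝ (fun θ => σ * sliceConnection g (curve F) θ) θ := by
  have hS := h.pair.slice
  have h1 : ContDiffAt ℝ ∞ (sliceConnection g (curve F)) θ :=
    hS.spacetime.contDiffAt_ip hS.smooth.contDiffAt (hS.mem θ)
      ((contDiff_deriv hS.contDiff_normalField).contDiffAt.add (hS.spacetime.contDiffAt_chr
        hS.smooth.contDiffAt (hS.mem θ) (contDiff_deriv hS.smooth).contDiffAt
        hS.contDiff_normalField.contDiffAt)) hS.contDiff_timeField.contDiffAt
  exact (h1.differentiableAt (by simp)).const_mul σ

lemma IsMember.profileFlux_eq_zero (h : IsMember U g F G s σ m f) (hF : ContDiff ℝ ∞ F)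
    (hax : Axisymmetric F) (hax' : Axisymmetric G) (hH : SpacelikeMeanCurvature g F)
    (hO : ∀ y ∈ polarDomain, divergence g (patch F) (flux g (patch F) (patch G)) y = 0) :
    ∀ θ ∈ Ioo 0 Real.pi, profileFlux g (curve F) (curve G) s m
      (fun θ => σ * sliceConnection g (curve F) θ) f θ = 0 := by
  obtain ⟨Λ, d, ε, hB⟩ := h.exists_bounds hF hax hH
  rw [patch_eq_spin hax, patch_eq_spin hax'] at hO
  obtain ⟨C, hC⟩ := h.pair.exists_flux_const (fun θ _ => h.differentiableAt_connection θ) hO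
  exact fun θ hθ => h.pair.profileFlux_eq_zero hB h.tilt_zero hC hθ

end Member

section Family

variable {U : Set R4} {g : R4 → Form} {s₀ : ℝ} {F : ℝ → R3 → R4}

/-- Along the family `|H|² = s m` tends to zero, and the hyperbolic angle between the mean curvature
vector and the frame of the slice is bounded up to constants. -/
lemma exists_slip_bounds (hg : IsAxisymmetricSpacetime U g)
    (h : IsConstantExpansionFamily U g s₀ F) (hs₀ : 0 < s₀)
    (hlimit : InwardTrapped g (F 0) ∨ IsTimeSymmetric U g) :
    ∃ C N, 0 ≤ C ∧ ∀ᶠ s in 𝓝[>] 0, ∀ m : ℝ → ℝ, (∀ θ ∈ Ioo 0 Real.pi,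
        m θ = s - 2 * profileExpansion g (curve (F s)) (timeField g (curve (F s))) θ) →
      (∃ c, ∀ θ ∈ Ioo 0 Real.pi, |slipAngle s (m θ) - c| ≤ N) ∧
      ∀ θ ∈ Ioo 0 Real.pi, √(s * m θ) ≤ √(C * s) := by
  have hs1 : ∀ᶠ s in 𝓝[>] (0 : ℝ), s ∈ Ioo 0 (min s₀ 1) :=
    Ioo_mem_nhdsGT (lt_min hs₀ one_pos)
  have hle : 𝓝[>] (0 : ℝ) ≤ 𝓝[≥] 0 := nhdsWithin_mono _ Ioi_subset_Ici_self
  rcases hlimit with ⟨c, hc, hΘ⟩ | ht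
  · have hL := h.isProfileLimit hg hs₀
    have h0 : (0 : ℝ) ∈ Ico 0 s₀ := ⟨le_rfl, hs₀⟩
    obtain ⟨C, hC⟩ := hL.exists_expansion_bound
    have hS := hL.limit
    obtain ⟨σ, hσ, hR⟩ := hS.exists_sign
    have hk : ∀ θ ∈ Ioo 0 Real.pi,
        profileExpansion g (curve (F 0)) (timeField g (curve (F 0))) θ ≤ -c / 2 := by
      intro θ hθ
      have h1 := hΘ _ (meridianPoint_mem hθ)
      have h2 := h.expansion_eq 0 h0 _ (meridianPoint_mem hθ)
      rw [patch_eq_spin (h.axisymmetric 0 h0)] at h1 h2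
      rw [(hS.thetas_spin hσ hR (meridianPoint_mem hθ)).2] at h1
      rw [(hS.thetas_spin hσ hR (meridianPoint_mem hθ)).1] at h2
      change profileExpansion g (curve (F 0)) (timeField g (curve (F 0))) θ
        - σ * profileExpansion g (curve (F 0)) (normalField g (curve (F 0))) θ ≤ -c at h1
      change profileExpansion g (curve (F 0)) (timeField g (curve (F 0))) θ
        + σ * profileExpansion g (curve (F 0)) (normalField g (curve (F 0))) θ = 0 at h2
      linarith
    -- At s = 0 the expansion of u is half of Θ₋, at most −c/2. Staying below −c/4 for small s gives
    -- m = s − 2k_T ≥ c/2.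
    have hev := hL.eventually_expansion_lt (s₁ := 0) (b' := -c / 4)
      (by rw [nhdsGE_eq_sup]; exact le_sup_left) rfl (by linarith) hk
    refine ⟨1 + 2 * |C|, (|Real.log (c / 2)| + |Real.log (1 + 2 * |C|)|) / 2, by positivity, ?_⟩
    filter_upwards [hs1, hle hC, hle hev] with s hs hCs hevs m hm
    have hlow : ∀ θ ∈ Ioo 0 Real.pi, c / 2 ≤ m θ := fun θ hθ => by
      rw [hm θ hθ]; linarith [hevs θ hθ, hs.1]
    have hupp : ∀ θ ∈ Ioo 0 Real.pi, m θ ≤ 1 + 2 * |C| := fun θ hθ => by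
      rw [hm θ hθ]
      linarith [(abs_le.1 (hCs θ hθ)).1, hs.2, min_le_right s₀ 1, le_abs_self C]
    refine ⟨⟨_, fun θ hθ => abs_slipAngle_sub_le hs.1 (by positivity) (hlow θ hθ) (hupp θ hθ)⟩,
      fun θ hθ => Real.sqrt_le_sqrt ?_⟩
    rw [mul_comm]
    exact mul_le_mul_of_nonneg_right (hupp θ hθ) hs.1.le
  -- In the time symmetric case k_T = 0, so m = s, the slip angle vanishes identically, and |H| = s
  -- ≤ √s because s ≤ 1.
  · refine ⟨1, 0, zero_le_one, ?_⟩
    filter_upwards [hs1] with s hs m hm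
    have hS := h.isSliceProfile hg ⟨hs.1.le, hs.2.trans_le (min_le_left _ _)⟩
    have hm' : ∀ θ ∈ Ioo 0 Real.pi, m θ = s := fun θ hθ => by
      rw [hm θ hθ, hS.profileExpansion_eq_zero ht hθ]; ring
    refine ⟨⟨0, fun θ hθ => ?_⟩, fun θ hθ => Real.sqrt_le_sqrt ?_⟩
    · rw [hm' θ hθ, slipAngle_eq hs.1 hs.1]; simp
    · rw [hm' θ hθ]
      exact mul_le_mul_of_nonneg_right (hs.2.le.trans (min_le_right _ _)) hs.1.le

end Family

end
end WangYau

/-! ### Asymptotics of the reference surfaces and the theorem. -/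

namespace WangYau
noncomputable section

section Asymptotics

variable {U : Set R4} {g : R4 → Form} {s₀ : ℝ} {F G : ℝ → R3 → R4}

/-- Uniform smallness of the tilt and the dilation of the reference surfaces. -/
theorem exists_asymptotics (hg : IsAxisymmetricSpacetime U g)
    (h : IsConstantExpansionFamily U g s₀ F) (hs₀ : 0 < s₀)
    (hlimit : InwardTrapped g (F 0) ∨ IsTimeSymmetric U g) :
    ∃ b : ℝ → ℝ, Tendsto b (𝓝[>] 0) (𝓝 0) ∧ ∀ᶠ s in 𝓝[>] 0, ∀ σ m f,
      IsMember U g (F s) (G s) s σ m f →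
      (∀ θ ∈ Ioo 0 Real.pi, profileFlux g (curve (F s)) (curve (G s)) s m
        (fun θ => σ * sliceConnection g (curve (F s)) θ) f θ = 0) →
      (∀ θ ∈ Ioo 0 Real.pi, |tilt g (curve (F s)) (curve (G s)) θ ^ 2| ≤ b s ∧
        |refDilation (curve (G s)) θ * lorentzFactor (curve (G s)) θ| ≤ b s ∧
        |deriv (curve (G s)) θ 0| ≤ b s) ∧
      |(1 / (8 * Real.pi)) * (∫ y in polarCell,
          massDensity g (spin (curve (F s))) (spin (curve (G s))) y
            * areaDensity g (spin (curve (F s))) y)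
        - (1 / (8 * Real.pi)) * (∫ y in polarCell,
          meanCurvNorm flat (spin (curve (G s))) y
            * areaDensity g (spin (curve (F s))) y)| ≤ b s := by
  obtain ⟨Λ₀, d, hB⟩ := (h.isProfileLimit hg hs₀).exists_profileBounds
  obtain ⟨C, N, hC, hN⟩ := exists_slip_bounds hg h hs₀ hlimit
  -- Λ and the angle bound A are fixed before s, so the smallness conditions follow from |H| ≤ √(C
  -- s) → 0 alone.
  set Λ := max (max Λ₀ N) 1 with hΛ
  have hΛ1 : 1 ≤ Λ := le_max_right _ _
  have hNΛ : N ≤ Λ := (le_max_right _ _).trans (le_max_left _ _)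
  set A := angleConst Λ d with hA
  set e : ℝ → ℝ := fun s => √(C * s) with he
  set K : ℝ → ℝ := fun s => e s * Real.sinh A with hK
  set T : ℝ → ℝ := fun s => 2 * Λ ^ 3 * K s with hT
  have te : Tendsto e (𝓝[>] 0) (𝓝 0) := by
    have : Continuous e := (continuous_const.mul continuous_id).sqrt
    have h1 := this.tendsto 0
    simp only [he, mul_zero, Real.sqrt_zero] at h1
    exact h1.mono_left nhdsWithin_le_nhds
  have tK : Tendsto K (𝓝[>] 0) (𝓝 0) := by simpa using te.mul_const (Real.sinh A)
  have tT : Tendsto T (𝓝[>] 0) (𝓝 0) := by simpa using tK.const_mul (2 * Λ ^ 3)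
  -- A common bound: every summand is nonnegative once the estimates hold, so each estimate is
  -- dominated by the sum.
  set P : ℝ → ℝ := fun s => T s ^ 2 + K s * (1 + T s) + Λ * T s +
    |T s * (curvatureConst Λ * Real.pi) + (e s + 2 * K s) * (Λ ^ 2 * Real.pi * Real.pi)| with hP
  have tP : Tendsto P (𝓝[>] 0) (𝓝 0) := by
    have h1 := (((tT.pow 2).add (tK.mul (tT.const_add 1))).add (tT.const_mul Λ)).add
      ((tT.mul_const (curvatureConst Λ * Real.pi)).add
        ((te.add (tK.const_mul 2)).mul_const (Λ ^ 2 * Real.pi * Real.pi))).abs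
    simpa using h1
  have hle : 𝓝[>] (0 : ℝ) ≤ 𝓝[≥] 0 := nhdsWithin_mono _ Ioi_subset_Ici_self
  have sm1 : ∀ᶠ s in 𝓝[>] (0 : ℝ), e s * Real.cosh A < 1 :=
    (by simpa using te.mul_const (Real.cosh A) :
      Tendsto (fun s => e s * Real.cosh A) (𝓝[>] 0) (𝓝 0)).eventually_lt_const one_pos
  have sm2 : ∀ᶠ s in 𝓝[>] (0 : ℝ), K s < 1 := tK.eventually_lt_const one_pos
  have sm3 : ∀ᶠ s in 𝓝[>] (0 : ℝ), Λ * K s * Real.pi < 1 / 2 :=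
    (by simpa using (tK.const_mul Λ).mul_const Real.pi :
      Tendsto (fun s => Λ * K s * Real.pi) (𝓝[>] 0) (𝓝 0)).eventually_lt_const (by norm_num)
  refine ⟨P, tP, ?_⟩
  filter_upwards [hle hB, hN, sm1, sm2, sm3] with s hB hN sm1 sm2 sm3 σ m f hM hj
  obtain ⟨⟨c, hc⟩, hn⟩ := hN m hM.m_eq
  have B := hB Λ ((le_max_left _ _).trans (le_max_left _ _)) σ hM.sign_sq hM.sign_pos s m (e s)
    ⟨c, fun θ hθ => (hc θ hθ).trans hNΛ⟩ hn
  have p := hM.pair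
  have hx : ∀ θ ∈ Ioo 0 Real.pi, |refDilation (curve (G s)) θ| ≤ K s := fun θ hθ =>
    p.abs_refDilation_le B hj sm1.le hθ
  have ht : ∀ θ ∈ Ioo 0 Real.pi, |tilt g (curve (F s)) (curve (G s)) θ| ≤ T s := fun θ hθ =>
    p.abs_tilt_le_of_dilation B hx sm3.le hθ
  have hp : Real.pi / 2 ∈ Ioo 0 Real.pi := ⟨by linarith [Real.pi_pos], by linarith [Real.pi_pos]⟩
  have K0 : 0 ≤ K s := (abs_nonneg _).trans (hx _ hp)
  have T0 : 0 ≤ T s := (abs_nonneg _).trans (ht _ hp)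
  have a1 : 0 ≤ T s ^ 2 := sq_nonneg _
  have a2 : 0 ≤ K s * (1 + T s) := by positivity
  have a3 : 0 ≤ Λ * T s := by positivity
  have a4 := abs_nonneg
    (T s * (curvatureConst Λ * Real.pi) + (e s + 2 * K s) * (Λ ^ 2 * Real.pi * Real.pi))
  refine ⟨fun θ hθ => ⟨?_, ?_, ?_⟩, ?_⟩
  · have h1 : |tilt g (curve (F s)) (curve (G s)) θ ^ 2| ≤ T s ^ 2 := by
      rw [abs_pow]
      have := ht θ hθ
      gcongr
    simp only [hP]; linarith
  · have h1 : |refDilation (curve (G s)) θ * lorentzFactor (curve (G s)) θ|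
        ≤ K s * (1 + T s) := by
      rw [abs_mul, abs_of_pos (IsProfile.lorentzFactor_pos _ _)]
      exact mul_le_mul (hx θ hθ) ((p.factor_le θ).trans (by linarith [ht θ hθ]))
        (IsProfile.lorentzFactor_pos _ _).le K0
    simp only [hP]; linarith
  · have hsp := p.slice.speed_pos θ
    have h1 : |deriv (curve (G s)) θ 0| ≤ Λ * T s := by
      have e1 : deriv (curve (G s)) θ 0
          = speed g (curve (F s)) θ * tilt g (curve (F s)) (curve (G s)) θ := by
        rw [tilt]; field_simp
      rw [e1, abs_mul, abs_of_pos hsp]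
      exact mul_le_mul (B.speed_le θ hθ) (ht θ hθ) (abs_nonneg _) (by linarith)
    simp only [hP]; linarith
  · have h1 := (p.abs_mass_sub_le B sm2.le hx ht).trans (le_abs_self _)
    refine h1.trans ?_
    simp only [hP]; linarith

end Asymptotics

lemma tendstoUniformlyOn_zero_of_le {ι α : Type*} {l : Filter ι} {q : ι → α → ℝ} {S : Set α}
    {b : ι → ℝ} (hb : Tendsto b l (𝓝 0)) (h : ∀ᶠ s in l, ∀ x ∈ S, |q s x| ≤ b s) :
    TendstoUniformlyOn q (fun _ => 0) l S := by
  rw [Metric.tendstoUniformlyOn_iff]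
  intro ε hε
  filter_upwards [h, hb.eventually_lt_const hε] with s hs hbs x hx
  rw [dist_zero_left, Real.norm_eq_abs]
  exact (hs x hx).trans_lt hbs

/-- Every point of the sphere lies on a rotated meridian. -/
lemma exists_polar {x : R3} (hx : x ∈ unitSphere) :
    ∃ θ ∈ Icc 0 Real.pi, ∃ φ, x = rot3 φ (meridian θ) := by
  have hx' : x 0 ^ 2 + x 1 ^ 2 + x 2 ^ 2 = 1 := hx
  set w : ℂ := ⟨x 0, x 1⟩ with hw
  have hn : ‖w‖ = √(1 - x 2 ^ 2) := by
    rw [Complex.norm_def, Complex.normSq_mk]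
    congr 1; linarith
  refine ⟨Real.arccos (x 2), ⟨Real.arccos_nonneg _, Real.arccos_le_pi _⟩, Complex.arg w, ?_⟩
  have hs : Real.sin (Real.arccos (x 2)) = ‖w‖ := by rw [Real.sin_arccos, hn]
  have hc : Real.cos (Real.arccos (x 2)) = x 2 :=
    Real.cos_arccos (by nlinarith [sq_nonneg (x 0), sq_nonneg (x 1)])
      (by nlinarith [sq_nonneg (x 0), sq_nonneg (x 1)])
  have h1 : ‖w‖ * Real.cos (Complex.arg w) = x 0 := Complex.norm_mul_cos_arg w
  have h2 : ‖w‖ * Real.sin (Complex.arg w) = x 1 := Complex.norm_mul_sin_arg w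
  ext i
  fin_cases i
  · simp [rot3, meridian, hs]; linarith
  · simp [rot3, meridian, hs]; linarith
  · simp [rot3, meridian, hc]

/-- The oscillation of the time function. -/
lemma abs_time_sub_le {G : R3 → R4} (hG : ContDiff ℝ ∞ G) (hax : Axisymmetric G) {b : ℝ}
    (hb : ∀ θ ∈ Ioo 0 Real.pi, |deriv (curve G) θ 0| ≤ b) {x : R3} (hx : x ∈ unitSphere) :
    |G x 0 - G ![0, 0, 1] 0| ≤ b * Real.pi := by
  obtain ⟨θ, hθ, φ, rfl⟩ := exists_polar hx
  have hd : ∀ t, HasDerivAt (fun t => curve G t 0) (deriv (curve G) t 0) t := fun t =>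
    hasDerivAt_pi.1 ((contDiff_curve hG).differentiable (by simp) t).hasDerivAt 0
  have hb0 : 0 ≤ b := (abs_nonneg _).trans
    (hb (Real.pi / 2) ⟨by linarith [Real.pi_pos], by linarith [Real.pi_pos]⟩)
  have e0 : (![0, 0, 1] : R3) = meridian 0 := by
    ext i; fin_cases i <;> simp [meridian]
  rw [(hax _ (meridian_mem θ)).1, e0]
  change |curve G θ 0 - curve G 0 0| ≤ _
  rcases hθ.1.eq_or_lt with h0 | h0
  · rw [← h0, sub_self, abs_zero]
    have := Real.pi_pos
    positivity
  · obtain ⟨t, ht, e⟩ := exists_hasDerivAt_eq_slope (fun t => curve G t 0)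
      (fun t => deriv (curve G) t 0) h0 (fun t _ => (hd t).continuousAt.continuousWithinAt)
      fun t _ => hd t
    rw [eq_div_iff (by linarith), sub_zero] at e
    rw [← e, abs_mul, abs_of_pos h0]
    exact mul_le_mul (hb t ⟨ht.1, ht.2.trans_le hθ.2⟩) hθ.2 h0.le hb0

end
end WangYau

theorem mainTheorem1
    (U : Set R4) (g : R4 → Form) (s₀ : ℝ) (F G : ℝ → R3 → R4)
    (hs₀ : 0 < s₀)
    (hspacetime : IsAxisymmetricSpacetime U g)
    (hfamily : IsConstantExpansionFamily U g s₀ F)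
    (hlimit : InwardTrapped g (F 0) ∨ IsTimeSymmetric U g)
    (hH : ∀ s ∈ Ioo 0 s₀, SpacelikeMeanCurvature g (F s))
    (hG : ∀ s ∈ Ioo 0 s₀, ContDiff ℝ ∞ (G s) ∧ Axisymmetric (G s))
    (hiso : ∀ s ∈ Ioo 0 s₀, IsIsometricReference g (F s) (G s))
    (hH₀ : ∀ s ∈ Ioo 0 s₀, SpacelikeMeanCurvature flat (G s))
    (hOEE : ∀ s ∈ Ioo 0 s₀, ∀ y ∈ polarDomain,
      divergence g (patch (F s)) (flux g (patch (F s)) (patch (G s))) y = 0) :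
    -- the time functions tend to constants, uniformly, with their gradients and Laplacians
    TendstoUniformlyOn (fun s x => G s x 0 - G s ![0, 0, 1] 0) (fun _ => 0) (𝓝[>] 0) unitSphere ∧
    TendstoUniformlyOn (fun s y => gradSq g (patch (F s)) (timeFn (patch (G s))) y) (fun _ => 0)
      (𝓝[>] 0) polarDomain ∧
    TendstoUniformlyOn (fun s y => laplacian g (patch (F s)) (timeFn (patch (G s))) y) (fun _ => 0)
      (𝓝[>] 0) polarDomain ∧
    -- `j = 0` along the family, and so in the limit
    (∀ s ∈ Ioo 0 s₀, ∀ y ∈ polarDomain, ∀ a, flux g (patch (F s)) (patch (G s)) a y = 0) ∧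
    -- the quasi-local mass approaches `(1/8π) ∫ |H₀|`
    Tendsto (fun s => quasiLocalMass g (F s) (G s)
        - surfaceMean g (F s) (meanCurvNorm flat (patch (G s)))) (𝓝[>] 0) (𝓝 0) := by
  have hIco : ∀ s ∈ Ioo 0 s₀, s ∈ Ico 0 s₀ := fun s hs => ⟨hs.1.le, hs.2⟩
  have hpF : ∀ s ∈ Ioo 0 s₀, patch (F s) = spin (curve (F s)) := fun s hs =>
    patch_eq_spin (hfamily.axisymmetric s (hIco s hs))
  have hpG : ∀ s ∈ Ioo 0 s₀, patch (G s) = spin (curve (G s)) := fun s hs =>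
    patch_eq_spin (hG s hs).2
  -- The sign, m and f are chosen for each s separately; the bound `b` below serves every such
  -- choice.
  have hmem : ∀ s ∈ Ioo 0 s₀, ∃ σ m f, IsMember U g (F s) (G s) s σ m f ∧
      ∀ θ ∈ Ioo 0 Real.pi, profileFlux g (curve (F s)) (curve (G s)) s m
        (fun θ => σ * sliceConnection g (curve (F s)) θ) f θ = 0 := by
    intro s hs
    have hF := hfamily.smooth s (hIco s hs)
    have hax := hfamily.axisymmetric s (hIco s hs)
    obtain ⟨σ, m, f, hM⟩ := exists_isMember (hfamily.isSliceProfile hspacetime (hIco s hs)) hF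
      (hG s hs).1 hax (hG s hs).2 (hiso s hs) hs.1 (hfamily.expansion_eq s (hIco s hs)) (hH s hs)
      (hH₀ s hs)
    exact ⟨σ, m, f, hM, hM.profileFlux_eq_zero hF hax (hG s hs).2 (hH s hs) (hOEE s hs)⟩
  obtain ⟨b, hb, hev⟩ := exists_asymptotics (G := G) hspacetime hfamily hs₀ hlimit
  have hs : ∀ᶠ s in 𝓝[>] (0 : ℝ), s ∈ Ioo 0 s₀ := Ioo_mem_nhdsGT hs₀
  refine ⟨?_, ?_, ?_, ?_, ?_⟩
  · refine tendstoUniformlyOn_zero_of_le (b := fun s => b s * Real.pi)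
      (by simpa using hb.mul_const Real.pi) ?_
    filter_upwards [hev, hs] with s hev hs x hx
    obtain ⟨σ, m, f, hM, hj⟩ := hmem s hs
    exact abs_time_sub_le (hG s hs).1 (hG s hs).2
      (fun θ hθ => ((hev σ m f hM hj).1 θ hθ).2.2) hx
  · refine tendstoUniformlyOn_zero_of_le hb ?_
    filter_upwards [hev, hs] with s hev hs y hy
    obtain ⟨σ, m, f, hM, hj⟩ := hmem s hs
    rw [hpF s hs, hpG s hs, hM.pair.gradSq_eq hy]
    exact ((hev σ m f hM hj).1 _ hy).1
  · refine tendstoUniformlyOn_zero_of_le hb ?_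
    filter_upwards [hev, hs] with s hev hs y hy
    obtain ⟨σ, m, f, hM, hj⟩ := hmem s hs
    rw [hpF s hs, hpG s hs, hM.pair.laplacian_eq hy]
    exact ((hev σ m f hM hj).1 _ hy).2.1
  · intro s hs y hy a
    obtain ⟨σ, m, f, hM, hj⟩ := hmem s hs
    have h1 := hM.pair.flux_eq hy
    rw [hpF s hs, hpG s hs]
    fin_cases a
    · exact h1.1.trans (hj _ hy)
    · exact h1.2
  · refine squeeze_zero_norm' ?_ hb
    filter_upwards [hev, hs] with s hev hs
    obtain ⟨σ, m, f, hM, hj⟩ := hmem s hs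
    rw [Real.norm_eq_abs, quasiLocalMass, surfaceMean, surfaceMean, hpF s hs, hpG s hs]
    exact (hev σ m f hM hj).2
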